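/- Let $n\ge 3$, let $\Omega\subset\mathbb{R}^n$ be a bounded open set with $C^2$ boundary, let $\nu$ be its unit outer normal and $dS$ the surface measure on $\partial\Omega$. Let $\widetilde\Omega\subset\mathbb{R}^n$ be open with $\overline\Omega\subset\widetilde\Omega$, and let $\varphi\in C^\infty(\widetilde\Omega,\mathbb{R})$ be a limiting Carleman weight for the semiclassical Laplacian on $\widetilde\Omega$: $\nabla\varphi\neq 0$ on $\widetilde\Omega$ and, with $p_\varphi(x,\xi)=|\xi|^2+2i\nabla\varphi(x)\cdot\xi-|\nabla\varphi(x)|^2$, the Poisson bracket $\{\operatorname{Re}p_\varphi,\operatorname{Im}p_\varphi\}(x,\xi)$ vanishes whenever $p_\varphi(x,\xi)=0$, $(x,\xi)\in\widetilde\Omega\times\mathbb{R}^n$. Put $\partial\Omega_\pm=\{x\in\partial\Omega:\pm\partial_\nu\varphi(x)\ge 0\}$ and let $\nabla_t u=\nabla u-(\partial_\nu u)\nu$ denote the tangential gradient on $\partial\Omega$. For every $M$ there are constants $C>0$ and $h_0>0$, depending only on $\Omega$, $\varphi$ (and $\widetilde\Omega$) and $M$, such that for all $0<h<h_0$, all $A\in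 L^\infty(\Omega,\mathbb{C}^n)$ and $V\in L^\infty(\Omega,\mathbb{C})$ (possibly depending on $h$) with $$\|A\|_{L^\infty(\Omega)}\le M,\qquad \|V\|_{L^\infty(\Omega)}\le \frac{M}{h},$$ and all complex-valued $u\in H^2(\Omega)$, $$ \begin{aligned} h^2&\Big(\|e^{-\varphi/h}u\|^2_{L^2(\Omega)}+\|e^{-\varphi/h}h\nabla u\|^2_{L^2(\Omega)}\Big)+h^3\int_{\partial\Omega_+}(\partial_\nu\varphi)e^{-2\varphi/h}|\partial_\nu u|^2\,dS\\ &\le C h\|e^{-\varphi/h}u\|^2_{L^2(\partial\Omega)}+C h^2\int_{\partial\Omega}e^{-2\varphi/h}|\partial_\nu u||u|\,dS+C h^3\int_{\partial\Omega_-}(-\partial_\nu\varphi)e^{-2\varphi/h}|\partial_\nu u|^2\,dS\\ &\quad+C h^3\|e^{-\varphi/h}\nabla_t u\|^2_{L^2(\partial\Omega)}+C h^3\int_{\partial\Omega}e^{-2\varphi/h}|\nabla_t u||\partial_\nu u|\,dS\\ &\quad+C\big\|e^{-\varphi/h}\big(-h^2\Delta+hA\cdot h\nabla+h^2V\big)u\big\|^2_{L^2(\Omega)}.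 \end{aligned} $$ Here the values of $u$ and $\nabla u$ on $\partial\Omega$ are understood in the sense of traces. -/

import Mathlib

open MeasureTheory Set Filter Topology
open scoped ContDiff ENNReal

noncomputable section

namespace Carleman

/-- Real Euclidean space of dimension `n`. -/
abbrev RSpace (n : ℕ) : Type := EuclideanSpace ℝ (Fin n)

/-- The Hermitian space of complex `n`-vectors. -/
abbrev CSpace (n : ℕ) : Type := EuclideanSpace ℂ (Fin n)

variable {n : ℕ}

/-! ### Domains with `C²` boundary, outer unit normal, surface measure -/

/-- `Ω` has `C²` boundary: near every boundary point, after a choice of a unit direction `e`,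
`Ω` is the set of points below the graph of a `C²` function `γ` of the component of the variable
orthogonal to `e`. -/
def HasC2Boundary (Ω : Set (RSpace n)) : Prop :=
  ∀ x ∈ frontier Ω, ∃ e : RSpace n, ‖e‖ = 1 ∧ ∃ r : ℝ, 0 < r ∧ ∃ γ : RSpace n → ℝ,
    ContDiff ℝ 2 γ ∧
      ∀ y ∈ Metric.ball x r, (y ∈ Ω ↔ inner ℝ e y < γ (y - (inner ℝ e y : ℝ) • e))

/-- `v` is the outer unit normal to `∂Ω` at `x`: near `x` one has `Ω = {ρ < 0}` with `ρ` of class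
`C¹`, `ρ x = 0`, `∇ρ x ≠ 0`, and `v = ∇ρ x / |∇ρ x|`. -/
def IsOuterUnitNormal (Ω : Set (RSpace n)) (x v : RSpace n) : Prop :=
  ∃ ρ : RSpace n → ℝ, ContDiffAt ℝ 1 ρ x ∧ ρ x = 0 ∧ gradient ρ x ≠ 0 ∧
    (∀ᶠ y in 𝓝 x, (y ∈ Ω ↔ ρ y < 0)) ∧ v = ‖gradient ρ x‖⁻¹ • gradient ρ x

open Classical in
/-- The outer unit normal field `ν` of `∂Ω` (with value `0` where there is no outer unit normal). -/
def outerNormal (Ω : Set (RSpace n)) (x : RSpace n) : RSpace n :=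
  if h : ∃ v, IsOuterUnitNormal Ω x v then h.choose else 0

/-- The surface measure `dS` on `∂Ω`: the `(n-1)`-dimensional Hausdorff measure, normalised to
agree with Lebesgue measure on hyperplanes, restricted to `∂Ω`. -/
def surfaceMeasure (Ω : Set (RSpace n)) : Measure (RSpace n) :=
  (Measure.euclideanHausdorffMeasure (n - 1)).restrict (frontier Ω)

/-! ### Limiting Carleman weights -/

/-- The semiclassical principal symbol of `e^{φ/h} (-h² Δ) e^{-φ/h}`,
`p_φ(x, ξ) = |ξ|² + 2 i ∇φ(x) · ξ - |∇φ(x)|²`. -/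
def symbol (φ : RSpace n → ℝ) (x ξ : RSpace n) : ℂ :=
  (‖ξ‖ ^ 2 : ℝ) + 2 * Complex.I * (inner ℝ (gradient φ x) ξ : ℝ) - (‖gradient φ x‖ ^ 2 : ℝ)

/-- The Poisson bracket `{f, g} = ∂_ξ f · ∂_x g - ∂_x f · ∂_ξ g`. -/
def poissonBracket (f g : RSpace n → RSpace n → ℝ) (x ξ : RSpace n) : ℝ :=
  inner ℝ (gradient (fun η => f x η) ξ) (gradient (fun y => g y ξ) x) -
    inner ℝ (gradient (fun y => f y ξ) x) (gradient (fun η => g x η) ξ)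

/-- `φ` is a (smooth) limiting Carleman weight for the semiclassical Laplacian on `U`. -/
def IsLimitingCarlemanWeight (U : Set (RSpace n)) (φ : RSpace n → ℝ) : Prop :=
  ContDiffOn ℝ ∞ φ U ∧ (∀ x ∈ U, gradient φ x ≠ 0) ∧
    ∀ x ∈ U, ∀ ξ : RSpace n, symbol φ x ξ = 0 →
      poissonBracket (fun y η => (symbol φ y η).re) (fun y η => (symbol φ y η).im) x ξ = 0

/-! ### Weak derivatives and the Sobolev space `H²(Ω)` -/

/-- The classical partial derivative `∂_j f`. -/
def classicalPartial {F : Type*} [NormedAddCommGroup F] [NormedSpace ℝ F]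
    (j : Fin n) (f : RSpace n → F) (x : RSpace n) : F :=
  fderiv ℝ f x (EuclideanSpace.single j 1)

/-- `g` is the weak partial derivative `∂_j u` on the open set `Ω`. -/
def HasWeakPartial (Ω : Set (RSpace n)) (j : Fin n) (u g : RSpace n → ℂ) : Prop :=
  LocallyIntegrableOn u Ω ∧ LocallyIntegrableOn g Ω ∧
    ∀ θ : RSpace n → ℝ, ContDiff ℝ ∞ θ → HasCompactSupport θ → tsupport θ ⊆ Ω →
      ∫ x in Ω, ((classicalPartial j θ x : ℝ) : ℂ) * u x = -∫ x in Ω, (θ x : ℂ) * g x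

open Classical in
/-- The weak partial derivative `∂_j u` on `Ω` (a representative of it; `0` if there is none). -/
def weakPartial (Ω : Set (RSpace n)) (j : Fin n) (u : RSpace n → ℂ) : RSpace n → ℂ :=
  if h : ∃ g, HasWeakPartial Ω j u g then h.choose else 0

/-- The weak gradient `∇u` on `Ω`. -/
def weakGrad (Ω : Set (RSpace n)) (u : RSpace n → ℂ) (x : RSpace n) : CSpace n :=
  WithLp.toLp 2 fun j => weakPartial Ω j u x

/-- The weak Laplacian `Δu` on `Ω`. -/
def weakLaplacian (Ω : Set (RSpace n)) (u : RSpace n → ℂ) (x : RSpace n) : ℂ :=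
  ∑ j, weakPartial Ω j (weakPartial Ω j u) x

/-- `u ∈ H²(Ω)`: on `Ω`, `u` is the restriction of an element of the Bessel potential space
`H²(ℝⁿ)`. -/
def MemH2 (Ω : Set (RSpace n)) (u : RSpace n → ℂ) : Prop :=
  ∃ U : Lp ℂ 2 (volume : Measure (RSpace n)),
    TemperedDistribution.MemSobolev 2 2 (U : TemperedDistribution (RSpace n) ℂ) ∧
      u =ᵐ[volume.restrict Ω] U

/-! ### Boundary traces -/

/-- `g` is the boundary trace of `w ∈ H¹(Ω)`: there are functions smooth up to the boundary which
converge to `w` in `H¹(Ω)` and whose boundary values converge to `g` in `L²(∂Ω)`. -/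
def IsTrace (Ω : Set (RSpace n)) (w g : RSpace n → ℂ) : Prop :=
  MemLp w 2 (volume.restrict Ω) ∧ MemLp g 2 (surfaceMeasure Ω) ∧
    ∃ W : ℕ → RSpace n → ℂ, (∀ k, ContDiff ℝ ∞ (W k)) ∧
      Tendsto (fun k => eLpNorm (fun x => W k x - w x) 2 (volume.restrict Ω)) atTop (𝓝 0) ∧
      (∀ j, ∃ d : RSpace n → ℂ, HasWeakPartial Ω j w d ∧ MemLp d 2 (volume.restrict Ω) ∧
        Tendsto (fun k => eLpNorm (fun x => classicalPartial j (W k) x - d x) 2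
          (volume.restrict Ω)) atTop (𝓝 0)) ∧
      Tendsto (fun k => eLpNorm (fun x => W k x - g x) 2 (surfaceMeasure Ω)) atTop (𝓝 0)

open Classical in
/-- The boundary trace `w|_{∂Ω}` (a representative of it; `0` if there is none). -/
def trace (Ω : Set (RSpace n)) (w : RSpace n → ℂ) : RSpace n → ℂ :=
  if h : ∃ g, IsTrace Ω w g then h.choose else 0

/-- The trace of `∇u` on `∂Ω`. -/
def traceGrad (Ω : Set (RSpace n)) (u : RSpace n → ℂ) (x : RSpace n) : CSpace n :=
  WithLp.toLp 2 fun j => trace Ω (weakPartial Ω j u) x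

/-- The normal derivative `∂_ν u = ν · ∇u` on `∂Ω`. -/
def normalDeriv (Ω : Set (RSpace n)) (u : RSpace n → ℂ) (x : RSpace n) : ℂ :=
  ∑ j, (outerNormal Ω x j : ℂ) * traceGrad Ω u x j

/-- The tangential gradient `∇_t u = ∇u - (∂_ν u) ν` on `∂Ω`. -/
def tangentialGrad (Ω : Set (RSpace n)) (u : RSpace n → ℂ) (x : RSpace n) : CSpace n :=
  WithLp.toLp 2 fun j => traceGrad Ω u x j - normalDeriv Ω u x * (outerNormal Ω x j : ℂ)

/-- The normal derivative `∂_ν φ` on `∂Ω` of a weight `φ` that is smooth near `∂Ω`. -/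
def weightNormalDeriv (Ω : Set (RSpace n)) (φ : RSpace n → ℝ) (x : RSpace n) : ℝ :=
  inner ℝ (gradient φ x) (outerNormal Ω x)

/-- The part `∂Ω₊ = {x ∈ ∂Ω : ∂_ν φ(x) ≥ 0}` of the boundary. -/
def boundaryPlus (Ω : Set (RSpace n)) (φ : RSpace n → ℝ) : Set (RSpace n) :=
  {x ∈ frontier Ω | 0 ≤ weightNormalDeriv Ω φ x}

/-- The part `∂Ω₋ = {x ∈ ∂Ω : ∂_ν φ(x) ≤ 0}` of the boundary. -/
def boundaryMinus (Ω : Set (RSpace n)) (φ : RSpace n → ℝ) : Set (RSpace n) :=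
  {x ∈ frontier Ω | weightNormalDeriv Ω φ x ≤ 0}

/-! ### The operator -/

/-- `(-h² Δ + h A · h∇ + h² V) u` on `Ω`. -/
def schrodingerOp (Ω : Set (RSpace n)) (h : ℝ) (A : RSpace n → CSpace n) (V : RSpace n → ℂ)
    (u : RSpace n → ℂ) (x : RSpace n) : ℂ :=
  -(h : ℂ) ^ 2 * weakLaplacian Ω u x
    + ∑ j, ((h : ℂ) * A x j) * ((h : ℂ) * weakGrad Ω u x j)
    + (h : ℂ) ^ 2 * V x * u x

end Carleman

end

/-!
# A Carleman estimate with boundary terms for a limiting Carleman weight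

The weight `φ` is replaced by `ψ = φ - (τ / 2) φ²` with `τ = h / ε`, and `u` by `v = e^{-ψ/h} u`.
Then `e^{-ψ/h} (-h² Δ) u = (S + T) v` with `S = -h² Δ - |∇ψ|²` self-adjoint and
`T = -(2 h ∇ψ · ∇ + h Δψ)` anti-self-adjoint. The cross term `2 (S v) (T v)` is the divergence of
an explicit vector field (`carlemanField`) plus the commutator terms, which contain the Hessian of
`ψ` only through `ψ''(∇v, ∇v)` and `ψ''(∇ψ, ∇ψ) v²`; this is the identity `div_carlemanField`.

For a limiting Carleman weight, the Poisson bracket condition says exactly that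
`φ''(ζ, ζ) = -κ |ζ|² + 2 φ''(∇φ, ζ) (∇φ · ζ) / |∇φ|²` for all `ζ`, with
`κ = φ''(∇φ, ∇φ) / |∇φ|²` (`poissonBracket_symbol`, `bilin_eq_of_forall_orthogonal`,
`IsLimitingCarlemanWeight.hessian_identity`). The last term contains `∇φ · ∇v`, which is a multiple
of `T v` up to lower order. The two terms with `κ` are `h² |∇v|²` and `-|∇ψ|² v²` with the same
coefficient, so they cancel after the equation is multiplied by a suitable function times `v`
(`multiplier`). What is left comes from the convexification: it is positive, of size
`(h² / ε) (h² |∇v|² + v²)`, and for small `ε` it beats all the errors, which are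
`O(h²) (h² |∇v|² + v²)` (`remainder_lower_bound`). The flux of `carlemanField` through the boundary
is `2 h³ (∂_ν ψ) |∂_ν u|² e^{-2ψ/h}`, up to terms which the right-hand side of the estimate controls
(`flux_lower_bound`).

The factor `1 / ε` also absorbs the terms with `A` and `V` of the magnetic Schrödinger operator,
which contribute at most a multiple of `M² h² (h² |∇u|² + |u|²)` (`norm_lap_le_schrodingerOp`).
Finally `e^{-2ψ/h} = e^{-2φ/h} e^{φ²/ε}`, and once `ε` is fixed the last factor is bounded above
and below on `closure Ω` independently of `h`; so the estimate for `ψ` gives the one for `φ`.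

The integration needs the divergence theorem on a bounded `C²` domain with the Hausdorff measure as
surface measure (`setIntegral_fderiv_eq`). It is reduced by bump functions to the region below a
graph, and there to the area formula for graphs, obtained by comparing a `C¹` immersion with its
linearizations (`comap_euclideanHausdorffMeasure_eq_withDensity`). The estimate extends from smooth
functions to `H²(Ω)` by density: Fourier multipliers give Schwartz approximations of elements of
`H²(ℝⁿ)` (`exists_schwartz_tendsto`), and the trace inequality
(`exists_integral_sq_surfaceMeasure_le`) makes the boundary values converge to the traces
(`tendsto_trace`, `MemH2.exists_isH2Approx`).
-/

noncomputable section

namespace Carleman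

open Module

/-! ### The area formula for graphs -/

/-- Two measures that compare on small sets compare globally. -/
theorem measure_le_of_locally_le {X : Type*} [TopologicalSpace X] [SecondCountableTopology X]
    [MeasurableSpace X] [OpensMeasurableSpace X] {μ ν : Measure X}
    (h : ∀ x, ∃ U ∈ 𝓝 x, ∀ s ⊆ U, MeasurableSet s → μ s ≤ ν s) : μ ≤ ν := by
  choose U hU hle using h
  obtain ⟨T, hTc, hT⟩ := TopologicalSpace.countable_cover_nhds (f := fun x => interior (U x))
    fun x => interior_mem_nhds.2 (hU x)
  rcases T.eq_empty_or_nonempty with rfl | hne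
  · have : IsEmpty X := by
      rw [← univ_eq_empty_iff, ← hT]; simp
    exact Measure.le_iff.2 fun s _ => by rw [s.eq_empty_of_isEmpty]; simp
  obtain ⟨f, rfl⟩ := hTc.exists_eq_range hne
  have hcov : ⋃ k, interior (U (f k)) = univ := by simpa using hT
  refine Measure.le_iff.2 fun s hs => ?_
  have hd : ⋃ k, s ∩ disjointed (fun k => interior (U (f k))) k = s := by
    rw [← inter_iUnion, iUnion_disjointed, hcov, inter_univ]
  have hm : ∀ k, MeasurableSet (s ∩ disjointed (fun k => interior (U (f k))) k) := fun k =>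
    hs.inter (MeasurableSet.disjointed (fun _ => isOpen_interior.measurableSet) k)
  have hp : Pairwise (Function.onFun Disjoint
      fun k => s ∩ disjointed (fun k => interior (U (f k))) k) := fun i j hij =>
    (disjoint_disjointed (fun k => interior (U (f k))) hij).mono inter_subset_right
      inter_subset_right
  rw [← hd, measure_iUnion hp hm, measure_iUnion hp hm]
  refine ENNReal.tsum_le_tsum fun k => hle (f k) _ ?_ (hm k)
  exact inter_subset_right.trans ((disjointed_subset _ k).trans interior_subset)

/-- Lipschitz maps increase the `d`-dimensional Hausdorff measure at most by the factor `K ^ d`; the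
normalizing constants of the two measures agree. -/
theorem euclideanHausdorffMeasure_image_le {X Y : Type*} [EMetricSpace X] [EMetricSpace Y]
    [MeasurableSpace X] [BorelSpace X] [MeasurableSpace Y] [BorelSpace Y]
    {K : NNReal} {f : X → Y} {s : Set X} (h : LipschitzOnWith K f s) (d : ℕ) :
    (Measure.euclideanHausdorffMeasure d : Measure Y) (f '' s) ≤
      (K : ℝ≥0∞) ^ d * (Measure.euclideanHausdorffMeasure d : Measure X) s := by
  simp only [Measure.euclideanHausdorffMeasure_def, Measure.smul_apply, Measure.nnreal_smul_coe_apply]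
  have := h.hausdorffMeasure_image_le (d := d) (by positivity)
  rw [mul_left_comm]
  gcongr
  simpa using this

/-- If `f` expands distances at most `t` times as much as the injective map `g` does, then `f ∘ g⁻¹`
is `t`-Lipschitz on `g '' s`, and the measures of the two images compare. -/
theorem euclideanHausdorffMeasure_image_le_image {W E : Type*}
    [NormedAddCommGroup W] [NormedAddCommGroup E]
    [MeasurableSpace E] [BorelSpace E] {f g : W → E} {s : Set W} {t : ℝ} (ht : 0 ≤ t)
    (hg : ∀ a ∈ s, ∀ b ∈ s, g a = g b → a = b)
    (hfg : ∀ a ∈ s, ∀ b ∈ s, ‖f a - f b‖ ≤ t * ‖g a - g b‖) (d : ℕ) :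
    (Measure.euclideanHausdorffMeasure d : Measure E) (f '' s) ≤
      ENNReal.ofReal t ^ d * (Measure.euclideanHausdorffMeasure d : Measure E) (g '' s) := by
  have hinv : ∀ a ∈ s, Function.invFunOn g s (g a) = a := fun a ha =>
    hg _ (Function.invFunOn_mem ⟨a, ha, rfl⟩) _ ha (Function.invFunOn_eq ⟨a, ha, rfl⟩)
  have himg : f '' s = (fun y => f (Function.invFunOn g s y)) '' (g '' s) := by
    rw [image_image]
    exact image_congr fun a ha => by rw [hinv a ha]
  rw [himg]
  refine euclideanHausdorffMeasure_image_le (K := t.toNNReal) ?_ d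
  refine LipschitzOnWith.of_dist_le_mul ?_
  rintro _ ⟨a, ha, rfl⟩ _ ⟨b, hb, rfl⟩
  simp only [hinv a ha, hinv b hb, dist_eq_norm, Real.coe_toNNReal t ht]
  exact hfg a ha b hb

/-- The area formula for an immersion which expands infinitesimally: the Hausdorff measure of the
image of `Γ` has density `J`, the norm-determinant of the derivative. Near a point, `Γ` is as close
as desired to its linearization, up to bi-Lipschitz constants, and the area formula for linear maps
applies. -/
theorem comap_euclideanHausdorffMeasure_eq_withDensity {W E : Type*}
    [NormedAddCommGroup W] [InnerProductSpace ℝ W] [FiniteDimensional ℝ W]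
    [MeasurableSpace W] [BorelSpace W]
    [NormedAddCommGroup E] [InnerProductSpace ℝ E] [FiniteDimensional ℝ E]
    [MeasurableSpace E] [BorelSpace E]
    {Γ : W → E} {Γ' : W → W →L[ℝ] E} {J : W → ℝ}
    (hΓ : ∀ x, HasStrictFDerivAt Γ (Γ' x) x) (hlow : ∀ x a, ‖a‖ ≤ ‖Γ' x a‖)
    (hJ : Continuous J) (hJpos : ∀ x, 0 < J x) (hJeq : ∀ x, (Γ' x).toLinearMap.normDet = J x)
    (hemb : MeasurableEmbedding Γ) :
    (Measure.euclideanHausdorffMeasure (finrank ℝ W) : Measure E).comap Γ =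
      (volume : Measure W).withDensity fun x => ENNReal.ofReal (J x) := by
  set d := finrank ℝ W
  set m₁ := (Measure.euclideanHausdorffMeasure d : Measure E).comap Γ with hm₁
  set m₂ := (volume : Measure W).withDensity fun x => ENNReal.ofReal (J x) with hm₂
  -- The factor `t ^ d` comes from the bi-Lipschitz comparison of `Γ` with its linearization, one
  -- more factor `t` from the oscillation of `J`; in the end `t → 1`.
  have local_bound : ∀ t : ℝ, 1 < t → ∀ x₀, ∃ U ∈ 𝓝 x₀, ∀ s ⊆ U, MeasurableSet s →
      m₁ s ≤ ENNReal.ofReal t ^ (d + 1) * m₂ s ∧ m₂ s ≤ ENNReal.ofReal t ^ (d + 1) * m₁ s := by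
    intro t ht x₀
    have ht0 : 0 < t := by linarith
    -- With the error `(t - 1) / t` relative to an expanding linear map, the upper constant is at most
    -- `t` and the lower one is exactly `1 / t`.
    have hη : 0 < (t - 1) / t := div_pos (by linarith) ht0
    have h1η : 1 - (t - 1) / t = 1 / t := by field_simp; ring
    have h2η : 1 + (t - 1) / t ≤ t := by
      have : (t - 1) / t ≤ t - 1 := div_le_self (by linarith) ht.le
      linarith
    obtain ⟨V, hV, hVa⟩ := (hΓ x₀).approximates_deriv_on_nhds
      (c := ((t - 1) / t).toNNReal) (Or.inr (by simpa using hη))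
    have hV' : ∀ a ∈ V, ∀ b ∈ V, ‖Γ a - Γ b - Γ' x₀ (a - b)‖ ≤ (t - 1) / t * ‖a - b‖ := by
      intro a ha b hb
      have h2 := hVa a ha b hb
      rwa [Real.coe_toNNReal _ hη.le] at h2
    have hU1 : ∀ᶠ x in 𝓝 x₀, J x < t * J x₀ :=
      (hJ.tendsto x₀).eventually (gt_mem_nhds (by nlinarith [hJpos x₀]))
    have hU2 : ∀ᶠ x in 𝓝 x₀, J x₀ / t < J x :=
      (hJ.tendsto x₀).eventually (lt_mem_nhds (div_lt_self (hJpos x₀) ht))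
    refine ⟨V ∩ {x | J x < t * J x₀ ∧ J x₀ / t < J x}, inter_mem hV (hU1.and hU2), ?_⟩
    intro s hs hsm
    -- The area formula for the linearization at `x₀`.
    have hlin : (Measure.euclideanHausdorffMeasure d : Measure E) (Γ' x₀ '' s) =
        ENNReal.ofReal (J x₀) * volume s := by
      have := LinearMap.euclideanHausdorffMeasure_image_eq_normDet_mul_volume
        (Γ' x₀).toLinearMap s
      rwa [hJeq] at this
    have e1 : m₁ s = (Measure.euclideanHausdorffMeasure d : Measure E) (Γ '' s) :=
      hemb.comap_apply _ s
    have e2 : m₂ s = ∫⁻ x in s, ENNReal.ofReal (J x) := withDensity_apply _ hsm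
    have linj : ∀ a ∈ s, ∀ b ∈ s, Γ' x₀ a = Γ' x₀ b → a = b := by
      intro a _ b _ hab
      have := hlow x₀ (a - b)
      rw [map_sub, hab, sub_self, norm_zero] at this
      exact sub_eq_zero.1 (norm_le_zero_iff.1 this)
    have up : ∀ a ∈ s, ∀ b ∈ s, ‖Γ a - Γ b‖ ≤ t * ‖Γ' x₀ a - Γ' x₀ b‖ := by
      intro a ha b hb
      have h1 := hV' a (hs ha).1 b (hs hb).1
      have h2 := hlow x₀ (a - b)
      rw [← map_sub]
      have h3 : ‖Γ a - Γ b‖ ≤ ‖Γ a - Γ b - Γ' x₀ (a - b)‖ + ‖Γ' x₀ (a - b)‖ := by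
        simpa using norm_add_le (Γ a - Γ b - Γ' x₀ (a - b)) (Γ' x₀ (a - b))
      nlinarith [norm_nonneg (Γ' x₀ (a - b))]
    have low : ∀ a ∈ s, ∀ b ∈ s, ‖Γ' x₀ a - Γ' x₀ b‖ ≤ t * ‖Γ a - Γ b‖ := by
      intro a ha b hb
      have h1 := hV' a (hs ha).1 b (hs hb).1
      have h2 := hlow x₀ (a - b)
      rw [← map_sub]
      have h3 : ‖Γ' x₀ (a - b)‖ ≤ ‖Γ a - Γ b‖ + ‖Γ a - Γ b - Γ' x₀ (a - b)‖ := by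
        simpa using norm_sub_le (Γ a - Γ b) (Γ a - Γ b - Γ' x₀ (a - b))
      have h4 : (1 / t) * ‖Γ' x₀ (a - b)‖ ≤ ‖Γ a - Γ b‖ := by
        rw [← h1η]; nlinarith
      rwa [one_div, inv_mul_le_iff₀ ht0] at h4
    have inj : ∀ a ∈ s, ∀ b ∈ s, Γ a = Γ b → a = b := fun a _ b _ hab => hemb.injective hab
    have c1 := euclideanHausdorffMeasure_image_le_image ht0.le linj up d
    have c2 := euclideanHausdorffMeasure_image_le_image ht0.le inj low d
    rw [← e1, hlin] at c1
    rw [← e1, hlin] at c2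
    have d1 : ENNReal.ofReal (J x₀) * volume s ≤ ENNReal.ofReal t * m₂ s := by
      rw [e2, ← setLIntegral_const, ← lintegral_const_mul' _ _ ENNReal.ofReal_ne_top]
      refine setLIntegral_mono' hsm fun x hx => ?_
      rw [← ENNReal.ofReal_mul ht0.le]
      refine ENNReal.ofReal_le_ofReal ?_
      have := (hs hx).2.2
      rw [div_lt_iff₀ ht0] at this
      linarith
    have d2 : m₂ s ≤ ENNReal.ofReal t * (ENNReal.ofReal (J x₀) * volume s) := by
      rw [e2, ← mul_assoc, ← ENNReal.ofReal_mul ht0.le, ← setLIntegral_const]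
      exact setLIntegral_mono' hsm fun x hx => ENNReal.ofReal_le_ofReal (hs hx).2.1.le
    refine ⟨?_, ?_⟩
    · calc m₁ s ≤ _ := c1
        _ ≤ ENNReal.ofReal t ^ d * (ENNReal.ofReal t * m₂ s) := by gcongr
        _ = _ := by rw [pow_succ, mul_assoc]
    · calc m₂ s ≤ _ := d2
        _ ≤ ENNReal.ofReal t * (ENNReal.ofReal t ^ d * m₁ s) := by gcongr
        _ = _ := by rw [pow_succ']; rw [mul_assoc]
  have hlim : ∀ a : ℝ≥0∞, Tendsto (fun t : ℝ => ENNReal.ofReal t ^ (d + 1) * a) (𝓝[>] 1) (𝓝 a) := by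
    intro a
    have h1 : Tendsto (fun t : ℝ => ENNReal.ofReal t ^ (d + 1)) (𝓝[>] 1) (𝓝 1) := by
      have : Continuous fun t : ℝ => ENNReal.ofReal t ^ (d + 1) :=
        (ENNReal.continuous_pow _).comp ENNReal.continuous_ofReal
      simpa using (this.tendsto 1).mono_left nhdsWithin_le_nhds
    simpa using ENNReal.Tendsto.mul_const h1 (Or.inl one_ne_zero)
  refine le_antisymm (Measure.le_iff'.2 fun s => ?_) (Measure.le_iff'.2 fun s => ?_)
  · refine ge_of_tendsto (hlim (m₂ s)) ?_
    filter_upwards [self_mem_nhdsWithin] with t ht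
    have : m₁ ≤ (ENNReal.ofReal t ^ (d + 1)) • m₂ := measure_le_of_locally_le fun x => by
      obtain ⟨U, hU, h⟩ := local_bound t ht x
      exact ⟨U, hU, fun s hs hm => (h s hs hm).1⟩
    exact this s
  · refine ge_of_tendsto (hlim (m₁ s)) ?_
    filter_upwards [self_mem_nhdsWithin] with t ht
    have : m₂ ≤ (ENNReal.ofReal t ^ (d + 1)) • m₁ := measure_le_of_locally_le fun x => by
      obtain ⟨U, hU, h⟩ := local_bound t ht x
      exact ⟨U, hU, fun s hs hm => (h s hs hm).2⟩
    exact this s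

/-! ### Surface integrals over graphs -/

section Graph

variable {E : Type*} [NormedAddCommGroup E] [InnerProductSpace ℝ E]

/-- The hyperplane `e^⊥`. -/
abbrev Hyperplane (e : E) : Submodule ℝ E := (ℝ ∙ e)ᗮ

/-- The parametrization `w ↦ w + γ(w) e` of the graph of `γ` over the hyperplane `e^⊥`. -/
def graphMap (e : E) (γ : Hyperplane e → ℝ) (w : Hyperplane e) : E := (w : E) + γ w • e

/-- The orthogonal projection to the hyperplane `e^⊥`. -/
abbrev hproj (e : E) : E →L[ℝ] Hyperplane e := (ℝ ∙ e)ᗮ.orthogonalProjectionOnto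

/-- The derivative of `graphMap`. -/
def graphDeriv (e : E) (γ : Hyperplane e → ℝ) (w : Hyperplane e) : Hyperplane e →L[ℝ] E :=
  (Hyperplane e).subtypeL + (fderiv ℝ γ w).smulRight e

variable {e : E}

theorem inner_e_coe (w : Hyperplane e) : inner ℝ e (w : E) = 0 :=
  (Submodule.mem_orthogonal_singleton_iff_inner_right.1 w.2)

theorem inner_e_e (he : ‖e‖ = 1) : inner ℝ e e = 1 := by
  rw [real_inner_self_eq_norm_sq, he]; norm_num

theorem hproj_coe (w : Hyperplane e) : hproj e (w : E) = w :=
  Submodule.orthogonalProjectionOnto_mem_subspace_eq_self w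

theorem coe_hproj (he : ‖e‖ = 1) (y : E) : (hproj e y : E) = y - inner ℝ e y • e := by
  rw [Submodule.coe_orthogonalProjectionOnto_apply, Submodule.starProjection_orthogonal,
    sub_apply, Submodule.starProjection_unit_singleton ℝ he]
  rfl

theorem hproj_e (he : ‖e‖ = 1) : hproj e e = 0 := by
  ext
  rw [coe_hproj he, inner_e_e he]; simp

theorem norm_sq_add_smul (he : ‖e‖ = 1) (a : Hyperplane e) (c : ℝ) :
    ‖(a : E) + c • e‖ ^ 2 = ‖a‖ ^ 2 + c ^ 2 := by
  rw [norm_add_sq_real, real_inner_smul_right, real_inner_comm, inner_e_coe, norm_smul, he]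
  simp

theorem hproj_graphMap (he : ‖e‖ = 1) (γ : Hyperplane e → ℝ) (w : Hyperplane e) :
    hproj e (graphMap e γ w) = w := by
  rw [graphMap, map_add, map_smul, hproj_e he, hproj_coe, smul_zero, add_zero]

theorem inner_e_graphMap (he : ‖e‖ = 1) (γ : Hyperplane e → ℝ) (w : Hyperplane e) :
    inner ℝ e (graphMap e γ w) = γ w := by
  rw [graphMap, inner_add_right, inner_e_coe, inner_smul_right, inner_e_e he]; simp

theorem range_graphMap (he : ‖e‖ = 1) (γ : Hyperplane e → ℝ) :
    range (graphMap e γ) = {y | inner ℝ e y = γ (hproj e y)} := by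
  ext y
  constructor
  · rintro ⟨w, rfl⟩
    simp only [mem_ofPred_eq, hproj_graphMap he, inner_e_graphMap he]
  · intro hy
    refine ⟨hproj e y, ?_⟩
    rw [graphMap, ← (show inner ℝ e y = γ (hproj e y) from hy), coe_hproj he]
    simp

variable {γ : Hyperplane e → ℝ}

theorem continuous_graphMap (hγ : Continuous γ) : Continuous (graphMap e γ) := by
  unfold graphMap; fun_prop

theorem isClosedEmbedding_graphMap (he : ‖e‖ = 1) (hγ : Continuous γ) :
    IsClosedEmbedding (graphMap e γ) :=
  Function.LeftInverse.isClosedEmbedding (f := hproj e) (hproj_graphMap he γ)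
    (hproj e).continuous (continuous_graphMap hγ)

theorem graphDeriv_apply (w a : Hyperplane e) :
    graphDeriv e γ w a = (a : E) + fderiv ℝ γ w a • e := rfl

theorem hasStrictFDerivAt_graphMap (hγ : ContDiff ℝ 1 γ) (w : Hyperplane e) :
    HasStrictFDerivAt (graphMap e γ) (graphDeriv e γ w) w :=
  ((Hyperplane e).subtypeL.hasStrictFDerivAt).add
    ((hγ.contDiffAt.hasStrictFDerivAt (by norm_num)).smul_const e)

theorem norm_le_norm_graphDeriv (he : ‖e‖ = 1) (w a : Hyperplane e) :
    ‖a‖ ≤ ‖graphDeriv e γ w a‖ := by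
  refine le_of_sq_le_sq ?_ (norm_nonneg _)
  rw [graphDeriv_apply, norm_sq_add_smul he]
  nlinarith [sq_nonneg (fderiv ℝ γ w a)]

variable [FiniteDimensional ℝ E]

/-- The normal vector `e - ∇γ` to the graph of `γ`, pointing upwards; it is not normalized. -/
def graphNormal (e : E) (γ : Hyperplane e → ℝ) (w : Hyperplane e) : E :=
  e - ((gradient γ w : Hyperplane e) : E)

theorem norm_sq_graphNormal (he : ‖e‖ = 1) (w : Hyperplane e) :
    ‖graphNormal e γ w‖ ^ 2 = 1 + ‖(gradient γ w : Hyperplane e)‖ ^ 2 := by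
  have := norm_sq_add_smul he (-(gradient γ w : Hyperplane e)) 1
  rw [norm_neg] at this
  rw [graphNormal, add_comm]
  simp only [Submodule.coe_neg, one_smul, one_pow] at this
  rw [← this]; congr 2; abel

theorem norm_graphNormal_pos (he : ‖e‖ = 1) (w : Hyperplane e) : 0 < ‖graphNormal e γ w‖ := by
  have := norm_sq_graphNormal he (γ := γ) w
  rcases (norm_nonneg (graphNormal e γ w)).eq_or_lt with h | h
  · rw [← h] at this; nlinarith [sq_nonneg ‖(gradient γ w : Hyperplane e)‖]
  · exact h

theorem inner_gradient_left {F : Type*} [NormedAddCommGroup F] [InnerProductSpace ℝ F]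
    [CompleteSpace F] (f : F → ℝ) (x a : F) : inner ℝ (gradient f x) a = fderiv ℝ f x a := by
  rw [gradient, InnerProductSpace.toDual_symm_apply]

theorem inner_graphNormal (he : ‖e‖ = 1) (w : Hyperplane e) (d : E) :
    inner ℝ (graphNormal e γ w) d = inner ℝ e d - fderiv ℝ γ w (hproj e d) := by
  rw [graphNormal, inner_sub_left, ← inner_gradient_left]
  congr 1
  have h0 : inner ℝ ((gradient γ w : Hyperplane e) : E) e = 0 := by
    rw [real_inner_comm]; exact inner_e_coe _
  rw [Submodule.coe_inner, coe_hproj he, inner_sub_right, inner_smul_right, h0]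
  simp [real_inner_comm]

theorem continuous_gradient {F : Type*} [NormedAddCommGroup F] [InnerProductSpace ℝ F]
    [CompleteSpace F] {f : F → ℝ} (hf : ContDiff ℝ 1 f) : Continuous fun x => gradient f x :=
  (InnerProductSpace.toDual ℝ F).symm.continuous.comp (hf.continuous_fderiv (by norm_num))

theorem continuous_graphNormal (hγ : ContDiff ℝ 1 γ) : Continuous (graphNormal e γ) :=
  continuous_const.sub (continuous_subtype_val.comp (continuous_gradient hγ))

/-- The surface element of a graph, `√(1 + |∇γ|²)`. The Gram matrix of the derivative of the
parametrization is `1 + ∇γ (∇γ)ᵀ`, a rank-one perturbation of the identity. -/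
theorem normDet_graphDeriv (he : ‖e‖ = 1) (w : Hyperplane e) :
    (graphDeriv e γ w).toLinearMap.normDet = ‖graphNormal e γ w‖ := by
  rw [← sq_eq_sq₀ (LinearMap.normDet_nonneg _) (norm_nonneg _), norm_sq_graphNormal he]
  set b := stdOrthonormalBasis ℝ (Hyperplane e)
  have h := LinearMap.normDet_sq_eq_det_gram (graphDeriv e γ w).toLinearMap b
  have hg : Matrix.gram ℝ (fun i => (graphDeriv e γ w).toLinearMap (b i)) =
      1 + Matrix.replicateCol Unit (fun i => fderiv ℝ γ w (b i)) *
        Matrix.replicateRow Unit (fun i => fderiv ℝ γ w (b i)) := by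
    ext i j
    have hij : inner ℝ ((b i : Hyperplane e) : E) ((b j : Hyperplane e) : E) =
        if i = j then 1 else 0 := by
      rw [← Submodule.coe_inner]; exact orthonormal_iff_ite.1 b.orthonormal i j
    simp only [Matrix.gram_apply, ContinuousLinearMap.coe_coe, graphDeriv_apply, inner_add_left,
      inner_add_right, inner_smul_left, inner_smul_right, inner_e_coe, inner_e_e he, hij,
      Matrix.add_apply, Matrix.mul_apply, Matrix.one_apply]
    rw [real_inner_comm, inner_e_coe]
    simp [mul_comm]
  rw [hg, Matrix.det_one_add_replicateCol_mul_replicateRow] at h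
  have h2 : ‖(gradient γ w : Hyperplane e)‖ ^ 2 = ∑ i, fderiv ℝ γ w (b i) ^ 2 := by
    rw [← b.sum_sq_norm_inner_left]
    simp
  simp only [RCLike.ofReal_real_eq_id, id] at h
  rw [h, h2]
  simp [dotProduct, sq]

theorem finrank_hyperplane (he : ‖e‖ = 1) : finrank ℝ (Hyperplane e) = finrank ℝ E - 1 := by
  have h := (ℝ ∙ e).finrank_add_finrank_orthogonal
  rw [finrank_span_singleton (by rintro rfl; simp at he)] at h
  change finrank ℝ (ℝ ∙ e)ᗮ = _
  omega

variable [MeasurableSpace E] [BorelSpace E]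

set_option linter.unusedSectionVars false in
theorem measurableEmbedding_graphMap (he : ‖e‖ = 1) (hγ : Continuous γ) :
    MeasurableEmbedding (graphMap e γ) :=
  (isClosedEmbedding_graphMap he hγ).measurableEmbedding

/-- The area formula for the graph of a `C¹` function. -/
theorem comap_graphMap (he : ‖e‖ = 1) (hγ : ContDiff ℝ 1 γ) :
    (Measure.euclideanHausdorffMeasure (finrank ℝ E - 1) : Measure E).comap (graphMap e γ) =
      volume.withDensity fun w => ENNReal.ofReal ‖graphNormal e γ w‖ := by
  rw [← finrank_hyperplane he]
  exact comap_euclideanHausdorffMeasure_eq_withDensity (hasStrictFDerivAt_graphMap hγ)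
    (fun w a => norm_le_norm_graphDeriv he w a) (continuous_graphNormal hγ).norm
    (norm_graphNormal_pos he) (normDet_graphDeriv he)
    (measurableEmbedding_graphMap he hγ.continuous)

/-- Surface integrals over a graph, in the coordinates of the base hyperplane. -/
theorem setIntegral_range_graphMap (he : ‖e‖ = 1) (hγ : ContDiff ℝ 1 γ) (k : E → ℝ) :
    ∫ y in range (graphMap e γ), k y
        ∂(Measure.euclideanHausdorffMeasure (finrank ℝ E - 1) : Measure E) =
      ∫ w, ‖graphNormal e γ w‖ * k (graphMap e γ w) := by
  have hemb := measurableEmbedding_graphMap he hγ.continuous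
  rw [← hemb.map_comap, hemb.integral_map, comap_graphMap he hγ,
    integral_withDensity_eq_integral_toReal_smul]
  · simp
  · exact (continuous_graphNormal hγ).norm.measurable.ennreal_ofReal
  · exact Eventually.of_forall fun _ => ENNReal.ofReal_lt_top

theorem euclideanHausdorffMeasure_graph_lt_top (he : ‖e‖ = 1) (hγ : ContDiff ℝ 1 γ) {K : Set E}
    (hK : IsCompact K) :
    (Measure.euclideanHausdorffMeasure (finrank ℝ E - 1) : Measure E) (K ∩ range (graphMap e γ))
      < ⊤ := by
  have hemb := measurableEmbedding_graphMap he hγ.continuous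
  rw [← image_preimage_eq_inter_range, ← hemb.comap_apply, comap_graphMap he hγ]
  have hc : IsCompact (graphMap e γ ⁻¹' K) :=
    (isClosedEmbedding_graphMap he hγ.continuous).isCompact_preimage hK
  rw [withDensity_apply _ hc.measurableSet]
  have hint : IntegrableOn (fun w => ‖graphNormal e γ w‖) (graphMap e γ ⁻¹' K) :=
    (continuous_graphNormal hγ).norm.continuousOn.integrableOn_compact hc
  exact hint.lintegral_lt_top

end Graph

/-! ### The divergence theorem below a graph -/

section Flatten

variable {E : Type*} [NormedAddCommGroup E] [InnerProductSpace ℝ E]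

/-- Coordinates `(w, t) ↦ w + (γ(w) + t) e` which flatten the graph of `γ`. -/
def flatten (e : E) (γ : Hyperplane e → ℝ) (p : Hyperplane e × ℝ) : E :=
  (p.1 : E) + (γ p.1 + p.2) • e

variable {e : E} {γ : Hyperplane e → ℝ}

theorem hproj_flatten (he : ‖e‖ = 1) (p : Hyperplane e × ℝ) : hproj e (flatten e γ p) = p.1 := by
  rw [flatten, map_add, map_smul, hproj_e he, hproj_coe, smul_zero, add_zero]

theorem inner_e_flatten (he : ‖e‖ = 1) (p : Hyperplane e × ℝ) :
    inner ℝ e (flatten e γ p) = γ p.1 + p.2 := by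
  rw [flatten, inner_add_right, inner_e_coe, inner_smul_right, inner_e_e he]; simp

theorem isClosedEmbedding_flatten (he : ‖e‖ = 1) (hγ : Continuous γ) :
    IsClosedEmbedding (flatten e γ) := by
  refine Function.LeftInverse.isClosedEmbedding
    (f := fun y => (hproj e y, inner ℝ e y - γ (hproj e y))) ?_ (by fun_prop)
    (by unfold flatten; fun_prop)
  intro p
  simp only [hproj_flatten he, inner_e_flatten he]
  ext <;> simp

theorem preimage_flatten (he : ‖e‖ = 1) :
    flatten e γ ⁻¹' {y | inner ℝ e y < γ (hproj e y)} = univ ×ˢ Iio (0 : ℝ) := by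
  ext p
  simp [hproj_flatten he, inner_e_flatten he]

theorem contDiff_flatten (hγ : ContDiff ℝ 1 γ) : ContDiff ℝ 1 (flatten e γ) := by
  unfold flatten
  have h1 : ContDiff ℝ 1 fun p : Hyperplane e × ℝ => (p.1 : E) :=
    (Hyperplane e).subtypeL.contDiff.comp contDiff_fst
  exact h1.add (((hγ.comp contDiff_fst).add contDiff_snd).smul contDiff_const)

theorem fderiv_flatten (hγ : ContDiff ℝ 1 γ) (p q : Hyperplane e × ℝ) :
    fderiv ℝ (flatten e γ) p q = (q.1 : E) + (fderiv ℝ γ p.1 q.1 + q.2) • e := by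
  have h1 : HasFDerivAt (fun p : Hyperplane e × ℝ => (p.1 : E))
      ((Hyperplane e).subtypeL ∘L ContinuousLinearMap.fst ℝ _ _) p :=
    (Hyperplane e).subtypeL.hasFDerivAt.comp p hasFDerivAt_fst
  have h2 : HasFDerivAt (fun p : Hyperplane e × ℝ => γ p.1)
      (fderiv ℝ γ p.1 ∘L ContinuousLinearMap.fst ℝ _ _) p :=
    ((hγ.differentiable (by norm_num)) p.1).hasFDerivAt.comp p hasFDerivAt_fst
  have h3 := h1.add ((h2.add hasFDerivAt_snd).smul_const e)
  rw [show fderiv ℝ (flatten e γ) p = _ from h3.fderiv]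
  simp

variable [FiniteDimensional ℝ E] [MeasurableSpace E] [BorelSpace E]

theorem measurePreserving_flatten (he : ‖e‖ = 1) (hγ : Continuous γ) :
    MeasurePreserving (flatten e γ) := by
  have h0 : MeasurePreserving
      (fun p : Hyperplane e × ℝ => (p.1, γ p.1 + p.2)) := by
    refine (MeasurePreserving.id volume).skew_product (g := fun w t => γ w + t) ?_ ?_
    · exact (by fun_prop : Continuous fun p : Hyperplane e × ℝ => γ p.1 + p.2).measurable
    · exact Eventually.of_forall fun w => map_add_left_eq_self _ _
  have h1 : MeasurePreserving (Prod.swap : Hyperplane e × ℝ → ℝ × Hyperplane e) :=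
    Measure.measurePreserving_swap
  have h2 : MeasurePreserving (Prod.map (LinearIsometryEquiv.toSpanUnitSingleton (𝕜 := ℝ) e he) id :
      ℝ × Hyperplane e → (ℝ ∙ e) × Hyperplane e) :=
    (LinearIsometryEquiv.toSpanUnitSingleton (𝕜 := ℝ) e he).measurePreserving.prod
      (MeasurePreserving.id volume)
  have h3 := ((ℝ ∙ e).measurePreserving_measurableEquivProd (0 : E)).symm
  rw [InnerProductSpace.euclideanHausdorffMeasure_eq_volume] at h3
  have h := h3.comp (h2.comp (h1.comp h0))
  convert h using 1
  ext p
  simp [flatten, add_comm]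

/-- The divergence theorem on the region below the graph of a `C¹` function. -/
theorem setIntegral_fderiv_below_graph (he : ‖e‖ = 1) (hγ : ContDiff ℝ 1 γ) {f : E → ℝ}
    (hf : ContDiff ℝ 1 f) (hs : HasCompactSupport f) (d : E) :
    ∫ y in {y | inner ℝ e y < γ (hproj e y)}, fderiv ℝ f y d =
      ∫ w, inner ℝ (graphNormal e γ w) d * f (graphMap e γ w) := by
  have hcl := isClosedEmbedding_flatten he hγ.continuous
  rw [← (measurePreserving_flatten he hγ.continuous).setIntegral_preimage_emb
    hcl.measurableEmbedding, preimage_flatten he]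
  set F : Hyperplane e × ℝ → ℝ := f ∘ flatten e γ with hF
  have hFc : ContDiff ℝ 1 F := hf.comp (contDiff_flatten hγ)
  have hFs : HasCompactSupport F := hs.comp_isClosedEmbedding hcl
  set c : Hyperplane e → ℝ := fun w => inner ℝ (graphNormal e γ w) d with hc
  have hcc : Continuous c := (continuous_graphNormal hγ).inner continuous_const
  have hFd : Continuous (fderiv ℝ F) := hFc.continuous_fderiv (by norm_num)
  have hFds : HasCompactSupport (fderiv ℝ F) := hFs.fderiv ℝ
  -- The direction `d` is the image of a horizontal direction and a multiple of the vertical one.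
  have key : ∀ p, fderiv ℝ f (flatten e γ p) d =
      fderiv ℝ F p (hproj e d, 0) + c p.1 * fderiv ℝ F p (0, 1) := by
    intro p
    have hcomp : fderiv ℝ F p = (fderiv ℝ f (flatten e γ p)) ∘L (fderiv ℝ (flatten e γ) p) :=
      fderiv_comp p (hf.differentiable (by norm_num) _)
        ((contDiff_flatten hγ).differentiable (by norm_num) _)
    rw [hcomp, ContinuousLinearMap.comp_apply, ContinuousLinearMap.comp_apply, ← smul_eq_mul,
      ← map_smul, ← map_add, fderiv_flatten hγ, fderiv_flatten hγ]
    congr 1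
    simp only [hc, inner_graphNormal he, coe_hproj he]
    simp only [map_zero, ZeroMemClass.coe_zero, zero_add, add_zero, one_smul]
    module
  have hi1 : Integrable fun p => fderiv ℝ F p (hproj e d, 0) :=
    (hFd.clm_apply continuous_const).integrable_of_hasCompactSupport
      (hFds.comp_left (g := fun L : Hyperplane e × ℝ →L[ℝ] ℝ => L (hproj e d, 0)) rfl)
  have hi2 : Integrable fun p => c p.1 * fderiv ℝ F p (0, 1) :=
    ((hcc.comp continuous_fst).mul (hFd.clm_apply continuous_const)).integrable_of_hasCompactSupport
      ((hFds.comp_left (g := fun L : Hyperplane e × ℝ →L[ℝ] ℝ => L (0, 1)) rfl).mul_left)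
  simp_rw [key]
  rw [integral_add hi1.integrableOn hi2.integrableOn]
  -- The horizontal derivative integrates to zero on each horizontal slice.
  have z1 : ∫ p in univ ×ˢ Iio (0 : ℝ), fderiv ℝ F p (hproj e d, 0) = 0 := by
    have := hi1.integrableOn (s := univ ×ˢ Iio (0 : ℝ))
    rw [IntegrableOn, Measure.volume_eq_prod, ← Measure.prod_restrict, Measure.restrict_univ] at this
    rw [Measure.volume_eq_prod, ← Measure.prod_restrict, Measure.restrict_univ,
      integral_prod_symm _ this]
    refine integral_eq_zero_of_ae (Eventually.of_forall fun t => ?_)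
    set G : Hyperplane e → ℝ := fun w => F (w, t) with hG
    have hGc : ContDiff ℝ 1 G := hFc.comp (contDiff_id.prodMk contDiff_const)
    have hemb : IsClosedEmbedding fun w : Hyperplane e => (w, t) :=
      Function.LeftInverse.isClosedEmbedding (f := Prod.fst) (fun _ => rfl) continuous_fst
        (by fun_prop)
    have hGs : HasCompactSupport G := hFs.comp_isClosedEmbedding hemb
    have hGd : ∀ w, fderiv ℝ G w (hproj e d) = fderiv ℝ F (w, t) (hproj e d, 0) := by
      intro w
      have h1 : HasFDerivAt (fun w : Hyperplane e => (w, t))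
          (ContinuousLinearMap.inl ℝ (Hyperplane e) ℝ) w := by
        exact hasFDerivAt_prodMk_left w t
      have := ((hFc.differentiable (by norm_num) (w, t)).hasFDerivAt).comp w h1
      rw [show G = F ∘ fun w => (w, t) from rfl, this.fderiv]
      simp
    simp_rw [← hGd]
    have := integral_mul_fderiv_eq_neg_fderiv_mul_of_integrable (μ := volume)
      (f := fun _ : Hyperplane e => (1 : ℝ)) (g := G) (v := hproj e d) (by simp) ?_ ?_
      (fun x _ => differentiableAt_const _) (fun x _ => hGc.differentiable (by norm_num) x)
    · simpa using this
    · simp only [one_mul]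
      exact ((hGc.continuous_fderiv (by norm_num)).clm_apply
        continuous_const).integrable_of_hasCompactSupport
        ((hGs.fderiv ℝ).comp_left (g := fun L : Hyperplane e →L[ℝ] ℝ => L (hproj e d)) rfl)
    · simp only [one_mul]
      exact hGc.continuous.integrable_of_hasCompactSupport hGs
  -- The vertical derivative is integrated over `t < 0` by the fundamental theorem of calculus.
  rw [z1, zero_add]
  have := hi2.integrableOn (s := univ ×ˢ Iio (0 : ℝ))
  rw [IntegrableOn, Measure.volume_eq_prod, ← Measure.prod_restrict, Measure.restrict_univ] at this
  rw [Measure.volume_eq_prod, ← Measure.prod_restrict, Measure.restrict_univ,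
    integral_prod _ this]
  congr 1 with w
  simp only
  rw [integral_const_mul]
  congr 1
  set G : ℝ → ℝ := fun t => F (w, t) with hG
  have hGc : ContDiff ℝ 1 G := hFc.comp (contDiff_const.prodMk contDiff_id)
  have hemb : IsClosedEmbedding fun t : ℝ => (w, t) :=
    Function.LeftInverse.isClosedEmbedding (f := Prod.snd) (fun _ => rfl) continuous_snd
      (by fun_prop)
  have hGs : HasCompactSupport G := hFs.comp_isClosedEmbedding hemb
  have hGd : ∀ t, deriv G t = fderiv ℝ F (w, t) (0, 1) := by
    intro t
    have h1 : HasFDerivAt (fun t : ℝ => (w, t))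
        (ContinuousLinearMap.inr ℝ (Hyperplane e) ℝ) t := by
      exact hasFDerivAt_prodMk_right w t
    have := ((hFc.differentiable (by norm_num) (w, t)).hasFDerivAt).comp t h1
    rw [← fderiv_apply_one_eq_deriv, show G = F ∘ fun t => (w, t) from rfl, this.fderiv]
    simp
  simp_rw [← hGd]
  rw [← integral_Iic_eq_integral_Iio, hGs.integral_Iic_deriv_eq hGc]
  simp [hG, hF, flatten, graphMap]

end Flatten

/-! ### Boundary charts and the outer unit normal -/

section Chart

variable {n : ℕ} {Ω : Set (RSpace n)}

/-- `Ω` lies below the graph of the `C¹` function `γ` over `e^⊥` in the ball of radius `r` around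
`x`. -/
structure IsChart (Ω : Set (RSpace n)) (x e : RSpace n) (r : ℝ) (γ : Hyperplane e → ℝ) : Prop where
  norm_eq : ‖e‖ = 1
  pos : 0 < r
  contDiff : ContDiff ℝ 1 γ
  mem_iff : ∀ y ∈ Metric.ball x r, (y ∈ Ω ↔ inner ℝ e y < γ (hproj e y))

/-- The graph functions of `HasC2Boundary` live on the whole space; only their restriction to the
hyperplane `e^⊥` matters. -/
theorem HasC2Boundary.exists_isChart (hΩ : HasC2Boundary Ω) {x : RSpace n} (hx : x ∈ frontier Ω) :
    ∃ e r, ∃ γ : Hyperplane e → ℝ, IsChart Ω x e r γ := by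
  obtain ⟨e, he, r, hr, γ, hγ, h⟩ := hΩ x hx
  refine ⟨e, r, fun w => γ w, he, hr, ?_, fun y hy => ?_⟩
  · exact (hγ.of_le (by norm_num)).comp (Hyperplane e).subtypeL.contDiff
  · rw [h y hy, coe_hproj he]

/-- The unit normal to a graph, extended constantly along the vertical direction. -/
def chartNormal (e : RSpace n) (γ : Hyperplane e → ℝ) (y : RSpace n) : RSpace n :=
  ‖graphNormal e γ (hproj e y)‖⁻¹ • graphNormal e γ (hproj e y)

theorem continuous_chartNormal {e : RSpace n} {γ : Hyperplane e → ℝ} (he : ‖e‖ = 1)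
    (hγ : ContDiff ℝ 1 γ) : Continuous (chartNormal e γ) := by
  have h : Continuous fun y => graphNormal e γ (hproj e y) :=
    (continuous_graphNormal hγ).comp (hproj e).continuous
  exact (h.norm.inv₀ fun y => (norm_graphNormal_pos he _).ne').smul h

variable {x e : RSpace n} {r : ℝ} {γ : Hyperplane e → ℝ}

/-- Inside a chart the boundary is the graph: points strictly above it are not limits of points of
`Ω`, and points on it are limits from below. -/
theorem IsChart.mem_frontier_iff (h : IsChart Ω x e r γ) (hΩ : IsOpen Ω) {y : RSpace n}
    (hy : y ∈ Metric.ball x r) : y ∈ frontier Ω ↔ inner ℝ e y = γ (hproj e y) := by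
  have hcont : Continuous fun z : RSpace n => inner ℝ e z - γ (hproj e z) :=
    (continuous_const.inner continuous_id).sub (h.contDiff.continuous.comp (hproj e).continuous)
  have hball : Metric.ball x r ∈ 𝓝 y := Metric.isOpen_ball.mem_nhds hy
  rw [hΩ.frontier_eq]
  constructor
  · rintro ⟨hcl, hn⟩
    rw [h.mem_iff y hy, not_lt] at hn
    refine le_antisymm ?_ hn
    by_contra hlt
    push Not at hlt
    have hev : ∀ᶠ z in 𝓝 y, 0 < inner ℝ e z - γ (hproj e z) :=
      (hcont.tendsto y).eventually (lt_mem_nhds (sub_pos.2 hlt))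
    have := mem_closure_iff_frequently.1 hcl
    obtain ⟨z, hz, hz1, hz2⟩ := (this.and_eventually (hev.and hball)).exists
    have := (h.mem_iff z hz2).1 hz
    linarith
  · intro heq
    refine ⟨?_, by rw [h.mem_iff y hy, heq]; exact lt_irrefl _⟩
    have ht : Tendsto (fun t : ℝ => y - t • e) (𝓝[>] 0) (𝓝 y) := by
      have : Continuous fun t : ℝ => y - t • e := by fun_prop
      simpa using (this.tendsto 0).mono_left nhdsWithin_le_nhds
    refine mem_closure_of_tendsto ht ?_
    filter_upwards [self_mem_nhdsWithin, ht hball] with t ht0 htb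
    rw [h.mem_iff _ htb, map_sub, map_smul, hproj_e h.norm_eq, inner_sub_right, inner_smul_right,
      inner_e_e h.norm_eq, heq]
    simpa using ht0

theorem IsOuterUnitNormal.norm_eq {v : RSpace n} (h : IsOuterUnitNormal Ω x v) : ‖v‖ = 1 := by
  obtain ⟨ρ, -, -, h0, -, rfl⟩ := h
  rw [norm_smul, norm_inv, norm_norm, inv_mul_cancel₀ (norm_ne_zero_iff.2 h0)]

/-- A direction which points inwards for one defining function does not point outwards for
another one. -/
theorem IsOuterUnitNormal.inner_nonpos {v v' a : RSpace n} (h : IsOuterUnitNormal Ω x v)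
    (h' : IsOuterUnitNormal Ω x v') (ha : inner ℝ v a < 0) : inner ℝ v' a ≤ 0 := by
  obtain ⟨ρ, hρ, hρx, h0, hev, rfl⟩ := h
  obtain ⟨σ, hσ, hσx, h0', hev', rfl⟩ := h'
  have hline : ∀ ρ : RSpace n → ℝ, ContDiffAt ℝ 1 ρ x →
      HasDerivAt (fun t : ℝ => ρ (x + t • a)) (inner ℝ (gradient ρ x) a) 0 := by
    intro ρ hρ
    have h1 : HasFDerivAt ρ (fderiv ℝ ρ x) (x + (0 : ℝ) • a) := by
      simpa using (hρ.differentiableAt (by norm_num)).hasFDerivAt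
    have h2 : HasDerivAt (fun t : ℝ => x + t • a) a 0 := by
      simpa using ((hasDerivAt_id (0 : ℝ)).smul_const a).const_add x
    rw [inner_gradient_left]
    exact h1.comp_hasDerivAt 0 h2
  rw [inner_smul_left] at ha ⊢
  have hn : 0 < ‖gradient ρ x‖⁻¹ := inv_pos.2 (norm_pos_iff.2 h0)
  have ha' : inner ℝ (gradient ρ x) a < 0 := by
    by_contra hc
    push Not at hc
    exact absurd ha (not_lt.2 (mul_nonneg hn.le hc))
  refine mul_nonpos_of_nonneg_of_nonpos (inv_nonneg.2 (norm_nonneg _)) ?_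
  by_contra hpos
  push Not at hpos
  have s1 := hasDerivAt_iff_tendsto_slope.1 (hline ρ hρ)
  have s2 := hasDerivAt_iff_tendsto_slope.1 (hline σ hσ)
  have hle : 𝓝[>] (0 : ℝ) ≤ 𝓝[≠] 0 := nhdsWithin_mono _ fun t ht => ne_of_gt ht
  have e1 := (s1.mono_left hle).eventually (gt_mem_nhds ha')
  have e2 := (s2.mono_left hle).eventually (lt_mem_nhds hpos)
  have ht : Tendsto (fun t : ℝ => x + t • a) (𝓝[>] 0) (𝓝 x) := by
    have : Continuous fun t : ℝ => x + t • a := by fun_prop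
    simpa using (this.tendsto 0).mono_left nhdsWithin_le_nhds
  obtain ⟨t, ⟨⟨⟨h1, h2⟩, h3⟩, h4⟩, ht0⟩ := ((((e1.and e2).and (ht.eventually hev)).and
    (ht.eventually hev')).and self_mem_nhdsWithin).exists
  have ht0' : (0 : ℝ) < t := ht0
  simp only [slope, sub_zero, vsub_eq_sub, zero_smul, add_zero, hρx, hσx, smul_eq_mul] at h1 h2
  have k1 : ρ (x + t • a) < 0 := by
    by_contra hc
    push Not at hc
    exact absurd h1 (not_lt.2 (mul_nonneg (inv_nonneg.2 ht0'.le) hc))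
  have k2 : ¬ σ (x + t • a) < 0 := fun hc =>
    absurd h2 (not_lt.2 (mul_nonpos_of_nonneg_of_nonpos (inv_nonneg.2 ht0'.le) hc.le))
  exact k2 (h4.1 (h3.2 k1))

/-- The outer unit normal does not depend on the defining function: otherwise `v' - v` would point
inwards for `v` but outwards for `v'`. -/
theorem IsOuterUnitNormal.unique {v v' : RSpace n} (h : IsOuterUnitNormal Ω x v)
    (h' : IsOuterUnitNormal Ω x v') : v = v' := by
  by_contra hne
  have hn := h.norm_eq
  have hn' := h'.norm_eq
  have hlt : inner ℝ v v' < 1 := inner_lt_one_iff_real_of_norm_eq_one hn hn' |>.2 hne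
  -- Both inner products `v · (v' - v)` and `v' · (v - v')` are negative when `v ≠ v'`.
  have h1 : inner ℝ v (v' - v) < 0 := by
    rw [inner_sub_right, real_inner_self_eq_norm_sq, hn]; linarith
  have h2 := h.inner_nonpos h' h1
  rw [inner_sub_right, real_inner_self_eq_norm_sq, hn', real_inner_comm] at h2
  linarith

theorem IsOuterUnitNormal.outerNormal_eq {v : RSpace n} (h : IsOuterUnitNormal Ω x v) :
    outerNormal Ω x = v := by
  have hex : ∃ v, IsOuterUnitNormal Ω x v := ⟨v, h⟩
  rw [outerNormal, dif_pos hex]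
  exact hex.choose_spec.unique h

theorem IsChart.isOuterUnitNormal (h : IsChart Ω x e r γ) (hΩ : IsOpen Ω) {y : RSpace n}
    (hy : y ∈ Metric.ball x r) (hyf : y ∈ frontier Ω) :
    IsOuterUnitNormal Ω y (chartNormal e γ y) := by
  have hd : ContDiff ℝ 1 fun z : RSpace n => inner ℝ e z - γ (hproj e z) :=
    (contDiff_const.inner ℝ contDiff_id).sub (h.contDiff.comp (hproj e).contDiff)
  have hg : gradient (fun z : RSpace n => inner ℝ e z - γ (hproj e z)) y =
      graphNormal e γ (hproj e y) := by
    refine ext_inner_right ℝ fun d => ?_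
    rw [inner_gradient_left, inner_graphNormal h.norm_eq]
    have h1 : HasFDerivAt (fun z : RSpace n => inner ℝ e z) (innerSL ℝ e) y :=
      (innerSL ℝ e).hasFDerivAt
    have h2 : HasFDerivAt (fun z : RSpace n => γ (hproj e z))
        (fderiv ℝ γ (hproj e y) ∘L hproj e) y :=
      ((h.contDiff.differentiable (by norm_num)) _).hasFDerivAt.comp y (hproj e).hasFDerivAt
    rw [show fderiv ℝ (fun z : RSpace n => inner ℝ e z - γ (hproj e z)) y = _ from
      (h1.sub h2).fderiv]
    simp
  refine ⟨fun z => inner ℝ e z - γ (hproj e z), hd.contDiffAt, ?_, ?_, ?_, ?_⟩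
  · exact sub_eq_zero.2 ((h.mem_frontier_iff hΩ hy).1 hyf)
  · rw [hg]; exact norm_pos_iff.1 (norm_graphNormal_pos h.norm_eq _)
  · filter_upwards [Metric.isOpen_ball.mem_nhds hy] with z hz
    rw [h.mem_iff z hz, sub_neg]
  · rw [hg]; rfl

theorem IsChart.outerNormal_eq (h : IsChart Ω x e r γ) (hΩ : IsOpen Ω) {y : RSpace n}
    (hy : y ∈ Metric.ball x r) (hyf : y ∈ frontier Ω) : outerNormal Ω y = chartNormal e γ y :=
  (h.isOuterUnitNormal hΩ hy hyf).outerNormal_eq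

theorem norm_outerNormal (hΩ : IsOpen Ω) (hb : HasC2Boundary Ω) (hx : x ∈ frontier Ω) :
    ‖outerNormal Ω x‖ = 1 := by
  obtain ⟨e, r, γ, h⟩ := hb.exists_isChart hx
  have := h.isOuterUnitNormal hΩ (Metric.mem_ball_self h.pos) hx
  rw [this.outerNormal_eq]
  exact this.norm_eq

theorem continuousOn_outerNormal (hΩ : IsOpen Ω) (hb : HasC2Boundary Ω) :
    ContinuousOn (outerNormal Ω) (frontier Ω) := by
  intro x hx
  obtain ⟨e, r, γ, h⟩ := hb.exists_isChart hx
  refine (continuous_chartNormal h.norm_eq h.contDiff).continuousWithinAt.congr_of_eventuallyEq ?_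
    (h.outerNormal_eq hΩ (Metric.mem_ball_self h.pos) hx)
  filter_upwards [self_mem_nhdsWithin,
    mem_nhdsWithin_of_mem_nhds (Metric.ball_mem_nhds x h.pos)] with y hy hyb
  exact h.outerNormal_eq hΩ hyb hy

/-! ### The divergence theorem on a bounded domain with `C²` boundary -/

/-- The divergence theorem for functions supported in a chart. The surface element `|e - ∇γ|` cancels
against the normalization of the normal. -/
theorem IsChart.setIntegral_fderiv (h : IsChart Ω x e r γ) (hΩ : IsOpen Ω) {f : RSpace n → ℝ}
    (hf : ContDiff ℝ 1 f) (hs : tsupport f ⊆ Metric.ball x r) (d : RSpace n) :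
    ∫ y in Ω, fderiv ℝ f y d = ∫ y, f y * inner ℝ (outerNormal Ω y) d ∂surfaceMeasure Ω := by
  have hcs : HasCompactSupport f :=
    (isCompact_closedBall x r).of_isClosed_subset (isClosed_tsupport f)
      (hs.trans Metric.ball_subset_closedBall)
  have hcl := isClosedEmbedding_graphMap h.norm_eq h.contDiff.continuous
  have hbelow : MeasurableSet {y : RSpace n | inner ℝ e y < γ (hproj e y)} :=
    (isOpen_lt (continuous_const.inner continuous_id)
      (h.contDiff.continuous.comp (hproj e).continuous)).measurableSet
  have e1 : ∫ y in Ω, fderiv ℝ f y d =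
      ∫ y in {y : RSpace n | inner ℝ e y < γ (hproj e y)}, fderiv ℝ f y d := by
    rw [← integral_indicator hΩ.measurableSet, ← integral_indicator hbelow]
    congr 1 with y
    by_cases hy : y ∈ Metric.ball x r
    · simp only [indicator, h.mem_iff y hy, mem_ofPred_eq]
    · have : fderiv ℝ f y = 0 := by
        by_contra hne
        exact hy (hs (support_fderiv_subset ℝ (Function.mem_support.2 hne)))
      simp [indicator, this]
  have e2 : ∫ y, f y * inner ℝ (outerNormal Ω y) d ∂surfaceMeasure Ω =
      ∫ y in range (graphMap e γ), f y * inner ℝ (chartNormal e γ y) d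
        ∂(Measure.euclideanHausdorffMeasure (n - 1)) := by
    rw [surfaceMeasure, ← integral_indicator isClosed_frontier.measurableSet,
      ← integral_indicator hcl.isClosed_range.measurableSet]
    congr 1 with y
    by_cases hy : y ∈ Metric.ball x r
    · by_cases hyf : y ∈ frontier Ω
      · have : y ∈ range (graphMap e γ) := by
          rw [range_graphMap h.norm_eq]; exact (h.mem_frontier_iff hΩ hy).1 hyf
        rw [indicator_of_mem hyf, indicator_of_mem this, h.outerNormal_eq hΩ hy hyf]
      · have : y ∉ range (graphMap e γ) := by
          rw [range_graphMap h.norm_eq]; exact fun hc => hyf ((h.mem_frontier_iff hΩ hy).2 hc)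
        rw [indicator_of_notMem hyf, indicator_of_notMem this]
    · have : f y = 0 := by
        by_contra hne
        exact hy (hs (subset_tsupport f hne))
      simp [indicator, this]
  have hn : n - 1 = finrank ℝ (RSpace n) - 1 := by simp
  rw [e1, setIntegral_fderiv_below_graph h.norm_eq h.contDiff hf hcs, e2, hn,
    setIntegral_range_graphMap h.norm_eq h.contDiff]
  congr 1 with w
  have hpos := norm_graphNormal_pos h.norm_eq (γ := γ) w
  rw [chartNormal, hproj_graphMap h.norm_eq, inner_smul_left]
  simp only [map_inv₀, conj_trivial]
  field_simp

theorem isCompact_frontier_of_isBounded (hbd : Bornology.IsBounded Ω) : IsCompact (frontier Ω) :=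
  hbd.isCompact_closure.of_isClosed_subset isClosed_frontier frontier_subset_closure

theorem isFiniteMeasure_surfaceMeasure (hΩ : IsOpen Ω) (hbd : Bornology.IsBounded Ω)
    (hb : HasC2Boundary Ω) : IsFiniteMeasure (surfaceMeasure Ω) := by
  refine ⟨?_⟩
  rw [surfaceMeasure, Measure.restrict_apply_univ]
  refine (isCompact_frontier_of_isBounded hbd).measure_lt_top_of_nhdsWithin fun x hx => ?_
  obtain ⟨e, r, γ, h⟩ := hb.exists_isChart hx
  refine ⟨Metric.ball x r ∩ frontier Ω,
    inter_mem (mem_nhdsWithin_of_mem_nhds (Metric.ball_mem_nhds x h.pos)) self_mem_nhdsWithin, ?_⟩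
  have hn : n - 1 = finrank ℝ (RSpace n) - 1 := by simp
  rw [hn]
  refine (measure_mono ?_).trans_lt (euclideanHausdorffMeasure_graph_lt_top h.norm_eq h.contDiff
    (isCompact_closedBall x r))
  rintro y ⟨hy, hyf⟩
  refine ⟨Metric.ball_subset_closedBall hy, ?_⟩
  rw [range_graphMap h.norm_eq]
  exact (h.mem_frontier_iff hΩ hy).1 hyf

end Chart

section Global

variable {n : ℕ} {Ω : Set (RSpace n)}

theorem aestronglyMeasurable_surfaceMeasure {F : Type*} [NormedAddCommGroup F] [NormedSpace ℝ F]
    [FiniteDimensional ℝ F] {g : RSpace n → F} (hg : ContinuousOn g (frontier Ω)) :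
    AEStronglyMeasurable g (surfaceMeasure Ω) := by
  exact hg.aestronglyMeasurable isClosed_frontier.measurableSet

theorem ae_surfaceMeasure_mem_frontier : ∀ᵐ y ∂surfaceMeasure Ω, y ∈ frontier Ω :=
  ae_restrict_mem isClosed_frontier.measurableSet

theorem memLp_surfaceMeasure (hΩ : IsOpen Ω) (hbd : Bornology.IsBounded Ω)
    (hb : HasC2Boundary Ω) {F : Type*} [NormedAddCommGroup F] [NormedSpace ℝ F]
    [FiniteDimensional ℝ F] {g : RSpace n → F} (hg : ContinuousOn g (frontier Ω)) (p : ℝ≥0∞) :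
    MemLp g p (surfaceMeasure Ω) := by
  have := isFiniteMeasure_surfaceMeasure hΩ hbd hb
  obtain ⟨C, hC⟩ := (isCompact_frontier_of_isBounded hbd).exists_bound_of_continuousOn hg
  refine MemLp.of_bound (aestronglyMeasurable_surfaceMeasure hg) C ?_
  filter_upwards [ae_surfaceMeasure_mem_frontier] with y hy using hC y hy

theorem memLp_restrict_of_continuousOn (hΩ : IsOpen Ω) (hbd : Bornology.IsBounded Ω)
    {F : Type*} [NormedAddCommGroup F] [NormedSpace ℝ F]
    [FiniteDimensional ℝ F] {g : RSpace n → F} (hg : ContinuousOn g (closure Ω)) (p : ℝ≥0∞) :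
    MemLp g p (volume.restrict Ω) := by
  have hfin : IsFiniteMeasure (volume.restrict Ω) :=
    ⟨by rw [Measure.restrict_apply_univ]; exact hbd.measure_lt_top⟩
  obtain ⟨C, hC⟩ := hbd.isCompact_closure.exists_bound_of_continuousOn hg
  refine MemLp.of_bound ((hg.mono subset_closure).aestronglyMeasurable hΩ.measurableSet) C ?_
  filter_upwards [ae_restrict_mem hΩ.measurableSet] with y hy using hC y (subset_closure hy)

theorem integrableOn_of_continuousOn (hΩ : IsOpen Ω) (hbd : Bornology.IsBounded Ω)
    {F : Type*} [NormedAddCommGroup F] [NormedSpace ℝ F]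
    [FiniteDimensional ℝ F] {g : RSpace n → F} (hg : ContinuousOn g (closure Ω)) :
    IntegrableOn g Ω :=
  memLp_one_iff_integrable.1 (memLp_restrict_of_continuousOn hΩ hbd hg 1)

theorem integrable_surfaceMeasure (hΩ : IsOpen Ω) (hbd : Bornology.IsBounded Ω)
    (hb : HasC2Boundary Ω) {F : Type*} [NormedAddCommGroup F] [NormedSpace ℝ F]
    [FiniteDimensional ℝ F] {g : RSpace n → F} (hg : ContinuousOn g (frontier Ω)) :
    Integrable g (surfaceMeasure Ω) :=
  memLp_one_iff_integrable.1 (memLp_surfaceMeasure hΩ hbd hb hg 1)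

/-- The divergence theorem for functions supported inside `Ω`: both sides vanish. -/
theorem setIntegral_fderiv_of_tsupport_subset (hΩ : IsOpen Ω) (hbd : Bornology.IsBounded Ω)
    {f : RSpace n → ℝ} (hf : ContDiff ℝ 1 f) (hs : tsupport f ⊆ Ω) (d : RSpace n) :
    ∫ y in Ω, fderiv ℝ f y d = ∫ y, f y * inner ℝ (outerNormal Ω y) d ∂surfaceMeasure Ω := by
  have hcs : HasCompactSupport f :=
    hbd.isCompact_closure.of_isClosed_subset (isClosed_tsupport f) (hs.trans subset_closure)
  have e1 : ∫ y in Ω, fderiv ℝ f y d = ∫ y, fderiv ℝ f y d := by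
    refine setIntegral_eq_integral_of_forall_compl_eq_zero fun y hy => ?_
    have : fderiv ℝ f y = 0 := by
      by_contra hne
      exact hy (hs (support_fderiv_subset ℝ (Function.mem_support.2 hne)))
    simp [this]
  have e2 : ∫ y, f y * inner ℝ (outerNormal Ω y) d ∂surfaceMeasure Ω = 0 := by
    refine integral_eq_zero_of_ae ?_
    filter_upwards [ae_surfaceMeasure_mem_frontier] with y hy
    have : f y = 0 := by
      by_contra hne
      rw [hΩ.frontier_eq] at hy
      exact hy.2 (hs (subset_tsupport f hne))
    simp [this]
  rw [e1, e2]
  have := integral_mul_fderiv_eq_neg_fderiv_mul_of_integrable (μ := volume)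
      (f := fun _ : RSpace n => (1 : ℝ)) (g := f) (v := d) (by simp) ?_ ?_
      (fun x _ => differentiableAt_const _) (fun x _ => hf.differentiable (by norm_num) x)
  · simpa using this
  · simp only [one_mul]
    exact ((hf.continuous_fderiv (by norm_num)).clm_apply
        continuous_const).integrable_of_hasCompactSupport
        ((hcs.fderiv ℝ).comp_left (g := fun L : RSpace n →L[ℝ] ℝ => L d) rfl)
  · simp only [one_mul]
    exact hf.continuous.integrable_of_hasCompactSupport hcs

/-- The divergence theorem, for one direction `d`. The local cases are patched together with
the functions `∏ (1 - χ)`, for finitely many bump functions `χ`. -/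
theorem setIntegral_fderiv_eq (hΩ : IsOpen Ω) (hbd : Bornology.IsBounded Ω)
    (hb : HasC2Boundary Ω) {f : RSpace n → ℝ} (hf : ContDiff ℝ 1 f) (d : RSpace n) :
    ∫ y in Ω, fderiv ℝ f y d = ∫ y, f y * inner ℝ (outerNormal Ω y) d ∂surfaceMeasure Ω := by
  have hloc : ∀ x ∈ closure Ω, ∃ V ∈ 𝓝 x, ∀ g : RSpace n → ℝ, ContDiff ℝ 1 g → tsupport g ⊆ V →
      ∫ y in Ω, fderiv ℝ g y d = ∫ y, g y * inner ℝ (outerNormal Ω y) d ∂surfaceMeasure Ω := by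
    intro x hx
    by_cases hxΩ : x ∈ Ω
    · exact ⟨Ω, hΩ.mem_nhds hxΩ, fun g hg hs =>
        setIntegral_fderiv_of_tsupport_subset hΩ hbd hg hs d⟩
    · have hxf : x ∈ frontier Ω := by rw [hΩ.frontier_eq]; exact ⟨hx, hxΩ⟩
      obtain ⟨e, r, γ, h⟩ := hb.exists_isChart hxf
      exact ⟨_, Metric.ball_mem_nhds x h.pos, fun g hg hs => h.setIntegral_fderiv hΩ hg hs d⟩
  have hbump : ∀ x ∈ closure Ω, ∃ χ : RSpace n → ℝ, ContDiff ℝ 1 χ ∧ (∀ᶠ y in 𝓝 x, χ y = 1) ∧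
      ∀ g : RSpace n → ℝ, ContDiff ℝ 1 g →
        ∫ y in Ω, fderiv ℝ (fun z => χ z * g z) y d =
          ∫ y, χ y * g y * inner ℝ (outerNormal Ω y) d ∂surfaceMeasure Ω := by
    intro x hx
    obtain ⟨V, hV, h⟩ := hloc x hx
    obtain ⟨R, hR, hRV⟩ := Metric.mem_nhds_iff.1 hV
    let χ : ContDiffBump x := ⟨R / 3, R / 2, by positivity, by linarith⟩
    refine ⟨χ, χ.contDiff, χ.eventuallyEq_one, fun g hg => ?_⟩
    refine h (fun z => χ z * g z) (χ.contDiff.mul hg) ((tsupport_mul_subset_left).trans ?_)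
    rw [χ.tsupport_eq]
    exact (Metric.closedBall_subset_ball (by change R / 2 < R; linarith)).trans hRV
  have hadd : ∀ g₁ g₂ : RSpace n → ℝ, ContDiff ℝ 1 g₁ → ContDiff ℝ 1 g₂ →
      (∫ y in Ω, fderiv ℝ g₁ y d = ∫ y, g₁ y * inner ℝ (outerNormal Ω y) d ∂surfaceMeasure Ω) →
      (∫ y in Ω, fderiv ℝ g₂ y d = ∫ y, g₂ y * inner ℝ (outerNormal Ω y) d ∂surfaceMeasure Ω) →
      ∫ y in Ω, fderiv ℝ (fun z => g₁ z + g₂ z) y d =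
        ∫ y, (g₁ y + g₂ y) * inner ℝ (outerNormal Ω y) d ∂surfaceMeasure Ω := by
    intro g₁ g₂ h₁ h₂ e₁ e₂
    have hi : ∀ g : RSpace n → ℝ, ContDiff ℝ 1 g → IntegrableOn (fun y => fderiv ℝ g y d) Ω :=
      fun g hg => integrableOn_of_continuousOn hΩ hbd
        ((hg.continuous_fderiv (by norm_num)).clm_apply continuous_const).continuousOn
    have hs : ∀ g : RSpace n → ℝ, ContDiff ℝ 1 g →
        Integrable (fun y => g y * inner ℝ (outerNormal Ω y) d) (surfaceMeasure Ω) :=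
      fun g hg => integrable_surfaceMeasure hΩ hbd hb
        (hg.continuous.continuousOn.mul ((continuousOn_outerNormal hΩ hb).inner continuousOn_const))
    simp_rw [add_mul]
    rw [integral_add (hs _ h₁) (hs _ h₂), ← e₁, ← e₂, ← integral_add (hi _ h₁) (hi _ h₂)]
    congr 1 with y
    rw [show fderiv ℝ (fun z => g₁ z + g₂ z) y = _ from fderiv_add
      (h₁.differentiable (by norm_num) y) (h₂.differentiable (by norm_num) y)]
    rfl
  choose! χ hχ hχ1 hχP using hbump
  obtain ⟨T, hT⟩ := hbd.isCompact_closure.elim_nhds_subcover'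
    (fun x _ => interior {y | χ x y = 1}) (fun x hx => interior_mem_nhds.2 (hχ1 x hx))
  -- `1 - ∏ (1 - χ)` is a telescoping sum of the functions `χ_a ∏ (1 - χ)`, each supported in one of
  -- the neighbourhoods, and it equals `1` near every point of the closure of `Ω`.
  have hprod : ∀ s : Finset (closure Ω), ContDiff ℝ 1 fun z => ∏ x ∈ s, (1 - χ x z) := fun s =>
    contDiff_prod fun x _ => contDiff_const.sub (hχ x x.2)
  have hind : ∀ s : Finset (closure Ω), ∀ g : RSpace n → ℝ, ContDiff ℝ 1 g →
      ∫ y in Ω, fderiv ℝ (fun z => (1 - ∏ x ∈ s, (1 - χ x z)) * g z) y d =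
        ∫ y, (1 - ∏ x ∈ s, (1 - χ x y)) * g y * inner ℝ (outerNormal Ω y) d
          ∂surfaceMeasure Ω := by
    intro s
    induction s using Finset.induction_on with
    | empty => intro g _; simp
    | insert a s ha ih =>
      intro g hg
      have h1 := ih g hg
      have h2 := hχP a a.2 (fun z => (∏ x ∈ s, (1 - χ x z)) * g z) ((hprod s).mul hg)
      have h3 := hadd _ _ ((contDiff_const.sub (hprod s)).mul hg)
        ((hχ a a.2).mul ((hprod s).mul hg)) h1 h2
      have e : ∀ z, (1 - ∏ x ∈ insert a s, (1 - χ x z)) * g z =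
          (1 - ∏ x ∈ s, (1 - χ x z)) * g z + χ a z * ((∏ x ∈ s, (1 - χ x z)) * g z) := by
        intro z; rw [Finset.prod_insert ha]; ring
      simp_rw [e]
      exact h3
  have hone : ∀ y ∈ closure Ω, ∀ᶠ z in 𝓝 y, (1 - ∏ x ∈ T, (1 - χ x z)) * f z = f z := by
    intro y hy
    obtain ⟨x, hx, hyx⟩ := mem_iUnion₂.1 (hT hy)
    filter_upwards [isOpen_interior.mem_nhds hyx] with z hz
    have hz1 : z ∈ {y | χ x y = 1} := interior_subset hz
    have hz1 : χ x z = 1 := hz1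
    rw [Finset.prod_eq_zero hx (by rw [hz1, sub_self]), sub_zero, one_mul]
  have h := hind T f hf
  have e1 : ∫ y in Ω, fderiv ℝ (fun z => (1 - ∏ x ∈ T, (1 - χ x z)) * f z) y d =
      ∫ y in Ω, fderiv ℝ f y d := by
    refine setIntegral_congr_fun hΩ.measurableSet fun y hy => ?_
    have : fderiv ℝ (fun z => (1 - ∏ x ∈ T, (1 - χ x z)) * f z) y = fderiv ℝ f y :=
      Filter.EventuallyEq.fderiv_eq (hone y (subset_closure hy))
    simp only [this]
  rw [← e1, h]
  refine integral_congr_ae ?_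
  filter_upwards [ae_surfaceMeasure_mem_frontier] with y hy
  rw [(hone y (frontier_subset_closure hy)).self_of_nhds]

/-! ### The trace inequality -/

theorem fderiv_apply_eq_sum {F : Type*} [NormedAddCommGroup F] [NormedSpace ℝ F]
    (f : RSpace n → F) (x a : RSpace n) :
    fderiv ℝ f x a = ∑ j, a j • classicalPartial j f x := by
  conv_lhs => rw [← (EuclideanSpace.basisFun (Fin n) ℝ).sum_repr a]
  simp [classicalPartial]

theorem sq_fderiv_apply_le (f : RSpace n → ℝ) (x a : RSpace n) :
    (fderiv ℝ f x a) ^ 2 ≤ ‖a‖ ^ 2 * ∑ j, classicalPartial j f x ^ 2 := by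
  rw [fderiv_apply_eq_sum, EuclideanSpace.norm_sq_eq]
  simpa using Finset.sum_mul_sq_le_sq_mul_sq Finset.univ (fun j => a j)
    (fun j => classicalPartial j f x)

theorem continuous_classicalPartial {F : Type*} [NormedAddCommGroup F] [NormedSpace ℝ F]
    {f : RSpace n → F} (hf : ContDiff ℝ 1 f) (j : Fin n) : Continuous (classicalPartial j f) :=
  (hf.continuous_fderiv (by norm_num)).clm_apply continuous_const

/-- The trace inequality for real functions which are `C¹` up to the boundary. It follows from the
divergence theorem for the fields `f² χ ν(x)`, with `χ` supported near the boundary point `x`. -/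
theorem exists_integral_sq_surfaceMeasure_le (hΩ : IsOpen Ω) (hbd : Bornology.IsBounded Ω)
    (hb : HasC2Boundary Ω) : ∃ C : ℝ, 0 ≤ C ∧ ∀ f : RSpace n → ℝ, ContDiff ℝ 1 f →
      ∫ y, f y ^ 2 ∂surfaceMeasure Ω ≤
        C * ((∫ y in Ω, f y ^ 2) + ∑ j, ∫ y in Ω, classicalPartial j f y ^ 2) := by
  have hν := continuousOn_outerNormal hΩ hb
  have hbump : ∀ x ∈ frontier Ω, ∃ χ : RSpace n → ℝ, ContDiff ℝ 1 χ ∧ (∀ᶠ y in 𝓝 x, χ y = 1) ∧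
      (∀ y, 0 ≤ χ y ∧ χ y ≤ 1) ∧ ∀ y ∈ frontier Ω, χ y ≠ 0 →
        1 / 2 ≤ inner ℝ (outerNormal Ω y) (outerNormal Ω x) := by
    intro x hx
    have h1 : ∀ᶠ y in 𝓝[frontier Ω] x,
        1 / 2 < inner ℝ (outerNormal Ω y) (outerNormal Ω x) := by
      have hc : ContinuousWithinAt (fun y => inner ℝ (outerNormal Ω y) (outerNormal Ω x))
        (frontier Ω) x := (hν.inner continuousOn_const) x hx
      refine hc.eventually (lt_mem_nhds ?_)
      beta_reduce
      rw [real_inner_self_eq_norm_sq, norm_outerNormal hΩ hb hx]; norm_num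
    rw [eventually_nhdsWithin_iff] at h1
    obtain ⟨R, hR, hRV⟩ := Metric.eventually_nhds_iff_ball.1 h1
    let χ : ContDiffBump x := ⟨R / 3, R / 2, by positivity, by linarith⟩
    refine ⟨χ, χ.contDiff, χ.eventuallyEq_one, fun y => ⟨χ.nonneg, χ.le_one⟩, fun y hy hy0 => ?_⟩
    have hy1 : y ∈ Metric.ball x (R / 2) := by
      have : y ∈ Function.support χ := hy0
      rwa [χ.support_eq] at this
    exact (hRV y (Metric.ball_subset_ball (by linarith) hy1) hy).le
  choose! χ hχ hχ1 hχ01 hχν using hbump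
  obtain ⟨T, hT⟩ := (isCompact_frontier_of_isBounded hbd).elim_nhds_subcover'
    (fun x _ => {y | χ x y = 1}) (fun x hx => hχ1 x hx)
  have hB : ∀ x : frontier Ω, ∃ B : ℝ, 0 ≤ B ∧ ∀ y ∈ closure Ω,
      |fderiv ℝ (χ x) y (outerNormal Ω x)| ≤ B := by
    intro x
    obtain ⟨B, hB⟩ := hbd.isCompact_closure.exists_bound_of_continuousOn
      (f := fun y => fderiv ℝ (χ x) y (outerNormal Ω x))
      (((hχ x x.2).continuous_fderiv (by norm_num)).clm_apply continuous_const).continuousOn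
    exact ⟨max B 0, le_max_right _ _, fun y hy => (hB y hy).trans (le_max_left _ _)⟩
  choose B hB0 hB using hB
  refine ⟨2 * ∑ x ∈ T, (B x + 1), by
    have := Finset.sum_nonneg (s := T) (f := fun x => B x + 1) fun x _ => by linarith [hB0 x]
    linarith, fun f hf => ?_⟩
  set Q := (∫ y in Ω, f y ^ 2) + ∑ j, ∫ y in Ω, classicalPartial j f y ^ 2 with hQ
  have hf2 : IntegrableOn (fun y => f y ^ 2) Ω :=
    integrableOn_of_continuousOn hΩ hbd (hf.continuous.pow 2).continuousOn
  have hj2 : ∀ j, IntegrableOn (fun y => classicalPartial j f y ^ 2) Ω := fun j =>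
    integrableOn_of_continuousOn hΩ hbd ((continuous_classicalPartial hf j).pow 2).continuousOn
  have hpart : ∀ x : frontier Ω,
      ∫ y, χ x y * f y ^ 2 * inner ℝ (outerNormal Ω y) (outerNormal Ω x) ∂surfaceMeasure Ω ≤
        (B x + 1) * Q := by
    intro x
    have hfun : ContDiff ℝ 1 fun y => χ x y * f y ^ 2 := (hχ x x.2).mul (hf.pow 2)
    rw [← setIntegral_fderiv_eq hΩ hbd hb hfun]
    have hrhs : (B x + 1) * Q = ∫ y in Ω, (B x + 1) *
        (f y ^ 2 + ∑ j, classicalPartial j f y ^ 2) := by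
      rw [integral_const_mul, integral_add hf2 (integrable_finsetSum _ fun j _ => hj2 j),
        integral_finsetSum _ fun j _ => hj2 j]
    rw [hrhs]
    refine setIntegral_mono_on (integrableOn_of_continuousOn hΩ hbd
      ((hfun.continuous_fderiv (by norm_num)).clm_apply continuous_const).continuousOn)
      ((hf2.add (integrable_finsetSum _ fun j _ => hj2 j)).const_mul _) hΩ.measurableSet
      fun y hy => ?_
    have h1 := (((hχ x x.2).differentiable (by norm_num)) y).hasFDerivAt
    have h2 := (hf.differentiable (by norm_num) y).hasFDerivAt
    have h3 := h1.mul (h2.pow 2)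
    rw [show fderiv ℝ (fun y => χ x y * f y ^ 2) y = _ from h3.fderiv]
    have h4 := hB x y (subset_closure hy)
    have h5 := sq_fderiv_apply_le f y (outerNormal Ω x)
    rw [norm_outerNormal hΩ hb x.2] at h5
    have h6 := (hχ01 x x.2 y)
    simp only [add_apply, smul_apply, smul_eq_mul]
    set S := ∑ j, classicalPartial j f y ^ 2
    set p := fderiv ℝ f y (outerNormal Ω x)
    set q := fderiv ℝ (χ x) y (outerNormal Ω x)
    have hS : 0 ≤ S := Finset.sum_nonneg fun j _ => sq_nonneg _
    have h7 : f y ^ 2 * q ≤ f y ^ 2 * B x :=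
      mul_le_mul_of_nonneg_left ((le_abs_self _).trans h4) (sq_nonneg _)
    have h8 : χ x y * (2 * f y * p) ≤ f y ^ 2 + S := by
      have : χ x y * (2 * f y * p) ≤ χ x y * (f y ^ 2 + p ^ 2) :=
        mul_le_mul_of_nonneg_left (by nlinarith [sq_nonneg (f y - p)]) h6.1
      nlinarith [sq_nonneg (f y), sq_nonneg p, h6.2]
    have h9 : 0 ≤ B x * S := mul_nonneg (hB0 x) hS
    norm_num
    nlinarith
  have hsum : ∫ y, f y ^ 2 ∂surfaceMeasure Ω ≤ ∑ x ∈ T,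
      2 * ∫ y, χ x y * f y ^ 2 * inner ℝ (outerNormal Ω y) (outerNormal Ω x)
        ∂surfaceMeasure Ω := by
    have hi : ∀ x : frontier Ω, Integrable (fun y => χ x y * f y ^ 2 *
        inner ℝ (outerNormal Ω y) (outerNormal Ω x)) (surfaceMeasure Ω) := fun x =>
      integrable_surfaceMeasure hΩ hbd hb ((((hχ x x.2).continuous.mul
        (hf.continuous.pow 2)).continuousOn).mul (hν.inner continuousOn_const))
    simp_rw [← integral_const_mul]
    rw [← integral_finsetSum _ fun x _ => (hi x).const_mul 2]
    refine integral_mono_ae (integrable_surfaceMeasure hΩ hbd hb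
      (hf.continuous.pow 2).continuousOn) (integrable_finsetSum _ fun x _ => (hi x).const_mul 2) ?_
    filter_upwards [ae_surfaceMeasure_mem_frontier] with y hy
    obtain ⟨x, hx, hyx⟩ := mem_iUnion₂.1 (hT hy)
    have hyx : χ x y = 1 := hyx
    have hnn : ∀ z ∈ T, 0 ≤ 2 * (χ z y * f y ^ 2 *
        inner ℝ (outerNormal Ω y) (outerNormal Ω z)) := by
      intro z _
      by_cases h0 : χ z y = 0
      · simp [h0]
      · have h1 := hχν z z.2 y hy h0
        have h2 := (hχ01 z z.2 y).1
        exact mul_nonneg (by norm_num) (mul_nonneg (mul_nonneg h2 (sq_nonneg _)) (by linarith))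
    refine le_trans ?_ (Finset.single_le_sum hnn hx)
    have h1 := hχν x x.2 y hy (by rw [hyx]; norm_num)
    rw [hyx]
    nlinarith [sq_nonneg (f y)]
  refine hsum.trans ?_
  rw [← Finset.mul_sum, mul_assoc, Finset.sum_mul]
  gcongr with x hx
  exact hpart x

end Global

section Trace

variable {n : ℕ} {Ω : Set (RSpace n)}

theorem sqrt_add_le_sqrt_add_sqrt {a b : ℝ} (ha : 0 ≤ a) (hb : 0 ≤ b) : √(a + b) ≤ √a + √b := by
  rw [Real.sqrt_le_left (by positivity)]
  nlinarith [Real.sq_sqrt ha, Real.sq_sqrt hb, mul_nonneg (Real.sqrt_nonneg a) (Real.sqrt_nonneg b)]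

theorem eLpNorm_two_eq_sqrt {α : Type*} [MeasurableSpace α] {μ : Measure α} {f : α → ℝ}
    (hf : MemLp f 2 μ) : eLpNorm f 2 μ = ENNReal.ofReal √(∫ x, f x ^ 2 ∂μ) := by
  rw [hf.eLpNorm_eq_integral_rpow_norm (by norm_num) (by norm_num), Real.sqrt_eq_rpow]
  simp

theorem classicalPartial_re {f : RSpace n → ℂ} (hf : ContDiff ℝ 1 f) (j : Fin n) (x : RSpace n) :
    classicalPartial j (fun y => (f y).re) x = (classicalPartial j f x).re := by
  have h := Complex.reCLM.hasFDerivAt.comp x (hf.differentiable (by norm_num) x).hasFDerivAt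
  rw [classicalPartial, show fderiv ℝ (fun y => (f y).re) x = _ from h.fderiv]
  rfl

theorem classicalPartial_im {f : RSpace n → ℂ} (hf : ContDiff ℝ 1 f) (j : Fin n) (x : RSpace n) :
    classicalPartial j (fun y => (f y).im) x = (classicalPartial j f x).im := by
  have h := Complex.imCLM.hasFDerivAt.comp x (hf.differentiable (by norm_num) x).hasFDerivAt
  rw [classicalPartial, show fderiv ℝ (fun y => (f y).im) x = _ from h.fderiv]
  rfl

theorem classicalPartial_sub {f g : RSpace n → ℂ} (hf : ContDiff ℝ 1 f) (hg : ContDiff ℝ 1 g)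
    (j : Fin n) (x : RSpace n) :
    classicalPartial j (fun y => f y - g y) x = classicalPartial j f x - classicalPartial j g x := by
  rw [classicalPartial, show fderiv ℝ (fun y => f y - g y) x = _ from
    fderiv_sub (hf.differentiable (by norm_num) x) (hg.differentiable (by norm_num) x)]
  rfl

theorem contDiff_classicalPartial {F : Type*} [NormedAddCommGroup F] [NormedSpace ℝ F]
    {f : RSpace n → F} (hf : ContDiff ℝ ∞ f) (j : Fin n) : ContDiff ℝ ∞ (classicalPartial j f) :=
  (hf.fderiv_right (m := ∞) (by norm_num)).clm_apply contDiff_const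

/-- The trace inequality for complex functions. -/
theorem exists_eLpNorm_surfaceMeasure_le (hΩ : IsOpen Ω) (hbd : Bornology.IsBounded Ω)
    (hb : HasC2Boundary Ω) : ∃ C : ℝ≥0∞, C ≠ ⊤ ∧ ∀ f : RSpace n → ℂ, ContDiff ℝ 1 f →
      eLpNorm f 2 (surfaceMeasure Ω) ≤ C * (eLpNorm f 2 (volume.restrict Ω) +
        ∑ j, eLpNorm (classicalPartial j f) 2 (volume.restrict Ω)) := by
  obtain ⟨C, hC0, hC⟩ := exists_integral_sq_surfaceMeasure_le hΩ hbd hb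
  have hreal : ∀ f : RSpace n → ℝ, ContDiff ℝ 1 f →
      eLpNorm f 2 (surfaceMeasure Ω) ≤ ENNReal.ofReal √C * (eLpNorm f 2 (volume.restrict Ω) +
        ∑ j, eLpNorm (classicalPartial j f) 2 (volume.restrict Ω)) := by
    intro f hf
    have hm : ∀ g : RSpace n → ℝ, Continuous g → MemLp g 2 (volume.restrict Ω) := fun g hg =>
      memLp_restrict_of_continuousOn hΩ hbd hg.continuousOn 2
    rw [eLpNorm_two_eq_sqrt (memLp_surfaceMeasure hΩ hbd hb hf.continuous.continuousOn 2),
      eLpNorm_two_eq_sqrt (hm f hf.continuous)]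
    simp_rw [fun j => eLpNorm_two_eq_sqrt (hm _ (continuous_classicalPartial hf j))]
    rw [← ENNReal.ofReal_sum_of_nonneg fun j _ => Real.sqrt_nonneg _,
      ← ENNReal.ofReal_add (Real.sqrt_nonneg _) (Finset.sum_nonneg fun j _ => Real.sqrt_nonneg _),
      ← ENNReal.ofReal_mul (Real.sqrt_nonneg _)]
    refine ENNReal.ofReal_le_ofReal ?_
    refine (Real.sqrt_le_sqrt (hC f hf)).trans ?_
    rw [Real.sqrt_mul hC0]
    refine mul_le_mul_of_nonneg_left ?_ (Real.sqrt_nonneg _)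
    have hs : ∀ (s : Finset (Fin n)) (b : Fin n → ℝ), (∀ j, 0 ≤ b j) →
        √(∑ j ∈ s, b j) ≤ ∑ j ∈ s, √(b j) := by
      intro s b hb0
      induction s using Finset.induction_on with
      | empty => simp
      | insert a s ha ih =>
        rw [Finset.sum_insert ha, Finset.sum_insert ha]
        exact (sqrt_add_le_sqrt_add_sqrt (hb0 a) (Finset.sum_nonneg fun j _ => hb0 j)).trans
          (by gcongr)
    refine (sqrt_add_le_sqrt_add_sqrt (integral_nonneg fun _ => sq_nonneg _)
      (Finset.sum_nonneg fun j _ => integral_nonneg fun _ => sq_nonneg _)).trans ?_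
    gcongr
    exact hs _ _ fun j => integral_nonneg fun _ => sq_nonneg _
  refine ⟨ENNReal.ofReal √C + ENNReal.ofReal √C, by simp, fun f hf => ?_⟩
  have hre : ContDiff ℝ 1 fun y => (f y).re := Complex.reCLM.contDiff.comp hf
  have him : ContDiff ℝ 1 fun y => (f y).im := Complex.imCLM.contDiff.comp hf
  have h1 : eLpNorm f 2 (surfaceMeasure Ω) ≤ eLpNorm (fun y => (f y).re) 2 (surfaceMeasure Ω) +
      eLpNorm (fun y => (f y).im) 2 (surfaceMeasure Ω) := by
    have hsm : ∀ g : RSpace n → ℝ, Continuous g → AEStronglyMeasurable g (surfaceMeasure Ω) :=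
      fun g hg => hg.aestronglyMeasurable
    have : eLpNorm f 2 (surfaceMeasure Ω) ≤
        eLpNorm (fun y => ‖(f y).re‖ + ‖(f y).im‖) 2 (surfaceMeasure Ω) :=
      eLpNorm_mono_real fun y => Complex.norm_le_abs_re_add_abs_im _
    have h2 := eLpNorm_add_le (hsm _ hre.continuous.norm) (hsm _ him.continuous.norm)
      (p := 2) (by norm_num)
    rw [eLpNorm_norm, eLpNorm_norm] at h2
    exact this.trans h2
  refine h1.trans ?_
  rw [add_mul]
  refine add_le_add ((hreal _ hre).trans ?_) ((hreal _ him).trans ?_)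
  · gcongr with j
    · exact eLpNorm_mono fun y => Complex.abs_re_le_norm _
    · refine eLpNorm_mono fun y => ?_
      rw [classicalPartial_re hf]; exact Complex.abs_re_le_norm _
  · gcongr with j
    · exact eLpNorm_mono fun y => Complex.abs_im_le_norm _
    · refine eLpNorm_mono fun y => ?_
      rw [classicalPartial_im hf]; exact Complex.abs_im_le_norm _

/-! ### Weak derivatives and traces of limits of smooth functions -/

/-- Uniqueness of weak derivatives. -/
theorem HasWeakPartial.ae_eq (hΩ : IsOpen Ω) {j : Fin n} {u u' g g' : RSpace n → ℂ}
    (h : HasWeakPartial Ω j u g) (h' : HasWeakPartial Ω j u' g') (hu : u =ᵐ[volume.restrict Ω] u') :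
    g =ᵐ[volume.restrict Ω] g' := by
  have hloc : LocallyIntegrableOn (fun x => g x - g' x) Ω := h.2.1.sub h'.2.1
  have := hΩ.ae_eq_zero_of_integral_contDiff_smul_eq_zero (μ := volume)
    (f := fun x => g x - g' x) hloc ?_
  · rw [Filter.EventuallyEq, ae_restrict_iff' hΩ.measurableSet]
    filter_upwards [this] with x hx hxΩ
    exact sub_eq_zero.1 (hx hxΩ)
  · intro θ hθ hθc hθs
    have e1 := h.2.2 θ hθ hθc hθs
    have e2 := h'.2.2 θ hθ hθc hθs
    have e3 : ∫ x in Ω, ((classicalPartial j θ x : ℝ) : ℂ) * u x =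
        ∫ x in Ω, ((classicalPartial j θ x : ℝ) : ℂ) * u' x := by
      refine integral_congr_ae ?_
      filter_upwards [hu] with x hx
      rw [hx]
    have hint : ∀ g : RSpace n → ℂ, LocallyIntegrableOn g Ω →
        IntegrableOn (fun x => (θ x : ℂ) * g x) Ω := by
      intro g hg
      have hK : IsCompact (tsupport θ) := hθc
      have h1 : IntegrableOn (fun x => (θ x : ℂ) * g x) (tsupport θ) :=
        (hg.integrableOn_compact_subset hθs hK).continuousOn_mul
          (Complex.continuous_ofReal.comp hθ.continuous).continuousOn hK
      refine ((integrableOn_iff_integrable_of_support_subset ?_).1 h1).integrableOn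
      intro x hx
      refine subset_tsupport θ fun h0 => hx ?_
      simp [h0]
    have hz : ∀ x ∉ Ω, θ x • (g x - g' x) = 0 := by
      intro x hx
      have : θ x = 0 := by
        by_contra hne
        exact hx (hθs (subset_tsupport θ hne))
      simp [this]
    rw [← setIntegral_eq_integral_of_forall_compl_eq_zero hz]
    have : ∀ x, θ x • (g x - g' x) = (θ x : ℂ) * g x - (θ x : ℂ) * g' x := by
      intro x; rw [Complex.real_smul, mul_sub]
    simp_rw [this]
    rw [integral_sub (hint g h.2.1) (hint g' h'.2.1), sub_eq_zero, ← neg_inj, ← e1, ← e2, e3]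

/-- Integration against a fixed `L²` function is continuous in `L²`. -/
theorem tendsto_integral_mul_of_tendsto_eLpNorm {α : Type*} [MeasurableSpace α] {μ : Measure α}
    {b : α → ℂ} (hb : MemLp b 2 μ) {W : ℕ → α → ℂ} (hW : ∀ k, MemLp (W k) 2 μ) {w : α → ℂ}
    (hw : MemLp w 2 μ) (h : Tendsto (fun k => eLpNorm (fun x => W k x - w x) 2 μ) atTop (𝓝 0)) :
    Tendsto (fun k => ∫ x, b x * W k x ∂μ) atTop (𝓝 (∫ x, b x * w x ∂μ)) := by
  have hi : ∀ g : α → ℂ, MemLp g 2 μ → Integrable (fun x => b x * g x) μ := fun g hg =>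
    memLp_one_iff_integrable.1 (hg.mul hb)
  refine tendsto_integral_of_L1' _ (hi w hw).aestronglyMeasurable
    (Eventually.of_forall fun k => hi _ (hW k)) ?_
  have hlim : Tendsto (fun k => eLpNorm b 2 μ * eLpNorm (fun x => W k x - w x) 2 μ) atTop (𝓝 0) := by
    simpa using ENNReal.Tendsto.const_mul h (Or.inr hb.2.ne)
  refine tendsto_of_tendsto_of_tendsto_of_le_of_le tendsto_const_nhds hlim (fun _ => zero_le) ?_
  intro k
  have h1 := eLpNorm_smul_le_mul_eLpNorm (p := 2) (q := 2) (r := 1) (φ := b)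
    (f := fun x => W k x - w x) ((hW k).1.sub hw.1) hb.1
  refine le_trans (le_of_eq ?_) h1
  refine congrArg (fun F => eLpNorm F 1 μ) ?_
  ext x
  simp [mul_sub]

theorem hasWeakPartial_of_contDiff {f : RSpace n → ℂ} (hf : ContDiff ℝ 1 f)
    (j : Fin n) : HasWeakPartial Ω j f (classicalPartial j f) := by
  refine ⟨hf.continuous.locallyIntegrable.locallyIntegrableOn _,
    (continuous_classicalPartial hf j).locallyIntegrable.locallyIntegrableOn _, ?_⟩
  intro θ hθ hθc hθs
  have hθ1 : ContDiff ℝ 1 θ := hθ.of_le (by simp)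
  have hcθ : ContDiff ℝ 1 fun x => (θ x : ℂ) := Complex.ofRealCLM.contDiff.comp hθ1
  have hθc' : HasCompactSupport fun x => (θ x : ℂ) := hθc.comp_left (g := Complex.ofReal) rfl
  have hd : ∀ x, ((classicalPartial j θ x : ℝ) : ℂ) = fderiv ℝ (fun x => (θ x : ℂ)) x
      (EuclideanSpace.single j 1) := by
    intro x
    have h := Complex.ofRealCLM.hasFDerivAt.comp x (hθ1.differentiable (by norm_num) x).hasFDerivAt
    rw [show fderiv ℝ (fun x => (θ x : ℂ)) x = _ from h.fderiv]
    rfl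
  have hz1 : ∀ x ∉ Ω, ((classicalPartial j θ x : ℝ) : ℂ) * f x = 0 := by
    intro x hx
    have : fderiv ℝ θ x = 0 := by
      by_contra hne
      exact hx (hθs (support_fderiv_subset ℝ (Function.mem_support.2 hne)))
    simp [classicalPartial, this]
  have hz2 : ∀ x ∉ Ω, (θ x : ℂ) * classicalPartial j f x = 0 := by
    intro x hx
    have : θ x = 0 := by
      by_contra hne
      exact hx (hθs (subset_tsupport θ hne))
    simp [this]
  rw [setIntegral_eq_integral_of_forall_compl_eq_zero hz1,
    setIntegral_eq_integral_of_forall_compl_eq_zero hz2]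
  have hdc : Continuous fun x => fderiv ℝ (fun x => (θ x : ℂ)) x (EuclideanSpace.single j 1) :=
    (hcθ.continuous_fderiv (by norm_num)).clm_apply continuous_const
  have := integral_mul_fderiv_eq_neg_fderiv_mul_of_integrable (μ := volume)
    (f := fun x => (θ x : ℂ)) (g := f) (v := EuclideanSpace.single j 1) ?_ ?_ ?_
    (fun x _ => hcθ.differentiable (by norm_num) x) (fun x _ => hf.differentiable (by norm_num) x)
  · simp_rw [hd]
    rw [show (∫ x, (θ x : ℂ) * classicalPartial j f x) = _ from this, neg_neg]
  · exact (hdc.mul hf.continuous).integrable_of_hasCompactSupport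
      (((hθc'.fderiv ℝ).comp_left (g := fun L : RSpace n →L[ℝ] ℂ =>
        L (EuclideanSpace.single j 1)) rfl).mul_right)
  · exact (hcθ.continuous.mul (continuous_classicalPartial hf j)).integrable_of_hasCompactSupport
      hθc'.mul_right
  · exact (hcθ.continuous.mul hf.continuous).integrable_of_hasCompactSupport hθc'.mul_right

theorem locallyIntegrableOn_of_memLp (hbd : Bornology.IsBounded Ω) {w : RSpace n → ℂ}
    (hw : MemLp w 2 (volume.restrict Ω)) : LocallyIntegrableOn w Ω := by
  have hfin : IsFiniteMeasure (volume.restrict Ω) :=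
    ⟨by rw [Measure.restrict_apply_univ]; exact hbd.measure_lt_top⟩
  exact IntegrableOn.locallyIntegrableOn (hw.integrable (by norm_num))

/-- Weak derivatives pass to `L²` limits. -/
theorem hasWeakPartial_of_tendsto (hΩ : IsOpen Ω) (hbd : Bornology.IsBounded Ω) {j : Fin n}
    {W : ℕ → RSpace n → ℂ} (hW : ∀ k, ContDiff ℝ 1 (W k)) {w d : RSpace n → ℂ}
    (hw : MemLp w 2 (volume.restrict Ω)) (hd : MemLp d 2 (volume.restrict Ω))
    (hlw : Tendsto (fun k => eLpNorm (fun x => W k x - w x) 2 (volume.restrict Ω)) atTop (𝓝 0))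
    (hld : Tendsto (fun k => eLpNorm (fun x => classicalPartial j (W k) x - d x) 2
      (volume.restrict Ω)) atTop (𝓝 0)) : HasWeakPartial Ω j w d := by
  refine ⟨locallyIntegrableOn_of_memLp hbd hw, locallyIntegrableOn_of_memLp hbd hd, ?_⟩
  intro θ hθ hθc hθs
  have hm : ∀ g : RSpace n → ℂ, Continuous g → MemLp g 2 (volume.restrict Ω) := fun g hg =>
    memLp_restrict_of_continuousOn hΩ hbd hg.continuousOn 2
  have hθ1 : ContDiff ℝ 1 θ := hθ.of_le (by simp)
  have h1 := tendsto_integral_mul_of_tendsto_eLpNorm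
    (hm _ (Complex.continuous_ofReal.comp (continuous_classicalPartial hθ1 j)))
    (fun k => hm _ (hW k).continuous) hw hlw
  have h2 := tendsto_integral_mul_of_tendsto_eLpNorm
    (hm _ (Complex.continuous_ofReal.comp hθ.continuous))
    (fun k => hm _ (continuous_classicalPartial (hW k) j)) hd hld
  have h3 := fun k => (hasWeakPartial_of_contDiff (hW k) j).2.2 θ hθ hθc hθs
  refine tendsto_nhds_unique h1 ?_
  have h4 := h2.neg
  refine h4.congr fun k => ?_
  exact (h3 k).symm

theorem weakPartial_ae_eq (hΩ : IsOpen Ω) {j : Fin n} {u d : RSpace n → ℂ}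
    (h : HasWeakPartial Ω j u d) : weakPartial Ω j u =ᵐ[volume.restrict Ω] d := by
  have hex : ∃ g, HasWeakPartial Ω j u g := ⟨d, h⟩
  rw [weakPartial, dif_pos hex]
  exact hex.choose_spec.ae_eq hΩ h (ae_eq_refl _)

/-- Smooth functions which converge in `H¹(Ω)` converge to the trace in `L²(∂Ω)`. -/
theorem tendsto_trace (hΩ : IsOpen Ω) (hbd : Bornology.IsBounded Ω) (hb : HasC2Boundary Ω)
    {W : ℕ → RSpace n → ℂ} (hW : ∀ k, ContDiff ℝ ∞ (W k)) {w : RSpace n → ℂ}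
    {d : Fin n → RSpace n → ℂ} (hw : MemLp w 2 (volume.restrict Ω))
    (hd : ∀ j, MemLp (d j) 2 (volume.restrict Ω))
    (hlw : Tendsto (fun k => eLpNorm (fun x => W k x - w x) 2 (volume.restrict Ω)) atTop (𝓝 0))
    (hld : ∀ j, Tendsto (fun k => eLpNorm (fun x => classicalPartial j (W k) x - d j x) 2
      (volume.restrict Ω)) atTop (𝓝 0)) :
    MemLp (trace Ω w) 2 (surfaceMeasure Ω) ∧
      Tendsto (fun k => eLpNorm (fun x => W k x - trace Ω w x) 2 (surfaceMeasure Ω)) atTop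
        (𝓝 0) := by
  obtain ⟨C, hC, hCW⟩ := exists_eLpNorm_surfaceMeasure_le hΩ hbd hb
  have hm : ∀ g : RSpace n → ℂ, Continuous g → MemLp g 2 (volume.restrict Ω) := fun g hg =>
    memLp_restrict_of_continuousOn hΩ hbd hg.continuousOn 2
  have hmS : ∀ g : RSpace n → ℂ, Continuous g → MemLp g 2 (surfaceMeasure Ω) := fun g hg =>
    memLp_surfaceMeasure hΩ hbd hb hg.continuousOn 2
  -- Up to the trace constant, `N f` is the distance of `f` to `w` in `H¹(Ω)`.
  set N : (RSpace n → ℂ) → ℝ≥0∞ := fun f => C * (eLpNorm (fun x => f x - w x) 2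
    (volume.restrict Ω) + ∑ j, eLpNorm (fun x => classicalPartial j f x - d j x) 2
    (volume.restrict Ω)) with hN
  have htri : ∀ f g : RSpace n → ℂ, MemLp f 2 (volume.restrict Ω) → MemLp g 2 (volume.restrict Ω) →
      ∀ w : RSpace n → ℂ, MemLp w 2 (volume.restrict Ω) →
      eLpNorm (fun x => f x - g x) 2 (volume.restrict Ω) ≤
        eLpNorm (fun x => f x - w x) 2 (volume.restrict Ω) +
          eLpNorm (fun x => g x - w x) 2 (volume.restrict Ω) := by
    intro f g hf hg w hw
    have := eLpNorm_sub_le (hf.sub hw).1 (hg.sub hw).1 (p := 2) (by norm_num)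
    rw [sub_sub_sub_cancel_right] at this
    exact this
  have hdiff : ∀ f g : RSpace n → ℂ, ContDiff ℝ ∞ f → ContDiff ℝ ∞ g →
      eLpNorm (fun x => f x - g x) 2 (surfaceMeasure Ω) ≤ N f + N g := by
    intro f g hf hg
    have hf1 : ContDiff ℝ 1 f := hf.of_le (by simp)
    have hg1 : ContDiff ℝ 1 g := hg.of_le (by simp)
    refine (hCW _ (hf1.sub hg1)).trans ?_
    rw [hN, ← mul_add]
    gcongr C * ?_
    calc _ ≤ (eLpNorm (fun x => f x - w x) 2 (volume.restrict Ω) +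
          eLpNorm (fun x => g x - w x) 2 (volume.restrict Ω)) +
          ∑ j, (eLpNorm (fun x => classicalPartial j f x - d j x) 2 (volume.restrict Ω) +
            eLpNorm (fun x => classicalPartial j g x - d j x) 2 (volume.restrict Ω)) := by
          gcongr with j
          · exact htri f g (hm f hf.continuous) (hm g hg.continuous) w hw
          · have := htri _ _ (hm _ (continuous_classicalPartial hf1 j))
              (hm _ (continuous_classicalPartial hg1 j)) _ (hd j)
            refine le_trans (le_of_eq ?_) this
            congr 1
            ext x
            exact classicalPartial_sub hf1 hg1 j x
      _ = _ := by rw [Finset.sum_add_distrib]; exact add_add_add_comm _ _ _ _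
  have hNlim : ∀ W : ℕ → RSpace n → ℂ,
      Tendsto (fun k => eLpNorm (fun x => W k x - w x) 2 (volume.restrict Ω)) atTop (𝓝 0) →
      (∀ j, Tendsto (fun k => eLpNorm (fun x => classicalPartial j (W k) x - d j x) 2
        (volume.restrict Ω)) atTop (𝓝 0)) → Tendsto (fun k => N (W k)) atTop (𝓝 0) := by
    intro W h1 h2
    have := ENNReal.Tendsto.const_mul (a := C)
      (h1.add (tendsto_finsetSum Finset.univ fun j _ => h2 j)) (Or.inr hC)
    simpa using this
  have hNW := hNlim W hlw hld
  have hex : ∃ g, IsTrace Ω w g := by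
    have hcau : CauchySeq fun k => (hmS (W k) (hW k).continuous).toLp (W k) := by
      rw [EMetric.cauchySeq_iff]
      intro ε hε
      have hev := hNW.eventually (gt_mem_nhds (ENNReal.half_pos hε.ne'))
      obtain ⟨K, hK⟩ := eventually_atTop.1 hev
      refine ⟨K, fun k hk l hl => ?_⟩
      rw [Lp.edist_toLp_toLp]
      refine lt_of_le_of_lt (hdiff _ _ (hW k) (hW l)) ?_
      rw [← ENNReal.add_halves ε]
      exact ENNReal.add_lt_add (hK k hk) (hK l hl)
    obtain ⟨g, hg⟩ := cauchySeq_tendsto_of_complete hcau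
    refine ⟨g, hw, Lp.memLp g, W, hW, hlw, fun j => ⟨d j, ?_, hd j, hld j⟩, ?_⟩
    · exact hasWeakPartial_of_tendsto hΩ hbd (fun k => (hW k).of_le (by simp)) hw (hd j) hlw (hld j)
    · have := (Lp.tendsto_Lp_iff_tendsto_eLpNorm' _ _).1 hg
      refine this.congr fun k => eLpNorm_congr_ae ?_
      filter_upwards [(hmS (W k) (hW k).continuous).coeFn_toLp] with x hx
      simp [hx]
  -- The chosen trace comes with its own approximating sequence; by uniqueness of weak derivatives it
  -- also converges to `w` with respect to `N`, so both sequences have the same boundary limit.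
  have htr : IsTrace Ω w (trace Ω w) := by
    rw [trace, dif_pos hex]; exact hex.choose_spec
  obtain ⟨-, hg, W', hW', hlw', hld', hlg⟩ := htr
  refine ⟨hg, ?_⟩
  have hld'' : ∀ j, Tendsto (fun k => eLpNorm (fun x => classicalPartial j (W' k) x - d j x) 2
      (volume.restrict Ω)) atTop (𝓝 0) := by
    intro j
    obtain ⟨d', hd', hd'm, hl⟩ := hld' j
    have hae := hd'.ae_eq hΩ (hasWeakPartial_of_tendsto hΩ hbd
      (fun k => (hW k).of_le (by simp)) hw (hd j) hlw (hld j)) (ae_eq_refl _)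
    refine hl.congr fun k => eLpNorm_congr_ae ?_
    filter_upwards [hae] with x hx
    rw [hx]
  have hNW' := hNlim W' hlw' hld''
  have hsum := (hNW.add hNW').add hlg
  simp only [add_zero] at hsum
  refine tendsto_of_tendsto_of_tendsto_of_le_of_le tendsto_const_nhds hsum (fun _ => zero_le) ?_
  intro k
  have h1 := eLpNorm_add_le ((hmS _ (hW k).continuous).1.sub (hmS _ (hW' k).continuous).1)
    ((hmS _ (hW' k).continuous).1.sub hg.1) (p := 2) (by norm_num)
  have h2 : eLpNorm (fun x => W k x - trace Ω w x) 2 (surfaceMeasure Ω) =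
      eLpNorm ((W k - W' k) + (W' k - trace Ω w)) 2 (surfaceMeasure Ω) := by
    congr 1; ext x; simp
  beta_reduce
  rw [h2]
  refine h1.trans ?_
  gcongr
  · exact hdiff _ _ (hW k) (hW' k)
  · exact le_of_eq rfl

end Trace

/-! ### Approximation of `H²` functions by Schwartz functions -/

section Sobolev

open scoped SchwartzMap LineDeriv FourierTransform

variable {n : ℕ} {Ω : Set (RSpace n)}

/-- A Fourier multiplier with bounded symbol is bounded on `L²`, by Plancherel's theorem. -/
theorem norm_toLp_fourierMultiplierCLM_le {σ : RSpace n → ℝ} (hσ : σ.HasTemperateGrowth) {C : ℝ}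
    (hC : ∀ x, |σ x| ≤ C) (f : 𝓢(RSpace n, ℂ)) :
    ‖(SchwartzMap.fourierMultiplierCLM ℂ σ f).toLp 2 volume‖ ≤ C * ‖f.toLp 2 volume‖ := by
  have h1 : ∀ f : 𝓢(RSpace n, ℂ), ‖(𝓕 f).toLp 2 volume‖ = ‖f.toLp 2 volume‖ := fun f => by
    rw [← SchwartzMap.toLp_fourier_eq, Lp.norm_fourier_eq]
  have h2 : ∀ f : 𝓢(RSpace n, ℂ), ‖(𝓕⁻ f).toLp 2 volume‖ = ‖f.toLp 2 volume‖ := fun f => by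
    rw [← h1 (𝓕⁻ f), FourierTransform.fourier_fourierInv_eq]
  rw [SchwartzMap.fourierMultiplierCLM_apply, h2, ← h1 f]
  refine Lp.norm_le_mul_norm_of_ae_le_mul ?_
  filter_upwards [SchwartzMap.coeFn_toLp (SchwartzMap.smulLeftCLM ℂ σ (𝓕 f)) 2,
    SchwartzMap.coeFn_toLp (𝓕 f) 2] with x hx hx'
  rw [hx, hx', SchwartzMap.smulLeftCLM_apply_apply hσ, norm_smul]
  exact mul_le_mul_of_nonneg_right (hC x) (norm_nonneg _)

/-- An operator on Schwartz functions which is bounded in `L²` maps `L²`-convergent sequences to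
`L²`-convergent ones. -/
theorem exists_tendsto_toLp {T : 𝓢(RSpace n, ℂ) →ₗ[ℝ] 𝓢(RSpace n, ℂ)} {C : ℝ}
    (hT : ∀ f, ‖(T f).toLp 2 volume‖ ≤ C * ‖f.toLp 2 volume‖) {g : ℕ → 𝓢(RSpace n, ℂ)}
    {G : Lp ℂ 2 (volume : Measure (RSpace n))}
    (hg : Tendsto (fun k => (g k).toLp 2 volume) atTop (𝓝 G)) :
    ∃ D : Lp ℂ 2 (volume : Measure (RSpace n)),
      Tendsto (fun k => (T (g k)).toLp 2 volume) atTop (𝓝 D) := by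
  have hsub : ∀ a b : 𝓢(RSpace n, ℂ),
      (a - b).toLp 2 volume = a.toLp 2 volume - b.toLp 2 volume := fun a b =>
    map_sub (SchwartzMap.toLpCLM ℝ ℂ 2 volume) a b
  refine cauchySeq_tendsto_of_complete ?_
  rw [Metric.cauchySeq_iff]
  intro ε hε
  obtain ⟨K, hK⟩ := Metric.cauchySeq_iff.1 hg.cauchySeq (ε / (|C| + 1)) (by positivity)
  refine ⟨K, fun k hk l hl => ?_⟩
  have h1 := hK k hk l hl
  rw [dist_eq_norm, ← hsub] at h1 ⊢
  rw [← map_sub]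
  have h2 := hT (g k - g l)
  rw [lt_div_iff₀ (by positivity)] at h1
  nlinarith [le_abs_self C, norm_nonneg ((g k - g l).toLp 2 volume)]

/-- The symbol `⟨x⟩⁻²`. -/
def japaneseInv (x : RSpace n) : ℝ := (1 + ‖x‖ ^ 2) ^ ((-2 : ℝ) / 2)

theorem japaneseInv_eq (x : RSpace n) : japaneseInv x = (1 + ‖x‖ ^ 2)⁻¹ := by
  rw [japaneseInv, show (-2 : ℝ) / 2 = -1 by norm_num, Real.rpow_neg_one]

theorem hasTemperateGrowth_japaneseInv :
    (japaneseInv : RSpace n → ℝ).HasTemperateGrowth := by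
  unfold japaneseInv; fun_prop

theorem lineDerivOp_fourierMultiplierCLM {σ : RSpace n → ℝ} (hσ : σ.HasTemperateGrowth)
    (m : RSpace n) (f : 𝓢(RSpace n, ℂ)) :
    ∂_{m} (SchwartzMap.fourierMultiplierCLM ℂ σ f) = (2 * Real.pi * Complex.I) •
      SchwartzMap.fourierMultiplierCLM ℂ (fun x => inner ℝ x m * σ x) f := by
  rw [SchwartzMap.lineDeriv_eq_fourierMultiplierCLM,
    SchwartzMap.fourierMultiplierCLM_fourierMultiplierCLM_apply (by fun_prop) hσ]
  rfl

theorem norm_toLp_smul (c : ℂ) (f : 𝓢(RSpace n, ℂ)) :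
    ‖(c • f).toLp 2 volume‖ = ‖c‖ * ‖f.toLp 2 volume‖ := by
  have : (c • f).toLp 2 volume = c • f.toLp 2 volume :=
    map_smul (SchwartzMap.toLpCLM ℂ ℂ 2 volume) c f
  rw [this, norm_smul]

theorem lineDerivOp_smul' (c : ℂ) (m : RSpace n) (f : 𝓢(RSpace n, ℂ)) :
    ∂_{m} (c • f) = c • ∂_{m} f := LineDeriv.lineDerivOp_smul ..

/-- An element of the Bessel potential space `H²(ℝⁿ)` is the limit of Schwartz functions in the
sense that all derivatives of order at most two converge in `L²`. -/
theorem exists_schwartz_tendsto {U : Lp ℂ 2 (volume : Measure (RSpace n))}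
    (hU : TemperedDistribution.MemSobolev 2 2 (U : TemperedDistribution (RSpace n) ℂ)) :
    ∃ f : ℕ → 𝓢(RSpace n, ℂ), Tendsto (fun k => (f k).toLp 2 volume) atTop (𝓝 U) ∧
      (∀ m : RSpace n, ∃ D : Lp ℂ 2 (volume : Measure (RSpace n)),
        Tendsto (fun k => (∂_{m} (f k)).toLp 2 volume) atTop (𝓝 D)) ∧
      ∀ m m' : RSpace n, ∃ D : Lp ℂ 2 (volume : Measure (RSpace n)),
        Tendsto (fun k => (∂_{m} (∂_{m'} (f k))).toLp 2 volume) atTop (𝓝 D) := by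
  -- `U = ⟨D⟩⁻² G` with `G ∈ L²`; apply `⟨D⟩⁻²` to Schwartz functions which approximate `G`. The
  -- symbols `⟨x⟩⁻²`, `x_m ⟨x⟩⁻²` and `x_m x_m' ⟨x⟩⁻²` are bounded.
  obtain ⟨G, hG⟩ := hU
  have hdense := SchwartzMap.denseRange_toLpCLM (E := RSpace n) (F := ℂ) (p := 2)
    (μ := volume) ENNReal.ofNat_ne_top
  obtain ⟨s, hs, hsG⟩ := mem_closure_iff_seq_limit.1 (hdense G)
  choose g hg using hs
  have hgG : Tendsto (fun k => (g k).toLp 2 volume) atTop (𝓝 G) := by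
    refine hsG.congr fun k => ?_
    rw [← hg k]; rfl
  have hJ := hasTemperateGrowth_japaneseInv (n := n)
  have hpos : ∀ x : RSpace n, 0 < 1 + ‖x‖ ^ 2 := fun x => by positivity
  have hJ0 : ∀ x : RSpace n, 0 ≤ japaneseInv x := fun x => by
    rw [japaneseInv_eq]; exact (inv_pos.2 (hpos x)).le
  have hin : ∀ x m : RSpace n, |inner ℝ x m| ≤ ‖x‖ * ‖m‖ := fun x m => abs_real_inner_le_norm x m
  set T := SchwartzMap.fourierMultiplierCLM ℂ (japaneseInv : RSpace n → ℝ) with hT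
  have hb0 : ∀ f : 𝓢(RSpace n, ℂ), ‖(T f).toLp 2 volume‖ ≤ 1 * ‖f.toLp 2 volume‖ := fun f =>
    norm_toLp_fourierMultiplierCLM_le hJ (fun x => by
      rw [abs_of_nonneg (hJ0 x), japaneseInv_eq]
      exact inv_le_one_of_one_le₀ (by nlinarith [sq_nonneg ‖x‖])) f
  have hb1 : ∀ (m : RSpace n) (f : 𝓢(RSpace n, ℂ)), ‖(∂_{m} (T f)).toLp 2 volume‖ ≤
      (‖(2 * Real.pi * Complex.I : ℂ)‖ * ‖m‖) * ‖f.toLp 2 volume‖ := by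
    intro m f
    rw [hT, lineDerivOp_fourierMultiplierCLM hJ, norm_toLp_smul,
      mul_assoc ‖(2 * Real.pi * Complex.I : ℂ)‖]
    gcongr
    refine norm_toLp_fourierMultiplierCLM_le
      (σ := fun x => inner ℝ x m * japaneseInv x) (by fun_prop) (fun x => ?_) f
    rw [abs_mul, abs_of_nonneg (hJ0 x), japaneseInv_eq, ← div_eq_mul_inv, div_le_iff₀ (hpos x)]
    refine (hin x m).trans ?_
    nlinarith [sq_nonneg (‖x‖ - 1), norm_nonneg m, norm_nonneg x,
      mul_nonneg (norm_nonneg m) (sq_nonneg (‖x‖ - 1)),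
      mul_nonneg (norm_nonneg m) (sq_nonneg ‖x‖)]
  have hb2 : ∀ (m m' : RSpace n) (f : 𝓢(RSpace n, ℂ)), ‖(∂_{m} (∂_{m'} (T f))).toLp 2 volume‖ ≤
      (‖(2 * Real.pi * Complex.I : ℂ)‖ * (‖(2 * Real.pi * Complex.I : ℂ)‖ * (‖m‖ * ‖m'‖))) *
        ‖f.toLp 2 volume‖ := by
    intro m m' f
    rw [hT, lineDerivOp_fourierMultiplierCLM hJ, lineDerivOp_smul',
      lineDerivOp_fourierMultiplierCLM (by fun_prop), norm_toLp_smul, norm_toLp_smul,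
      mul_assoc ‖(2 * Real.pi * Complex.I : ℂ)‖, mul_assoc ‖(2 * Real.pi * Complex.I : ℂ)‖]
    gcongr
    refine norm_toLp_fourierMultiplierCLM_le
      (σ := fun x => inner ℝ x m * (inner ℝ x m' * japaneseInv x)) (by fun_prop) (fun x => ?_) f
    rw [abs_mul, abs_mul, abs_of_nonneg (hJ0 x), japaneseInv_eq, ← mul_assoc, ← div_eq_mul_inv,
      div_le_iff₀ (hpos x)]
    calc |inner ℝ x m| * |inner ℝ x m'| ≤ (‖x‖ * ‖m‖) * (‖x‖ * ‖m'‖) :=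
          mul_le_mul (hin x m) (hin x m') (abs_nonneg _) (by positivity)
      _ = ‖m‖ * ‖m'‖ * ‖x‖ ^ 2 := by ring
      _ ≤ _ := by
        gcongr
        linarith
  refine ⟨fun k => T (g k), ?_, fun m => ?_, fun m m' => ?_⟩
  · obtain ⟨U', hU'⟩ := exists_tendsto_toLp (T := T.toLinearMap) hb0 hgG
    have hc := (Lp.toTemperedDistributionCLM ℂ (volume : Measure (RSpace n)) 2).continuous
    have l1 := (hc.tendsto U').comp hU'
    have l2 := ((TemperedDistribution.besselPotential (RSpace n) ℂ (-2)).continuous.tendsto _).comp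
      ((hc.tendsto G).comp hgG)
    have heq : ∀ k, TemperedDistribution.besselPotential (RSpace n) ℂ (-2)
        (Lp.toTemperedDistributionCLM ℂ (volume : Measure (RSpace n)) 2 ((g k).toLp 2 volume)) =
        Lp.toTemperedDistributionCLM ℂ (volume : Measure (RSpace n)) 2
          ((T (g k)).toLp 2 volume) := by
      intro k
      rw [Lp.toTemperedDistributionCLM_apply, Lp.toTemperedDistributionCLM_apply,
        Lp.toTemperedDistribution_toLp_eq, Lp.toTemperedDistribution_toLp_eq,
        TemperedDistribution.besselPotential,
        TemperedDistribution.fourierMultiplierCLM_toTemperedDistributionCLM_eq (by fun_prop)]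
      congr 1
      exact SchwartzMap.fourierMultiplierCLM_ofReal ℂ hJ (g k)
    have l3 := l2.congr heq
    have hlim := tendsto_nhds_unique l1 l3
    have hGU : TemperedDistribution.besselPotential (RSpace n) ℂ (-2)
        (Lp.toTemperedDistributionCLM ℂ (volume : Measure (RSpace n)) 2 G) =
        Lp.toTemperedDistributionCLM ℂ (volume : Measure (RSpace n)) 2 U := by
      rw [TemperedDistribution.besselPotential_neg_apply_eq_iff]
      exact hG
    rw [hGU] at hlim
    have hinj := LinearMap.ker_eq_bot.1 (Lp.ker_toTemperedDistributionCLM_eq_bot (F := ℂ)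
      (μ := (volume : Measure (RSpace n))) (p := 2))
    rw [← hinj hlim]
    exact hU'
  · exact exists_tendsto_toLp (T := (LineDeriv.lineDerivOpCLM ℝ 𝓢(RSpace n, ℂ) m ∘L T).toLinearMap)
      (hb1 m) hgG
  · exact exists_tendsto_toLp (T := (LineDeriv.lineDerivOpCLM ℝ 𝓢(RSpace n, ℂ) m ∘L
      LineDeriv.lineDerivOpCLM ℝ 𝓢(RSpace n, ℂ) m' ∘L T).toLinearMap) (hb2 m m') hgG

theorem tendsto_eLpNorm_restrict {f : ℕ → 𝓢(RSpace n, ℂ)}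
    {D : Lp ℂ 2 (volume : Measure (RSpace n))}
    (h : Tendsto (fun k => (f k).toLp 2 volume) atTop (𝓝 D)) {d : RSpace n → ℂ}
    (hd : d =ᵐ[volume.restrict Ω] D) :
    Tendsto (fun k => eLpNorm (fun x => f k x - d x) 2 (volume.restrict Ω)) atTop (𝓝 0) := by
  have h1 := (Lp.tendsto_Lp_iff_tendsto_eLpNorm' _ _).1 h
  refine tendsto_of_tendsto_of_tendsto_of_le_of_le tendsto_const_nhds h1 (fun _ => zero_le) ?_
  intro k
  have h2 : eLpNorm (fun x => f k x - d x) 2 (volume.restrict Ω) =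
      eLpNorm ((f k).toLp 2 volume - D : RSpace n → ℂ) 2 (volume.restrict Ω) := by
    refine eLpNorm_congr_ae ?_
    filter_upwards [hd, ae_restrict_of_ae ((f k).coeFn_toLp 2 volume)] with x hx hx'
    simp [hx, hx']
  beta_reduce
  rw [h2]
  exact eLpNorm_mono_measure _ Measure.restrict_le_self

theorem memLp_restrict_of_ae_eq {D : Lp ℂ 2 (volume : Measure (RSpace n))} {d : RSpace n → ℂ}
    (hd : d =ᵐ[volume.restrict Ω] D) : MemLp d 2 (volume.restrict Ω) :=
  (memLp_congr_ae hd).2 ((Lp.memLp D).restrict Ω)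

theorem classicalPartial_schwartz (f : 𝓢(RSpace n, ℂ)) (j : Fin n) :
    classicalPartial j f = (∂_{(EuclideanSpace.single j (1 : ℝ) : RSpace n)} f :
      𝓢(RSpace n, ℂ)) := by
  ext x
  rw [SchwartzMap.lineDerivOp_apply_eq_fderiv, classicalPartial]

/-- A sequence of smooth functions approximating `u ∈ H²(Ω)`, in `H²(Ω)` and on the boundary. -/
structure IsH2Approx (Ω : Set (RSpace n)) (u : RSpace n → ℂ) (W : ℕ → RSpace n → ℂ) : Prop where
  contDiff : ∀ k, ContDiff ℝ ∞ (W k)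
  memLp : MemLp u 2 (volume.restrict Ω)
  memLp_partial : ∀ j, MemLp (weakPartial Ω j u) 2 (volume.restrict Ω)
  memLp_partial₂ : ∀ i j, MemLp (weakPartial Ω i (weakPartial Ω j u)) 2 (volume.restrict Ω)
  tendsto : Tendsto (fun k => eLpNorm (fun x => W k x - u x) 2 (volume.restrict Ω)) atTop (𝓝 0)
  tendsto_partial : ∀ j, Tendsto (fun k => eLpNorm (fun x => classicalPartial j (W k) x -
    weakPartial Ω j u x) 2 (volume.restrict Ω)) atTop (𝓝 0)
  tendsto_partial₂ : ∀ i j, Tendsto (fun k => eLpNorm (fun x =>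
    classicalPartial i (classicalPartial j (W k)) x - weakPartial Ω i (weakPartial Ω j u) x) 2
      (volume.restrict Ω)) atTop (𝓝 0)
  memLp_trace : MemLp (trace Ω u) 2 (surfaceMeasure Ω)
  memLp_trace_partial : ∀ j, MemLp (trace Ω (weakPartial Ω j u)) 2 (surfaceMeasure Ω)
  tendsto_trace : Tendsto (fun k => eLpNorm (fun x => W k x - trace Ω u x) 2 (surfaceMeasure Ω))
    atTop (𝓝 0)
  tendsto_trace_partial : ∀ j, Tendsto (fun k => eLpNorm (fun x => classicalPartial j (W k) x -
    trace Ω (weakPartial Ω j u) x) 2 (surfaceMeasure Ω)) atTop (𝓝 0)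

/-- Smooth functions are dense in `H²(Ω)`, with convergence of the boundary values. The convergence
of second derivatives is used twice: for the Laplacian, and for the traces of `∂_j u`. -/
theorem MemH2.exists_isH2Approx (hΩ : IsOpen Ω) (hbd : Bornology.IsBounded Ω)
    (hb : HasC2Boundary Ω) {u : RSpace n → ℂ} (hu : MemH2 Ω u) : ∃ W, IsH2Approx Ω u W := by
  obtain ⟨U, hU, huU⟩ := hu
  obtain ⟨f, hf, hf1, hf2⟩ := exists_schwartz_tendsto hU
  choose D hD using fun j : Fin n => hf1 (EuclideanSpace.single j 1)
  choose DD hDD using fun i j : Fin n => hf2 (EuclideanSpace.single i 1) (EuclideanSpace.single j 1)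
  have hfs : ∀ k, ContDiff ℝ ∞ (f k) := fun k => (f k).smooth ⊤
  have hc1 : ∀ k j, classicalPartial j (f k) =
      (∂_{(EuclideanSpace.single j (1 : ℝ) : RSpace n)} (f k) : 𝓢(RSpace n, ℂ)) :=
    fun k j => classicalPartial_schwartz (f k) j
  have hu2 := memLp_restrict_of_ae_eq huU
  have t0 := tendsto_eLpNorm_restrict (Ω := Ω) hf huU
  have hw1 : ∀ j, weakPartial Ω j u =ᵐ[volume.restrict Ω] D j := fun j => by
    refine weakPartial_ae_eq hΩ (hasWeakPartial_of_tendsto hΩ hbd (W := fun k => f k)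
      (fun k => (hfs k).of_le (by simp)) hu2 (memLp_restrict_of_ae_eq (ae_eq_refl _)) t0 ?_)
    simp_rw [hc1]
    exact tendsto_eLpNorm_restrict (hD j) (ae_eq_refl _)
  have t1 : ∀ j, Tendsto (fun k => eLpNorm (fun x => classicalPartial j (f k) x -
      weakPartial Ω j u x) 2 (volume.restrict Ω)) atTop (𝓝 0) := fun j => by
    simp_rw [hc1]
    exact tendsto_eLpNorm_restrict (hD j) (hw1 j)
  have hp1 : ∀ j, MemLp (weakPartial Ω j u) 2 (volume.restrict Ω) := fun j =>
    memLp_restrict_of_ae_eq (hw1 j)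
  have hw2 : ∀ i j, weakPartial Ω i (weakPartial Ω j u) =ᵐ[volume.restrict Ω] DD i j := by
    intro i j
    refine weakPartial_ae_eq hΩ (hasWeakPartial_of_tendsto hΩ hbd
      (W := fun k => classicalPartial j (f k))
      (fun k => (contDiff_classicalPartial (hfs k) j).of_le (by simp)) (hp1 j)
      (memLp_restrict_of_ae_eq (ae_eq_refl _)) (t1 j) ?_)
    simp_rw [hc1, classicalPartial_schwartz]
    exact tendsto_eLpNorm_restrict (hDD i j) (ae_eq_refl _)
  have t2 : ∀ i j, Tendsto (fun k => eLpNorm (fun x =>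
      classicalPartial i (classicalPartial j (f k)) x - weakPartial Ω i (weakPartial Ω j u) x) 2
      (volume.restrict Ω)) atTop (𝓝 0) := by
    intro i j
    simp_rw [hc1, classicalPartial_schwartz]
    exact tendsto_eLpNorm_restrict (hDD i j) (hw2 i j)
  have hp2 : ∀ i j, MemLp (weakPartial Ω i (weakPartial Ω j u)) 2 (volume.restrict Ω) :=
    fun i j => memLp_restrict_of_ae_eq (hw2 i j)
  have tr0 := Carleman.tendsto_trace hΩ hbd hb hfs hu2 hp1 t0 t1
  have tr1 := fun j => Carleman.tendsto_trace hΩ hbd hb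
    (W := fun k => classicalPartial j (f k))
    (fun k => contDiff_classicalPartial (hfs k) j) (hp1 j) (fun i => hp2 i j) (t1 j)
    (fun i => t2 i j)
  exact ⟨fun k => f k, hfs, hu2, hp1, hp2, t0, t1, t2, tr0.1, fun j => (tr1 j).1, tr0.2,
    fun j => (tr1 j).2⟩

end Sobolev

/-! ### The divergence identity behind the Carleman estimate -/

section Calculus

variable {n : ℕ}

/-- The Laplacian of a real function, in terms of classical partial derivatives. -/
def lap (f : RSpace n → ℝ) (x : RSpace n) : ℝ := ∑ j, classicalPartial j (classicalPartial j f) x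

/-- The dot product `∇f · ∇g`. -/
def gradDot (f g : RSpace n → ℝ) (x : RSpace n) : ℝ :=
  ∑ j, classicalPartial j f x * classicalPartial j g x

/-- The Hessian form `f''(∇g, ∇k)`. -/
def hessForm (f g k : RSpace n → ℝ) (x : RSpace n) : ℝ :=
  ∑ i, ∑ j, classicalPartial i (classicalPartial j f) x *
    (classicalPartial i g x * classicalPartial j k x)

@[fun_prop]
theorem contDiff_pd {f : RSpace n → ℝ} (hf : ContDiff ℝ ∞ f) (j : Fin n) :
    ContDiff ℝ ∞ (fun x => classicalPartial j f x) := contDiff_classicalPartial hf j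

@[fun_prop]
theorem contDiff_lap {f : RSpace n → ℝ} (hf : ContDiff ℝ ∞ f) :
    ContDiff ℝ ∞ (fun x => lap f x) := by
  unfold lap
  exact ContDiff.sum fun j _ => contDiff_pd (contDiff_pd hf j) j

@[fun_prop]
theorem contDiff_gradDot {f g : RSpace n → ℝ} (hf : ContDiff ℝ ∞ f) (hg : ContDiff ℝ ∞ g) :
    ContDiff ℝ ∞ (fun x => gradDot f g x) := by
  unfold gradDot
  exact ContDiff.sum fun j _ => (contDiff_pd hf j).mul (contDiff_pd hg j)

@[fun_prop]
theorem contDiff_hessForm {f g k : RSpace n → ℝ} (hf : ContDiff ℝ ∞ f) (hg : ContDiff ℝ ∞ g)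
    (hk : ContDiff ℝ ∞ k) : ContDiff ℝ ∞ (fun x => hessForm f g k x) := by
  unfold hessForm
  exact ContDiff.sum fun i _ => ContDiff.sum fun j _ =>
    (contDiff_pd (contDiff_pd hf j) i).mul ((contDiff_pd hg i).mul (contDiff_pd hk j))

variable {f g : RSpace n → ℝ} (hf : ContDiff ℝ ∞ f) (hg : ContDiff ℝ ∞ g) (j : Fin n)
  (x : RSpace n)

include hf in
theorem differentiableAt_of_smooth : DifferentiableAt ℝ f x :=
  hf.differentiable (by simp) x

include hf hg

theorem pd_mul : classicalPartial j (fun y => f y * g y) x =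
    f x * classicalPartial j g x + classicalPartial j f x * g x := by
  have := (differentiableAt_of_smooth hf x).hasFDerivAt.mul
    (differentiableAt_of_smooth hg x).hasFDerivAt
  rw [classicalPartial, show fderiv ℝ (fun y => f y * g y) x = _ from this.fderiv]
  simp [classicalPartial, mul_comm]

theorem pd_add : classicalPartial j (fun y => f y + g y) x =
    classicalPartial j f x + classicalPartial j g x := by
  have := (differentiableAt_of_smooth hf x).hasFDerivAt.add
    (differentiableAt_of_smooth hg x).hasFDerivAt
  rw [classicalPartial, show fderiv ℝ (fun y => f y + g y) x = _ from this.fderiv]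
  rfl

theorem pd_sub : classicalPartial j (fun y => f y - g y) x =
    classicalPartial j f x - classicalPartial j g x := by
  have := (differentiableAt_of_smooth hf x).hasFDerivAt.sub
    (differentiableAt_of_smooth hg x).hasFDerivAt
  rw [classicalPartial, show fderiv ℝ (fun y => f y - g y) x = _ from this.fderiv]
  rfl

omit hg in
theorem pd_const_mul (c : ℝ) : classicalPartial j (fun y => c * f y) x =
    c * classicalPartial j f x := by
  have := (differentiableAt_of_smooth hf x).hasFDerivAt.const_mul c
  rw [classicalPartial, show fderiv ℝ (fun y => c * f y) x = _ from this.fderiv]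
  rfl

omit hf hg in
theorem pd_sum {k : Fin n → RSpace n → ℝ} (hk : ∀ i, ContDiff ℝ ∞ (k i)) :
    classicalPartial j (fun y => ∑ i, k i y) x = ∑ i, classicalPartial j (k i) x := by
  have := HasFDerivAt.fun_sum (u := Finset.univ)
    fun i _ => (differentiableAt_of_smooth (hk i) x).hasFDerivAt
  rw [classicalPartial, show fderiv ℝ (fun y => ∑ i, k i y) x = _ from this.fderiv]
  simp [classicalPartial]

omit hg in
/-- Symmetry of second derivatives. -/
theorem pd_comm (i : Fin n) : classicalPartial i (classicalPartial j f) x =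
    classicalPartial j (classicalPartial i f) x := by
  have hd : DifferentiableAt ℝ (fderiv ℝ f) x :=
    (hf.fderiv_right (m := ∞) (by norm_num)).differentiable (by simp) x
  have h : ∀ a b : Fin n, classicalPartial a (classicalPartial b f) x =
      fderiv ℝ (fderiv ℝ f) x (EuclideanSpace.single a 1) (EuclideanSpace.single b 1) := by
    intro a b
    have := hd.hasFDerivAt.clm_apply (hasFDerivAt_const (EuclideanSpace.single b (1 : ℝ)) x)
    rw [classicalPartial, show fderiv ℝ (classicalPartial b f) x = _ from this.fderiv]
    simp
  rw [h, h]
  exact hf.contDiffAt.isSymmSndFDerivAt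
    (by simpa using WithTop.coe_le_coe.2 (le_top : (2 : ℕ∞) ≤ ⊤)) _ _

theorem pd_gradDot : classicalPartial j (gradDot f g) x = ∑ i,
    (classicalPartial i f x * classicalPartial j (classicalPartial i g) x +
      classicalPartial j (classicalPartial i f) x * classicalPartial i g x) := by
  rw [show gradDot f g = fun y => ∑ i, classicalPartial i f y * classicalPartial i g y from rfl,
    pd_sum j x fun i => (contDiff_pd hf i).mul (contDiff_pd hg i)]
  exact Finset.sum_congr rfl fun i _ => pd_mul (contDiff_pd hf i) (contDiff_pd hg i) j x

omit hf hg

/-- The vector field whose divergence is the boundary part of the Carleman identity for the weight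
`ψ`; the terms with `g` come from multiplying the equation by `g v`. -/
def carlemanField (h : ℝ) (ψ g v : RSpace n → ℝ) (i : Fin n) (x : RSpace n) : ℝ :=
  4 * h ^ 3 * (classicalPartial i v x * gradDot ψ v x)
    - 2 * h ^ 3 * (classicalPartial i ψ x * gradDot v v x)
    + 2 * h ^ 3 * (lap ψ x * (v x * classicalPartial i v x))
    - h ^ 3 * (v x * v x * classicalPartial i (lap ψ) x)
    + 2 * h * (gradDot ψ ψ x * (classicalPartial i ψ x * (v x * v x)))
    + h ^ 2 * (g x * (v x * classicalPartial i v x))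
    - h ^ 2 / 2 * (v x * v x * classicalPartial i g x)

theorem contDiff_carlemanField {h : ℝ} {ψ g v : RSpace n → ℝ} (hψ : ContDiff ℝ ∞ ψ)
    (hg : ContDiff ℝ ∞ g) (hv : ContDiff ℝ ∞ v) (i : Fin n) :
    ContDiff ℝ ∞ (carlemanField h ψ g v i) := by
  have h1 := contDiff_lap hψ
  have h2 := contDiff_pd h1 i
  unfold carlemanField
  fun_prop

/-- The product rule for each component of `carlemanField`. -/
theorem pd_carlemanField {h : ℝ} {ψ g v : RSpace n → ℝ} (hψ : ContDiff ℝ ∞ ψ)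
    (hg : ContDiff ℝ ∞ g) (hv : ContDiff ℝ ∞ v) (i : Fin n) (x : RSpace n) :
    classicalPartial i (carlemanField h ψ g v i) x =
      4 * h ^ 3 * (classicalPartial i v x * classicalPartial i (gradDot ψ v) x +
        classicalPartial i (classicalPartial i v) x * gradDot ψ v x)
      - 2 * h ^ 3 * (classicalPartial i ψ x * classicalPartial i (gradDot v v) x +
        classicalPartial i (classicalPartial i ψ) x * gradDot v v x)
      + 2 * h ^ 3 * (lap ψ x * (v x * classicalPartial i (classicalPartial i v) x +
        classicalPartial i v x * classicalPartial i v x) +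
          classicalPartial i (lap ψ) x * (v x * classicalPartial i v x))
      - h ^ 3 * (v x * v x * classicalPartial i (classicalPartial i (lap ψ)) x +
        (v x * classicalPartial i v x + classicalPartial i v x * v x) * classicalPartial i (lap ψ) x)
      + 2 * h * (gradDot ψ ψ x * (classicalPartial i ψ x *
          (v x * classicalPartial i v x + classicalPartial i v x * v x) +
          classicalPartial i (classicalPartial i ψ) x * (v x * v x)) +
        classicalPartial i (gradDot ψ ψ) x * (classicalPartial i ψ x * (v x * v x)))
      + h ^ 2 * (g x * (v x * classicalPartial i (classicalPartial i v) x +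
        classicalPartial i v x * classicalPartial i v x) +
          classicalPartial i g x * (v x * classicalPartial i v x))
      - h ^ 2 / 2 * (v x * v x * classicalPartial i (classicalPartial i g) x +
        (v x * classicalPartial i v x + classicalPartial i v x * v x) *
          classicalPartial i g x) := by
  have hL : ContDiff ℝ ∞ (lap ψ) := contDiff_lap hψ
  have hLi := contDiff_classicalPartial hL i
  have hvi := contDiff_classicalPartial hv i
  have hψi := contDiff_classicalPartial hψ i
  have hgi := contDiff_classicalPartial hg i
  have hS : ContDiff ℝ ∞ (gradDot ψ v) := contDiff_gradDot hψ hv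
  have hN : ContDiff ℝ ∞ (gradDot v v) := contDiff_gradDot hv hv
  have hQ : ContDiff ℝ ∞ (gradDot ψ ψ) := contDiff_gradDot hψ hψ
  unfold carlemanField
  rw [pd_sub (by fun_prop) (by fun_prop), pd_add (by fun_prop) (by fun_prop),
    pd_add (by fun_prop) (by fun_prop), pd_sub (by fun_prop) (by fun_prop),
    pd_add (by fun_prop) (by fun_prop), pd_sub (by fun_prop) (by fun_prop),
    pd_const_mul (by fun_prop), pd_const_mul (by fun_prop), pd_const_mul (by fun_prop),
    pd_const_mul (by fun_prop), pd_const_mul (by fun_prop), pd_const_mul (by fun_prop),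
    pd_const_mul (by fun_prop)]
  rw [pd_mul hvi hS, pd_mul hψi hN, pd_mul hL (hv.mul hvi), pd_mul hv hvi,
    pd_mul (hv.mul hv) hLi, pd_mul hv hv, pd_mul hQ (hψi.mul (hv.mul hv)),
    pd_mul hψi (hv.mul hv), pd_mul hv hv, pd_mul hg (hv.mul hvi), pd_mul hv hvi,
    pd_mul (hv.mul hv) hgi, pd_mul hv hv]

/-- The divergence of `carlemanField`. The terms with `ψ' v' v''` which arise from `∇v · ∇(∇ψ · ∇v)`
and `∇ψ · ∇|∇v|²` cancel by symmetry of the second derivatives of `v`. -/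
theorem div_carlemanField {h : ℝ} {ψ g v : RSpace n → ℝ} (hψ : ContDiff ℝ ∞ ψ)
    (hg : ContDiff ℝ ∞ g) (hv : ContDiff ℝ ∞ v) (x : RSpace n) :
    ∑ i, classicalPartial i (carlemanField h ψ g v i) x =
      4 * h ^ 3 * (lap v x * gradDot ψ v x) + 4 * h ^ 3 * hessForm ψ v v x
      + 2 * h ^ 3 * (lap ψ x * (v x * lap v x)) - h ^ 3 * (v x ^ 2 * lap (lap ψ) x)
      + 4 * h * (hessForm ψ ψ ψ x * v x ^ 2) + 2 * h * (gradDot ψ ψ x * lap ψ x * v x ^ 2)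
      + 4 * h * (gradDot ψ ψ x * v x * gradDot ψ v x)
      + h ^ 2 * (g x * gradDot v v x) + h ^ 2 * (g x * (v x * lap v x))
      - h ^ 2 / 2 * (v x ^ 2 * lap g x) := by
  have e1 : ∑ i, classicalPartial i v x * classicalPartial i (gradDot ψ v) x =
      hessForm ψ v v x + ∑ i, ∑ j, classicalPartial i v x * (classicalPartial j ψ x *
        classicalPartial i (classicalPartial j v) x) := by
    simp_rw [pd_gradDot hψ hv, hessForm, Finset.mul_sum]
    rw [← Finset.sum_add_distrib]
    refine Finset.sum_congr rfl fun i _ => ?_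
    rw [← Finset.sum_add_distrib]
    exact Finset.sum_congr rfl fun j _ => by ring
  have e2 : ∑ i, classicalPartial i ψ x * classicalPartial i (gradDot v v) x =
      2 * ∑ i, ∑ j, classicalPartial i v x * (classicalPartial j ψ x *
        classicalPartial i (classicalPartial j v) x) := by
    rw [Finset.sum_comm]
    simp_rw [pd_gradDot hv hv, Finset.mul_sum]
    refine Finset.sum_congr rfl fun i _ => Finset.sum_congr rfl fun j _ => ?_
    rw [pd_comm hv i x j]; ring
  have e3 : ∑ i, classicalPartial i (gradDot ψ ψ) x * classicalPartial i ψ x =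
      2 * hessForm ψ ψ ψ x := by
    simp_rw [pd_gradDot hψ hψ, hessForm, Finset.mul_sum, Finset.sum_mul]
    exact Finset.sum_congr rfl fun i _ => Finset.sum_congr rfl fun j _ => by ring
  have hv' : lap v x = ∑ i, classicalPartial i (classicalPartial i v) x := rfl
  have hψ' : lap ψ x = ∑ i, classicalPartial i (classicalPartial i ψ) x := rfl
  have hg' : lap g x = ∑ i, classicalPartial i (classicalPartial i g) x := rfl
  have hL' : lap (lap ψ) x = ∑ i, classicalPartial i (classicalPartial i (lap ψ)) x := rfl
  have hN' : gradDot v v x = ∑ i, classicalPartial i v x * classicalPartial i v x := rfl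
  have hS' : gradDot ψ v x = ∑ i, classicalPartial i ψ x * classicalPartial i v x := rfl
  have key : ∑ i, classicalPartial i (carlemanField h ψ g v i) x =
      4 * h ^ 3 * ∑ i, classicalPartial i v x * classicalPartial i (gradDot ψ v) x
      + 4 * h ^ 3 * gradDot ψ v x * ∑ i, classicalPartial i (classicalPartial i v) x
      - 2 * h ^ 3 * ∑ i, classicalPartial i ψ x * classicalPartial i (gradDot v v) x
      - 2 * h ^ 3 * gradDot v v x * ∑ i, classicalPartial i (classicalPartial i ψ) x
      + (2 * h ^ 3 * lap ψ x + h ^ 2 * g x) * v x * ∑ i, classicalPartial i (classicalPartial i v) x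
      + (2 * h ^ 3 * lap ψ x + h ^ 2 * g x) * ∑ i, classicalPartial i v x * classicalPartial i v x
      - h ^ 3 * v x ^ 2 * ∑ i, classicalPartial i (classicalPartial i (lap ψ)) x
      + 4 * h * gradDot ψ ψ x * v x * ∑ i, classicalPartial i ψ x * classicalPartial i v x
      + 2 * h * gradDot ψ ψ x * v x ^ 2 * ∑ i, classicalPartial i (classicalPartial i ψ) x
      + 2 * h * v x ^ 2 * ∑ i, classicalPartial i (gradDot ψ ψ) x * classicalPartial i ψ x
      - h ^ 2 / 2 * v x ^ 2 * ∑ i, classicalPartial i (classicalPartial i g) x := by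
    simp_rw [pd_carlemanField hψ hg hv, Finset.mul_sum]
    simp_rw [← Finset.sum_add_distrib, ← Finset.sum_sub_distrib, ← Finset.sum_add_distrib,
      ← Finset.sum_sub_distrib, ← Finset.sum_add_distrib]
    rw [← Finset.sum_sub_distrib]
    exact Finset.sum_congr rfl fun i _ => by ring
  rw [key, e1, e2, e3, ← hv', ← hψ', ← hg', ← hL', ← hN', ← hS']
  ring

end Calculus

/-! ### Pointwise lower bounds -/

/-- The remainder in the Carleman identity is bounded from below: the contributions of order
`h² / ε` coming from the convexification beat all the others, which are of order `h²`. Here `a`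
and `-(2hσs + hLv)` are the values of the self-adjoint and the anti-self-adjoint part. -/
theorem remainder_lower_bound {h ε τ σ β m K κ N s r L L₂ g g₂ v a c : ℝ}
    (h0 : 0 < h) (h1 : h ≤ 1) (hε : 0 < ε) (hτ : τ = h / ε)
    (hσ : 1 / 2 ≤ σ) (hm : 0 < m) (hβ : m ≤ β) (hK : 0 ≤ K)
    (hL : |L| ≤ K) (hL₂ : |L₂| ≤ K) (hg : |g| ≤ K * h) (hg₂ : |g₂| ≤ K * h)
    (hgκ : g = 4 * h * σ * κ - m * h * τ)
    (hr : r ^ 2 ≤ K * N) (hN : 0 ≤ N)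
    (hε₁ : 6 * K / m ^ 2 ≤ m / ε - c / ε)
    (hε₂ : 3 * K ^ 2 + 2 * K ≤ 3 / 4 * m ^ 2 / ε - c / ε) :
    c / ε * h ^ 2 * (h ^ 2 * N + v ^ 2) ≤
      a ^ 2 + (2 * h * (σ * s) + h * L * v) ^ 2
        - 4 * h ^ 3 * (σ * (-κ * N + 2 * r * s / β) - τ * s ^ 2)
        + h ^ 3 * (v ^ 2 * L₂) - 4 * h * ((σ ^ 3 * (κ * β) - τ * σ ^ 2 * β ^ 2) * v ^ 2)
        - h ^ 2 * (g * N) + g * v * (a + σ ^ 2 * β * v) + h ^ 2 / 2 * (v ^ 2 * g₂) := by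
  have hβ0 : 0 < β := hm.trans_le hβ
  have hτ0 : 0 < τ := hτ ▸ div_pos h0 hε
  set B := -(2 * h * (σ * s) + h * L * v) with hB
  set q := r / β with hq
  have hq2 : q ^ 2 ≤ K / m ^ 2 * N := by
    rw [hq, div_pow, div_mul_eq_mul_div]
    have : m ^ 2 ≤ β ^ 2 := by gcongr
    exact div_le_div₀ (by positivity) hr (by positivity) this
  -- The multiplier cancels the terms with `κ`, and `2 h σ s` is expressed through `B`.
  have e1 : a ^ 2 + (2 * h * (σ * s) + h * L * v) ^ 2
        - 4 * h ^ 3 * (σ * (-κ * N + 2 * r * s / β) - τ * s ^ 2)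
        + h ^ 3 * (v ^ 2 * L₂) - 4 * h * ((σ ^ 3 * (κ * β) - τ * σ ^ 2 * β ^ 2) * v ^ 2)
        - h ^ 2 * (g * N) + g * v * (a + σ ^ 2 * β * v) + h ^ 2 / 2 * (v ^ 2 * g₂) =
      a ^ 2 + B ^ 2 + m * h ^ 3 * τ * N + h * τ * (σ ^ 2 * β * (4 * β - m)) * v ^ 2
        + 4 * h ^ 3 * τ * s ^ 2 + 4 * h ^ 2 * q * B + 4 * h ^ 3 * q * L * v
        + g * v * a + h ^ 2 / 2 * (v ^ 2 * g₂) + h ^ 3 * (v ^ 2 * L₂) := by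
    rw [hB, show 2 * r * s / β = 2 * q * s by rw [hq]; ring]
    have : g * v * (a + σ ^ 2 * β * v) = g * v * a + g * (σ ^ 2 * β * v ^ 2) := by ring
    rw [this]
    have : h ^ 2 * (g * N) = g * (h ^ 2 * N) := by ring
    rw [this]
    have h1 : g * (σ ^ 2 * β * v ^ 2) - g * (h ^ 2 * N) =
        (4 * h * σ * κ - m * h * τ) * (σ ^ 2 * β * v ^ 2 - h ^ 2 * N) := by rw [← hgκ]; ring
    linear_combination h1
  rw [e1]
  clear_value B q
  clear e1
  -- Cauchy–Schwarz: the squares `B ^ 2` and `a ^ 2` are used up in `b1` and `b3`.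
  have b1 : -(B ^ 2 + 4 * (h ^ 4 * (K / m ^ 2 * N))) ≤ 4 * h ^ 2 * q * B := by
    have : h ^ 4 * q ^ 2 ≤ h ^ 4 * (K / m ^ 2 * N) := by gcongr
    linarith only [sq_nonneg (B + 2 * h ^ 2 * q), this]
  have hL2 : L ^ 2 ≤ K ^ 2 := by rw [← sq_abs L]; gcongr
  have b2 : -(2 * (h ^ 4 * (K / m ^ 2 * N)) + 2 * h ^ 2 * (K ^ 2 * v ^ 2)) ≤
      4 * h ^ 3 * q * L * v := by
    have h3 : h ^ 4 * q ^ 2 ≤ h ^ 4 * (K / m ^ 2 * N) := by gcongr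
    have h4 : h ^ 2 * (L ^ 2 * v ^ 2) ≤ h ^ 2 * (K ^ 2 * v ^ 2) := by gcongr
    linarith only [sq_nonneg (h ^ 2 * q + h * L * v), h3, h4]
  have hg2 : g ^ 2 ≤ K ^ 2 * h ^ 2 := by
    rw [← sq_abs g, ← mul_pow]; gcongr
  have b3 : -(a ^ 2 + K ^ 2 * h ^ 2 * v ^ 2) ≤ g * v * a := by
    have : g ^ 2 * v ^ 2 ≤ K ^ 2 * h ^ 2 * v ^ 2 := by gcongr
    linarith only [sq_nonneg (a + g * v / 2), mul_nonneg (sq_nonneg g) (sq_nonneg v), this]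
  have b4 : -(K * h ^ 2 * v ^ 2) ≤ h ^ 2 / 2 * (v ^ 2 * g₂) := by
    have h2 : -K ≤ g₂ := by
      have := (abs_le.1 hg₂).1
      nlinarith only [this, h1, hK]
    have : h ^ 2 * v ^ 2 * -K ≤ h ^ 2 * v ^ 2 * g₂ := by gcongr
    linarith only [mul_nonneg (mul_nonneg (sq_nonneg h) (sq_nonneg v)) hK, this]
  have b5 : -(K * h ^ 2 * v ^ 2) ≤ h ^ 3 * (v ^ 2 * L₂) := by
    have h2 := (abs_le.1 hL₂).1
    have h3 : h ^ 3 * v ^ 2 * -K ≤ h ^ 3 * v ^ 2 * L₂ := by gcongr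
    have h4 : h ^ 3 ≤ h ^ 2 := pow_le_pow_of_le_one h0.le h1 (by norm_num)
    have h5 : h ^ 3 * (v ^ 2 * K) ≤ h ^ 2 * (v ^ 2 * K) := by gcongr
    linarith only [h3, h5]
  have hσ2 : 1 / 4 ≤ σ ^ 2 := by nlinarith only [hσ]
  have b6 : 3 / 4 * m ^ 2 ≤ σ ^ 2 * β * (4 * β - m) := by
    have h2 : 3 * m ^ 2 ≤ β * (4 * β - m) := by nlinarith only [hβ, hm]
    nlinarith only [h2, hσ2, sq_nonneg m]
  have b7 : h * τ * (3 / 4 * m ^ 2) * v ^ 2 ≤ h * τ * (σ ^ 2 * β * (4 * β - m)) * v ^ 2 := by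
    gcongr
  have b8 : 0 ≤ 4 * h ^ 3 * τ * s ^ 2 := by positivity
  have c1 : 6 * K / m ^ 2 * (h ^ 4 * N) ≤ (m / ε - c / ε) * (h ^ 4 * N) := by gcongr
  have c2 : (3 * K ^ 2 + 2 * K) * (h ^ 2 * v ^ 2) ≤
      (3 / 4 * m ^ 2 / ε - c / ε) * (h ^ 2 * v ^ 2) := by gcongr
  -- Since `τ = h / ε`, the convexification terms are of order `h² / ε`.
  have d1 : m * h ^ 3 * τ * N = m / ε * (h ^ 4 * N) := by rw [hτ]; ring
  have d2 : h * τ * (3 / 4 * m ^ 2) * v ^ 2 = 3 / 4 * m ^ 2 / ε * (h ^ 2 * v ^ 2) := by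
    rw [hτ]; ring
  have d3 : 6 * K / m ^ 2 * (h ^ 4 * N) = 6 * (h ^ 4 * (K / m ^ 2 * N)) := by ring
  linarith only [b1, b2, b3, b4, b5, b7, b8, c1, c2, d1, d2, d3]

/-- The boundary flux in the Carleman identity, in terms of the normal derivative `p`, the length
`t` of the tangential gradient of `u`, and the products `w` of the tangential gradient and `Xν` of
the normal with the gradient of the weight. -/
theorem flux_lower_bound {h K p u t w Xν Q L Lν g gν : ℝ} (h0 : 0 < h) (h1 : h ≤ 1) (hK : 0 ≤ K)
    (ht : 0 ≤ t) (hw : |w| ≤ K * t) (hX : |Xν| ≤ K) (hQ : |Q| ≤ K ^ 2)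
    (hL : |L| ≤ K) (hLν : |Lν| ≤ K) (hg : |g| ≤ K * h) (hgν : |gν| ≤ K * h) :
    2 * h ^ 3 * Xν * p ^ 2 - (4 * K ^ 3 + 4 * K ^ 2 + 4 * K) *
        (h * u ^ 2 + h ^ 2 * (|u| * |p|) + h ^ 3 * t ^ 2 + h ^ 3 * (t * |p|)) ≤
      4 * h ^ 3 * ((p - u * Xν / h) * (Xν * p + w - u * Q / h))
        - 2 * h ^ 3 * (Xν * (p ^ 2 + t ^ 2 - 2 * u * (Xν * p + w) / h + u ^ 2 * Q / h ^ 2))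
        + 2 * h ^ 3 * (L * (u * (p - u * Xν / h))) - h ^ 3 * (u ^ 2 * Lν)
        + 2 * h * (Q * (Xν * u ^ 2)) + h ^ 2 * (g * (u * (p - u * Xν / h)))
        - h ^ 2 / 2 * (u ^ 2 * gν) := by
  have e : 4 * h ^ 3 * ((p - u * Xν / h) * (Xν * p + w - u * Q / h))
        - 2 * h ^ 3 * (Xν * (p ^ 2 + t ^ 2 - 2 * u * (Xν * p + w) / h + u ^ 2 * Q / h ^ 2))
        + 2 * h ^ 3 * (L * (u * (p - u * Xν / h))) - h ^ 3 * (u ^ 2 * Lν)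
        + 2 * h * (Q * (Xν * u ^ 2)) + h ^ 2 * (g * (u * (p - u * Xν / h)))
        - h ^ 2 / 2 * (u ^ 2 * gν) =
      2 * h ^ 3 * Xν * p ^ 2 + 4 * h ^ 3 * (p * w) - 4 * h ^ 2 * (Q * (p * u))
        - 2 * h ^ 3 * (Xν * t ^ 2) + 4 * h * ((Xν * Q) * u ^ 2) + 2 * h ^ 3 * (L * (u * p))
        - 2 * h ^ 2 * ((L * Xν) * u ^ 2) - h ^ 3 * (Lν * u ^ 2) + h ^ 2 * (g * (u * p))
        - h * ((g * Xν) * u ^ 2) - h ^ 2 / 2 * (gν * u ^ 2) := by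
    field_simp
    ring
  rw [e]
  clear e
  -- All terms except `2 h³ Xν p²` are estimated by absolute values; the powers of `h` in excess of
  -- those in the conclusion are dropped using `h ≤ 1`.
  have gen : ∀ {y k z Z : ℝ}, |y| ≤ k → |z| ≤ Z → |y * z| ≤ k * Z := fun {y k z Z} hy hz => by
    rw [abs_mul]; exact mul_le_mul hy hz (abs_nonneg _) ((abs_nonneg _).trans hy)
  have hu2 : |u ^ 2| ≤ u ^ 2 := (abs_of_nonneg (sq_nonneg u)).le
  have ht2 : |t ^ 2| ≤ t ^ 2 := (abs_of_nonneg (sq_nonneg t)).le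
  have hup : |u * p| ≤ |u| * |p| := (abs_mul u p).le
  have hpu : |p * u| ≤ |u| * |p| := by rw [abs_mul, mul_comm]
  have hP : 0 ≤ |u| * |p| := by positivity
  have hT : 0 ≤ t * |p| := by positivity
  have i1 := abs_le.1 (gen (le_refl |p|) hw)
  have i2 := abs_le.1 (gen hQ hpu)
  have i3 := abs_le.1 (gen hX ht2)
  have i4 := abs_le.1 (gen (gen hX hQ) hu2)
  have i5 := abs_le.1 (gen hL hup)
  have i6 := abs_le.1 (gen (gen hL hX) hu2)
  have i7 := abs_le.1 (gen hLν hu2)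
  have i8 := abs_le.1 (gen hg hup)
  have i9 := abs_le.1 (gen (gen hg hX) hu2)
  have i10 := abs_le.1 (gen hgν hu2)
  have h21 : h ^ 2 ≤ h := by nlinarith only [h0, h1]
  have h32 : h ^ 3 ≤ h ^ 2 := pow_le_pow_of_le_one h0.le h1 (by norm_num)
  have h31 : h ^ 3 ≤ h := h32.trans h21
  set U := |u| * |p|
  have j1 := mul_le_mul_of_nonneg_left i1.1 (show 0 ≤ 4 * h ^ 3 by positivity)
  have j2 := mul_le_mul_of_nonneg_left i2.2 (show 0 ≤ 4 * h ^ 2 by positivity)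
  have j3 := mul_le_mul_of_nonneg_left i3.2 (show 0 ≤ 2 * h ^ 3 by positivity)
  have j4 := mul_le_mul_of_nonneg_left i4.1 (show 0 ≤ 4 * h by positivity)
  have j5 := mul_le_mul_of_nonneg_left i5.1 (show 0 ≤ 2 * h ^ 3 by positivity)
  have j6 := mul_le_mul_of_nonneg_left i6.2 (show 0 ≤ 2 * h ^ 2 by positivity)
  have j7 := mul_le_mul_of_nonneg_left i7.2 (show 0 ≤ h ^ 3 by positivity)
  have j8 := mul_le_mul_of_nonneg_left i8.1 (show 0 ≤ h ^ 2 by positivity)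
  have j9 := mul_le_mul_of_nonneg_left i9.2 (show 0 ≤ h by positivity)
  have j10 := mul_le_mul_of_nonneg_left i10.2 (show 0 ≤ h ^ 2 / 2 by positivity)
  have k5 : h ^ 3 * (K * U) ≤ h ^ 2 * (K * U) := by gcongr
  have k6 : h ^ 2 * (K * K * u ^ 2) ≤ h * (K * K * u ^ 2) := by gcongr
  have k7 : h ^ 3 * (K * u ^ 2) ≤ h * (K * u ^ 2) := by gcongr
  have n1 : 0 ≤ K * (h ^ 3 * (t * |p|)) := by positivity
  have n2 : 0 ≤ K ^ 2 * (h ^ 3 * (t * |p|)) := by positivity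
  have n3 : 0 ≤ K ^ 3 * (h ^ 3 * (t * |p|)) := by positivity
  have n4 : 0 ≤ K * (h ^ 2 * U) := by positivity
  have n5 : 0 ≤ K ^ 3 * (h ^ 2 * U) := by positivity
  have n6 : 0 ≤ K * (h ^ 3 * t ^ 2) := by positivity
  have n7 : 0 ≤ K ^ 2 * (h ^ 3 * t ^ 2) := by positivity
  have n8 : 0 ≤ K ^ 3 * (h ^ 3 * t ^ 2) := by positivity
  have n9 : 0 ≤ K ^ 2 * (h * u ^ 2) := by positivity
  have n10 : 0 ≤ K * (h * u ^ 2) := by positivity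
  linarith only [j1, j2, j3, j4, j5, j6, j7, j8, j9, j10, k5, k6, k7, n1, n2, n3, n4, n5, n6, n7,
    n8, n9, n10]

/-! ### Convexified limiting Carleman weights -/

section Weight

variable {n : ℕ} {Ω : Set (RSpace n)}

/-- A globally smooth function `φ` which is a limiting Carleman weight on the closure of `Ω`, with
`|∇φ|² ≥ m > 0` there. The Poisson bracket condition is written as a formula for the Hessian of
`φ`, in which `κ = φ''(∇φ, ∇φ) / |∇φ|²` on the closure of `Ω`. -/
structure IsWeightPair (Ω : Set (RSpace n)) (φ κ : RSpace n → ℝ) (m : ℝ) : Prop where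
  smooth : ContDiff ℝ ∞ φ
  smooth_curvature : ContDiff ℝ ∞ κ
  pos : 0 < m
  le_gradDot : ∀ x ∈ closure Ω, m ≤ gradDot φ φ x
  hess_self : ∀ x ∈ closure Ω, hessForm φ φ φ x = κ x * gradDot φ φ x
  hess : ∀ x ∈ closure Ω, ∀ v : RSpace n → ℝ, hessForm φ v v x =
    -κ x * gradDot v v x + 2 * hessForm φ φ v x * gradDot φ v x / gradDot φ φ x

/-- The convexified weight `φ - (τ / 2) φ²`. -/
def convexWeight (φ : RSpace n → ℝ) (τ : ℝ) (x : RSpace n) : ℝ := φ x - τ / 2 * (φ x * φ x)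

/-- The multiplier `4 (1 - τ φ) κ - m τ`, which balances the two indefinite terms of the Carleman
identity. -/
def multiplier (φ κ : RSpace n → ℝ) (m τ : ℝ) (x : RSpace n) : ℝ :=
  4 * κ x - 4 * τ * (φ x * κ x) - m * τ

variable {φ κ v ψ u : RSpace n → ℝ} {m : ℝ}

@[fun_prop]
theorem contDiff_convexWeight (hφ : ContDiff ℝ ∞ φ) (τ : ℝ) :
    ContDiff ℝ ∞ (convexWeight φ τ) := by
  unfold convexWeight
  fun_prop

@[fun_prop]
theorem contDiff_multiplier (hφ : ContDiff ℝ ∞ φ) (hκ : ContDiff ℝ ∞ κ) (m τ : ℝ) :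
    ContDiff ℝ ∞ (multiplier φ κ m τ) := by
  unfold multiplier
  fun_prop

theorem pd_convexWeight (hφ : ContDiff ℝ ∞ φ) (τ : ℝ) (i : Fin n) (x : RSpace n) :
    classicalPartial i (convexWeight φ τ) x = (1 - τ * φ x) * classicalPartial i φ x := by
  unfold convexWeight
  rw [pd_sub hφ (by fun_prop), pd_const_mul (by fun_prop), pd_mul hφ hφ]
  ring

theorem pd_pd_convexWeight (hφ : ContDiff ℝ ∞ φ) (τ : ℝ) (i j : Fin n) (x : RSpace n) :
    classicalPartial i (classicalPartial j (convexWeight φ τ)) x =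
      (1 - τ * φ x) * classicalPartial i (classicalPartial j φ) x -
        τ * (classicalPartial i φ x * classicalPartial j φ x) := by
  have hj := contDiff_classicalPartial hφ j
  rw [show classicalPartial j (convexWeight φ τ) = fun y =>
      classicalPartial j φ y - τ * (φ y * classicalPartial j φ y) from
    funext fun y => by rw [pd_convexWeight hφ]; ring]
  rw [pd_sub (contDiff_pd hφ j) (by fun_prop), pd_const_mul (by fun_prop), pd_mul hφ hj]
  ring

theorem gradDot_convexWeight (hφ : ContDiff ℝ ∞ φ) (τ : ℝ) (v : RSpace n → ℝ) (x : RSpace n) :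
    gradDot (convexWeight φ τ) v x = (1 - τ * φ x) * gradDot φ v x := by
  simp_rw [gradDot, pd_convexWeight hφ, Finset.mul_sum, mul_assoc]

theorem gradDot_comm (f g : RSpace n → ℝ) (x : RSpace n) : gradDot f g x = gradDot g f x := by
  simp_rw [gradDot, mul_comm]

theorem hessForm_convexWeight (hφ : ContDiff ℝ ∞ φ) (τ : ℝ) (v : RSpace n → ℝ) (x : RSpace n) :
    hessForm (convexWeight φ τ) v v x =
      (1 - τ * φ x) * hessForm φ v v x - τ * gradDot φ v x ^ 2 := by
  simp_rw [hessForm, gradDot, sq, Finset.sum_mul_sum, pd_pd_convexWeight hφ, Finset.mul_sum]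
  rw [← Finset.sum_sub_distrib]
  refine Finset.sum_congr rfl fun i _ => ?_
  rw [← Finset.sum_sub_distrib]
  exact Finset.sum_congr rfl fun j _ => by ring

theorem hessForm_convexWeight_self (hφ : ContDiff ℝ ∞ φ) (τ : ℝ) (x : RSpace n) :
    hessForm (convexWeight φ τ) (convexWeight φ τ) (convexWeight φ τ) x =
      (1 - τ * φ x) ^ 3 * hessForm φ φ φ x
        - τ * (1 - τ * φ x) ^ 2 * gradDot φ φ x ^ 2 := by
  rw [hessForm_convexWeight hφ, gradDot_comm, gradDot_convexWeight hφ]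
  have : hessForm φ (convexWeight φ τ) (convexWeight φ τ) x =
      (1 - τ * φ x) ^ 2 * hessForm φ φ φ x := by
    simp_rw [hessForm, pd_convexWeight hφ, Finset.mul_sum]
    exact Finset.sum_congr rfl fun i _ => Finset.sum_congr rfl fun j _ => by ring
  rw [this]; ring

theorem lap_sub_const_mul {f g : RSpace n → ℝ} (hf : ContDiff ℝ ∞ f) (hg : ContDiff ℝ ∞ g) (c : ℝ) :
    lap (fun y => f y - c * g y) = fun x => lap f x - c * lap g x := by
  funext x
  simp_rw [lap, Finset.mul_sum]
  rw [← Finset.sum_sub_distrib]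
  refine Finset.sum_congr rfl fun i _ => ?_
  have hfi := contDiff_classicalPartial hf i
  have hgi := contDiff_classicalPartial hg i
  rw [show classicalPartial i (fun y => f y - c * g y) =
      fun y => classicalPartial i f y - c * classicalPartial i g y from
    funext fun y => by rw [pd_sub hf (by fun_prop), pd_const_mul hg]]
  rw [pd_sub hfi (by fun_prop), pd_const_mul hgi]

theorem lap_const_mul {f : RSpace n → ℝ} (hf : ContDiff ℝ ∞ f) (c : ℝ) (x : RSpace n) :
    lap (fun y => c * f y) x = c * lap f x := by
  simp_rw [lap, Finset.mul_sum]
  refine Finset.sum_congr rfl fun i _ => ?_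
  have hfi := contDiff_classicalPartial hf i
  rw [show classicalPartial i (fun y => c * f y) = fun y => c * classicalPartial i f y from
    funext fun y => by rw [pd_const_mul hf]]
  rw [pd_const_mul hfi]

/-- `K` bounds, at the point `x`, the coefficients in the Carleman identity for the convexified
weight. -/
structure CoeffBound (φ κ : RSpace n → ℝ) (m τ K : ℝ) (x : RSpace n) : Prop where
  lap_weight : |lap (convexWeight φ τ) x| ≤ K
  lap_lap_weight : |lap (lap (convexWeight φ τ)) x| ≤ K
  mult : |multiplier φ κ m τ x| ≤ K
  lap_mult : |lap (multiplier φ κ m τ) x| ≤ K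
  grad_weight : ∑ i, |classicalPartial i (convexWeight φ τ) x| ≤ K
  grad_lap_weight : ∑ i, |classicalPartial i (lap (convexWeight φ τ)) x| ≤ K
  grad_mult : ∑ i, |classicalPartial i (multiplier φ κ m τ) x| ≤ K
  hess_weight :
    ∑ j, (∑ i, classicalPartial i (classicalPartial j φ) x * classicalPartial i φ x) ^ 2 ≤ K
  weight : |φ x| ≤ K

/-- The coefficients of the Carleman identity are bounded on the closure of `Ω` by a constant
which does not depend on the convexification parameter. -/
theorem IsWeightPair.exists_bound (hd : IsWeightPair Ω φ κ m) (hbd : Bornology.IsBounded Ω) :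
    ∃ K : ℝ, 0 < K ∧ ∀ τ ∈ Icc (0 : ℝ) 1, ∀ x ∈ closure Ω, CoeffBound φ κ m τ K x := by
  have hφ := hd.smooth
  have hκ := hd.smooth_curvature
  have hφφ : ContDiff ℝ ∞ fun x => φ x * φ x := by fun_prop
  have hφκ : ContDiff ℝ ∞ fun x => φ x * κ x := by fun_prop
  have hL := contDiff_lap hφ
  have hL2 := contDiff_lap hφφ
  have e1 (τ : ℝ) : lap (convexWeight φ τ) =
      fun x => lap φ x - τ / 2 * lap (fun x => φ x * φ x) x := lap_sub_const_mul hφ hφφ (τ / 2)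
  have e2 (τ : ℝ) : lap (lap (convexWeight φ τ)) = fun x =>
      lap (fun x => lap φ x) x - τ / 2 * lap (fun x => lap (fun x => φ x * φ x) x) x := by
    rw [e1, lap_sub_const_mul hL hL2]
  have e3 (τ : ℝ) (i : Fin n) (x : RSpace n) : classicalPartial i (lap (convexWeight φ τ)) x =
      classicalPartial i (fun x => lap φ x) x -
        τ / 2 * classicalPartial i (fun x => lap (fun x => φ x * φ x) x) x := by
    rw [e1, pd_sub hL (by fun_prop), pd_const_mul hL2]
  have hG : ∀ τ : ℝ, multiplier φ κ m τ =
      fun x => 4 * κ x - τ * (4 * (φ x * κ x) + m) := fun τ => by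
    funext x; simp only [multiplier]; ring
  have h4κ : ContDiff ℝ ∞ fun x => 4 * κ x := by fun_prop
  have h4φ : ContDiff ℝ ∞ fun x => 4 * (φ x * κ x) + m := by fun_prop
  have e4 (τ : ℝ) : lap (multiplier φ κ m τ) = fun x => lap (fun x => 4 * κ x) x -
      τ * lap (fun x => 4 * (φ x * κ x) + m) x := by
    rw [hG, lap_sub_const_mul h4κ h4φ]
  have e5 (τ : ℝ) (i : Fin n) (x : RSpace n) : classicalPartial i (multiplier φ κ m τ) x =
      classicalPartial i (fun x => 4 * κ x) x -
        τ * classicalPartial i (fun x => 4 * (φ x * κ x) + m) x := by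
    rw [hG, pd_sub h4κ (by fun_prop), pd_const_mul h4φ]
  have cφ : Continuous φ := hφ.continuous
  have cκ : Continuous κ := hκ.continuous
  have cL := hL.continuous
  have cL2 := hL2.continuous
  have cLL := (contDiff_lap hL).continuous
  have cLL2 := (contDiff_lap hL2).continuous
  have cL4 := (contDiff_lap h4κ).continuous
  have cL5 := (contDiff_lap h4φ).continuous
  have cd1 := fun i => (contDiff_pd hφ i).continuous
  have cd2 := fun i => (contDiff_pd hL i).continuous
  have cd3 := fun i => (contDiff_pd hL2 i).continuous
  have cd4 := fun i => (contDiff_pd h4κ i).continuous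
  have cd5 := fun i => (contDiff_pd h4φ i).continuous
  have cdd := fun i j => (contDiff_pd (contDiff_pd hφ j) i).continuous
  let F : ℝ × RSpace n → ℝ := fun p =>
    |lap (convexWeight φ p.1) p.2| + |lap (lap (convexWeight φ p.1)) p.2| +
      |multiplier φ κ m p.1 p.2| + |lap (multiplier φ κ m p.1) p.2| +
      ∑ i, |classicalPartial i (convexWeight φ p.1) p.2| +
      ∑ i, |classicalPartial i (lap (convexWeight φ p.1)) p.2| +
      ∑ i, |classicalPartial i (multiplier φ κ m p.1) p.2| +
      ∑ j, (∑ i, classicalPartial i (classicalPartial j φ) p.2 * classicalPartial i φ p.2) ^ 2 +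
      |φ p.2|
  have hF : Continuous F := by
    simp only [F, e2, e3, e4, e5]
    simp only [e1, hG, pd_convexWeight hφ]
    fun_prop
  obtain ⟨K, hK⟩ := ((isCompact_Icc (a := (0 : ℝ)) (b := 1)).prod
    hbd.isCompact_closure).exists_bound_of_continuousOn hF.continuousOn
  refine ⟨|K| + 1, by positivity, fun τ hτ x hx => ?_⟩
  have h1 : F (τ, x) ≤ |K| + 1 :=
    ((le_abs_self _).trans (hK (τ, x) ⟨hτ, hx⟩)).trans ((le_abs_self K).trans (by simp))
  simp only [F] at h1
  have p1 := abs_nonneg (lap (convexWeight φ τ) x)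
  have p2 := abs_nonneg (lap (lap (convexWeight φ τ)) x)
  have p3 := abs_nonneg (multiplier φ κ m τ x)
  have p4 := abs_nonneg (lap (multiplier φ κ m τ) x)
  have p5 : 0 ≤ ∑ i, |classicalPartial i (convexWeight φ τ) x| := by positivity
  have p6 : 0 ≤ ∑ i, |classicalPartial i (lap (convexWeight φ τ)) x| := by positivity
  have p7 : 0 ≤ ∑ i, |classicalPartial i (multiplier φ κ m τ) x| := by positivity
  have p8 : 0 ≤ ∑ j, (∑ i, classicalPartial i (classicalPartial j φ) x *
    classicalPartial i φ x) ^ 2 := by positivity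
  have p9 := abs_nonneg (φ x)
  refine ⟨?_, ?_, ?_, ?_, ?_, ?_, ?_, ?_, ?_⟩ <;> linarith

/-- The Cauchy–Schwarz inequality for `∇v ↦ φ''(∇φ, ∇v)`. -/
theorem sq_hessForm_le (φ v : RSpace n → ℝ) (x : RSpace n) : hessForm φ φ v x ^ 2 ≤
    (∑ j, (∑ i, classicalPartial i (classicalPartial j φ) x * classicalPartial i φ x) ^ 2) *
      gradDot v v x := by
  have : hessForm φ φ v x = ∑ j, (∑ i, classicalPartial i (classicalPartial j φ) x *
      classicalPartial i φ x) * classicalPartial j v x := by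
    rw [hessForm, Finset.sum_comm]
    simp_rw [Finset.sum_mul, mul_assoc]
  rw [this]
  refine (Finset.sum_mul_sq_le_sq_mul_sq _ _ _).trans_eq ?_
  simp [gradDot, sq]

theorem gradDot_self_nonneg (v : RSpace n → ℝ) (x : RSpace n) : 0 ≤ gradDot v v x :=
  Finset.sum_nonneg fun _ _ => mul_self_nonneg _

/-- The pointwise Carleman estimate for `v = e^{-ψ/h} u`, where `ψ` is the convexified weight: the
square of the conjugated operator dominates `(h² / ε) (h² |∇v|² + v²)` up to a divergence. -/
theorem IsWeightPair.pointwise_estimate (hd : IsWeightPair Ω φ κ m) {h ε τ K c : ℝ}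
    (h0 : 0 < h) (h1 : h ≤ 1) (hε : 0 < ε) (hτ : τ = h / ε) (hK : 0 < K)
    (hv : ContDiff ℝ ∞ v) {x : RSpace n} (hx : x ∈ closure Ω)
    (hτφ : τ * φ x ≤ 1 / 2)
    (hB : CoeffBound φ κ m τ K x)
    (hε₁ : 6 * K / m ^ 2 ≤ m / ε - c / ε)
    (hε₂ : 3 * K ^ 2 + 2 * K ≤ 3 / 4 * m ^ 2 / ε - c / ε) :
    c / ε * h ^ 2 * (h ^ 2 * gradDot v v x + v x ^ 2) ≤
      (h ^ 2 * lap v x + gradDot (convexWeight φ τ) (convexWeight φ τ) x * v x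
        + 2 * h * gradDot (convexWeight φ τ) v x + h * lap (convexWeight φ τ) x * v x) ^ 2
      - ∑ i, classicalPartial i
          (carlemanField h (convexWeight φ τ) (fun y => h * multiplier φ κ m τ y) v i) x := by
  have hφ := hd.smooth
  have hG := contDiff_multiplier hφ hd.smooth_curvature m τ
  have hQ : gradDot (convexWeight φ τ) (convexWeight φ τ) x =
      (1 - τ * φ x) ^ 2 * gradDot φ φ x := by
    rw [gradDot_convexWeight hφ, gradDot_comm, gradDot_convexWeight hφ]; ring
  have key := remainder_lower_bound (h := h) (ε := ε) (τ := τ) (σ := 1 - τ * φ x)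
    (β := gradDot φ φ x) (m := m) (K := K) (κ := κ x) (N := gradDot v v x)
    (s := gradDot φ v x) (r := hessForm φ φ v x) (L := lap (convexWeight φ τ) x)
    (L₂ := lap (lap (convexWeight φ τ)) x) (g := h * multiplier φ κ m τ x)
    (g₂ := lap (fun y => h * multiplier φ κ m τ y) x) (v := v x)
    (a := -(h ^ 2 * lap v x) - (1 - τ * φ x) ^ 2 * gradDot φ φ x * v x) (c := c)
    h0 h1 hε hτ (by linarith) hd.pos (hd.le_gradDot x hx) hK.le hB.lap_weight hB.lap_lap_weight
    (by rw [abs_mul, abs_of_pos h0, mul_comm]; gcongr; exact hB.mult)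
    (by rw [lap_const_mul hG, abs_mul, abs_of_pos h0, mul_comm]; gcongr; exact hB.lap_mult)
    (by simp only [multiplier]; ring)
    ((sq_hessForm_le φ v x).trans (mul_le_mul_of_nonneg_right hB.hess_weight (gradDot_self_nonneg v x)))
    (gradDot_self_nonneg v x) hε₁ hε₂
  refine key.trans_eq ?_
  rw [div_carlemanField (contDiff_convexWeight hφ τ) (by fun_prop) hv, hQ,
    hessForm_convexWeight hφ, hessForm_convexWeight_self hφ, hd.hess x hx v, hd.hess_self x hx,
    gradDot_convexWeight hφ]
  ring

/-! ### Conjugation by the weight -/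

theorem contDiff_exp_mul (hψ : ContDiff ℝ ∞ ψ) (hu : ContDiff ℝ ∞ u) (h : ℝ) :
    ContDiff ℝ ∞ fun y => Real.exp (-ψ y / h) * u y := by fun_prop

theorem pd_exp_mul (hψ : ContDiff ℝ ∞ ψ) (hu : ContDiff ℝ ∞ u) (h : ℝ) (i : Fin n) (x : RSpace n) :
    classicalPartial i (fun y => Real.exp (-ψ y / h) * u y) x =
      Real.exp (-ψ x / h) * (classicalPartial i u x - u x * classicalPartial i ψ x / h) := by
  have hE : ContDiff ℝ ∞ fun y => Real.exp (-ψ y / h) := by fun_prop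
  have : classicalPartial i (fun y => Real.exp (-ψ y / h)) x =
      -(classicalPartial i ψ x / h) * Real.exp (-ψ x / h) := by
    have h1 := ((differentiableAt_of_smooth hψ x).hasFDerivAt.const_mul (-h⁻¹)).exp
    have h2 : (fun y => Real.exp (-ψ y / h)) = fun y => Real.exp (-h⁻¹ * ψ y) := by
      funext y; congr 1; ring
    rw [classicalPartial, h2, h1.fderiv]
    simp only [smul_apply, smul_eq_mul, classicalPartial]
    rw [show -h⁻¹ * ψ x = -ψ x / h by ring]; ring
  rw [pd_mul hE hu, this]; ring

theorem lap_exp_mul (hψ : ContDiff ℝ ∞ ψ) (hu : ContDiff ℝ ∞ u) (h : ℝ) (x : RSpace n) :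
    lap (fun y => Real.exp (-ψ y / h) * u y) x = Real.exp (-ψ x / h) *
      (lap u x - 2 * gradDot ψ u x / h - lap ψ x * u x / h + gradDot ψ ψ x * u x / h ^ 2) := by
  have : ∀ i, classicalPartial i (classicalPartial i fun y => Real.exp (-ψ y / h) * u y) x =
      Real.exp (-ψ x / h) * (classicalPartial i (classicalPartial i u) x
        - h⁻¹ * 2 * (classicalPartial i ψ x * classicalPartial i u x)
        - h⁻¹ * u x * classicalPartial i (classicalPartial i ψ) x
        + (h ^ 2)⁻¹ * u x * (classicalPartial i ψ x * classicalPartial i ψ x)) := by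
    intro i
    have hui := contDiff_classicalPartial hu i
    have hψi := contDiff_classicalPartial hψ i
    rw [show (classicalPartial i fun y => Real.exp (-ψ y / h) * u y) = fun y =>
        Real.exp (-ψ y / h) * (classicalPartial i u y - h⁻¹ * (u y * classicalPartial i ψ y)) from
      funext fun y => by rw [pd_exp_mul hψ hu]; ring]
    rw [pd_exp_mul hψ (by fun_prop), pd_sub hui (by fun_prop), pd_const_mul (by fun_prop),
      pd_mul hu hψi]
    ring
  rw [lap]
  simp_rw [this]
  rw [← Finset.mul_sum, Finset.sum_add_distrib, Finset.sum_sub_distrib, Finset.sum_sub_distrib,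
    ← Finset.mul_sum, ← Finset.mul_sum, ← Finset.mul_sum, ← lap, ← lap, ← gradDot, ← gradDot]
  ring

theorem gradDot_exp_mul (hψ : ContDiff ℝ ∞ ψ) (hu : ContDiff ℝ ∞ u) (h : ℝ) (x : RSpace n) :
    gradDot ψ (fun y => Real.exp (-ψ y / h) * u y) x = Real.exp (-ψ x / h) *
      (gradDot ψ u x - u x * gradDot ψ ψ x / h) := by
  simp_rw [gradDot, pd_exp_mul hψ hu, Finset.mul_sum, Finset.sum_div]
  rw [← Finset.sum_sub_distrib, Finset.mul_sum]
  exact Finset.sum_congr rfl fun i _ => by ring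

theorem gradDot_exp_mul_self (hψ : ContDiff ℝ ∞ ψ) (hu : ContDiff ℝ ∞ u) (h : ℝ) (x : RSpace n) :
    gradDot (fun y => Real.exp (-ψ y / h) * u y) (fun y => Real.exp (-ψ y / h) * u y) x =
      Real.exp (-ψ x / h) ^ 2 * (gradDot u u x - 2 * u x * gradDot ψ u x / h
        + u x ^ 2 * gradDot ψ ψ x / h ^ 2) := by
  simp_rw [gradDot, pd_exp_mul hψ hu, Finset.mul_sum, Finset.sum_div]
  rw [← Finset.sum_sub_distrib, ← Finset.sum_add_distrib, Finset.mul_sum]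
  exact Finset.sum_congr rfl fun i _ => by ring

/-- Conjugation of the semiclassical Laplacian by the weight. -/
theorem conjugated_lap (hψ : ContDiff ℝ ∞ ψ) (hu : ContDiff ℝ ∞ u) {h : ℝ} (h0 : h ≠ 0)
    (x : RSpace n) (hv : v = fun y => Real.exp (-ψ y / h) * u y) :
    h ^ 2 * lap v x + gradDot ψ ψ x * v x + 2 * h * gradDot ψ v x + h * lap ψ x * v x =
      Real.exp (-ψ x / h) * (h ^ 2 * lap u x) := by
  rw [hv, lap_exp_mul hψ hu, gradDot_exp_mul hψ hu]
  field_simp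
  ring

end Weight

/-! ### The Carleman estimate with boundary terms for smooth functions -/

section Smooth

variable {n : ℕ} {Ω : Set (RSpace n)} {φ κ u : RSpace n → ℝ} {m : ℝ}

theorem abs_sum_mul_le_of_norm_eq_one {ν : RSpace n} (hν : ‖ν‖ = 1) (a : Fin n → ℝ) :
    |∑ i, ν i * a i| ≤ ∑ i, |a i| := by
  refine (Finset.abs_sum_le_sum_abs _ _).trans (Finset.sum_le_sum fun i _ => ?_)
  rw [abs_mul]
  have : |ν i| ≤ 1 := by simpa [hν] using PiLp.norm_apply_le ν i
  exact mul_le_of_le_one_left (abs_nonneg _) this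

/-- Pythagoras' theorem for the tangential and the normal component of a real vector. -/
theorem sum_sq_sub_normal {ν : RSpace n} (hν : ‖ν‖ = 1) (a : Fin n → ℝ) :
    ∑ i, (a i - (∑ j, ν j * a j) * ν i) ^ 2 = ∑ i, a i * a i - (∑ j, ν j * a j) ^ 2 := by
  have h1 : ∑ i, ν i ^ 2 = 1 := by
    have := EuclideanSpace.real_norm_sq_eq ν
    rw [hν] at this; simpa using this.symm
  set p := ∑ j, ν j * a j with hp
  have : ∀ i, (a i - p * ν i) ^ 2 = a i * a i - 2 * p * (ν i * a i) + p ^ 2 * ν i ^ 2 :=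
    fun i => by ring
  simp_rw [this]
  rw [Finset.sum_add_distrib, Finset.sum_sub_distrib, ← Finset.mul_sum, ← Finset.mul_sum, h1, ← hp]
  ring

/-- The boundary flux in the Carleman identity for a real function, in terms of its normal
derivative and the length of its tangential gradient. -/
theorem flux_estimate (hφ : ContDiff ℝ ∞ φ) (hκ : ContDiff ℝ ∞ κ) {h τ K : ℝ} (h0 : 0 < h)
    (h1 : h ≤ 1) (hK : 0 < K) {x ν : RSpace n} (hB : CoeffBound φ κ m τ K x) (hν : ‖ν‖ = 1)
    (hu : ContDiff ℝ ∞ u) {p t : ℝ} (hp : p = ∑ i, ν i * classicalPartial i u x)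
    (ht : t = √(∑ i, (classicalPartial i u x - p * ν i) ^ 2)) :
    Real.exp (-convexWeight φ τ x / h) ^ 2 *
        (2 * h ^ 3 * (∑ i, ν i * classicalPartial i (convexWeight φ τ) x) * p ^ 2 -
          (4 * K ^ 3 + 4 * K ^ 2 + 4 * K) *
          (h * u x ^ 2 + h ^ 2 * (|u x| * |p|) + h ^ 3 * t ^ 2 + h ^ 3 * (t * |p|))) ≤
      ∑ i, carlemanField h (convexWeight φ τ) (fun y => h * multiplier φ κ m τ y)
        (fun y => Real.exp (-convexWeight φ τ y / h) * u y) i x * ν i := by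
  have hψ := contDiff_convexWeight hφ τ
  have hG := contDiff_multiplier hφ hκ m τ
  have ht0 : 0 ≤ t := ht ▸ Real.sqrt_nonneg _
  have ht2 : t ^ 2 = ∑ i, (classicalPartial i u x - p * ν i) ^ 2 := by
    rw [ht, Real.sq_sqrt (Finset.sum_nonneg fun _ _ => sq_nonneg _)]
  set w := ∑ i, classicalPartial i (convexWeight φ τ) x * (classicalPartial i u x - p * ν i)
    with hw
  set Xν := ∑ i, ν i * classicalPartial i (convexWeight φ τ) x with hX
  have hwt : |w| ≤ K * t := by
    refine (Finset.abs_sum_le_sum_abs _ _).trans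
      (le_trans ?_ (mul_le_mul_of_nonneg_right hB.grad_weight ht0))
    rw [Finset.sum_mul]
    refine Finset.sum_le_sum fun i _ => ?_
    rw [abs_mul]
    refine mul_le_mul_of_nonneg_left ?_ (abs_nonneg _)
    refine abs_le_of_sq_le_sq ?_ ht0
    rw [ht2]
    exact Finset.single_le_sum (f := fun i => (classicalPartial i u x - p * ν i) ^ 2)
      (fun _ _ => sq_nonneg _) (Finset.mem_univ i)
  have hQ : |gradDot (convexWeight φ τ) (convexWeight φ τ) x| ≤ K ^ 2 := by
    rw [abs_of_nonneg (gradDot_self_nonneg _ _), gradDot, sq]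
    refine le_trans ?_ (mul_le_mul_of_nonneg_right hB.grad_weight hK.le)
    rw [Finset.sum_mul]
    refine Finset.sum_le_sum fun i hi => ?_
    rw [← abs_mul_abs_self]
    exact mul_le_mul_of_nonneg_left ((Finset.single_le_sum
      (f := fun i => |classicalPartial i (convexWeight φ τ) x|)
      (fun _ _ => abs_nonneg _) hi).trans hB.grad_weight) (abs_nonneg _)
  have hgi : ∀ i, classicalPartial i (fun y => h * multiplier φ κ m τ y) x =
      h * classicalPartial i (multiplier φ κ m τ) x := fun i => pd_const_mul hG i x h
  have hgν : |∑ i, ν i * classicalPartial i (fun y => h * multiplier φ κ m τ y) x| ≤ K * h := by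
    refine (abs_sum_mul_le_of_norm_eq_one hν _).trans ?_
    simp_rw [hgi, abs_mul, abs_of_pos h0]
    rw [← Finset.mul_sum, mul_comm]
    exact mul_le_mul_of_nonneg_right hB.grad_mult h0.le
  have hS : gradDot (convexWeight φ τ) u x = Xν * p + w := by
    rw [hw, hX, Finset.sum_mul, ← Finset.sum_add_distrib, gradDot]
    exact Finset.sum_congr rfl fun i _ => by ring
  have hN : gradDot u u x = p ^ 2 + t ^ 2 := by
    rw [ht2, hp, sum_sq_sub_normal hν, gradDot]; ring
  have key := flux_lower_bound (p := p) (u := u x) (w := w) (Xν := Xν)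
    (Q := gradDot (convexWeight φ τ) (convexWeight φ τ) x) h0 h1 hK.le ht0 hwt
    ((abs_sum_mul_le_of_norm_eq_one hν _).trans hB.grad_weight) hQ hB.lap_weight
    ((abs_sum_mul_le_of_norm_eq_one hν _).trans hB.grad_lap_weight)
    (show |h * multiplier φ κ m τ x| ≤ K * h by
      rw [abs_mul, abs_of_pos h0, mul_comm]; gcongr; exact hB.mult) hgν
  refine (mul_le_mul_of_nonneg_left key (sq_nonneg _)).trans_eq ?_
  have hvν : ∑ i, ν i * classicalPartial i (fun y => Real.exp (-convexWeight φ τ y / h) * u y) x =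
      Real.exp (-convexWeight φ τ x / h) * (p - u x * Xν / h) := by
    simp_rw [pd_exp_mul hψ hu, hp, hX, Finset.mul_sum, Finset.sum_div]
    rw [← Finset.sum_sub_distrib, Finset.mul_sum]
    exact Finset.sum_congr rfl fun i _ => by ring
  set v := fun y => Real.exp (-convexWeight φ τ y / h) * u y with hv
  have hF : ∑ i, carlemanField h (convexWeight φ τ) (fun y => h * multiplier φ κ m τ y) v i x * ν i =
      4 * h ^ 3 * gradDot (convexWeight φ τ) v x * (∑ i, ν i * classicalPartial i v x)
      - 2 * h ^ 3 * gradDot v v x * Xν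
      + (2 * h ^ 3 * lap (convexWeight φ τ) x + h ^ 2 * (h * multiplier φ κ m τ x)) * v x *
        (∑ i, ν i * classicalPartial i v x)
      - h ^ 3 * v x ^ 2 * (∑ i, ν i * classicalPartial i (lap (convexWeight φ τ)) x)
      + 2 * h * gradDot (convexWeight φ τ) (convexWeight φ τ) x * v x ^ 2 * Xν
      - h ^ 2 / 2 * v x ^ 2 *
        (∑ i, ν i * classicalPartial i (fun y => h * multiplier φ κ m τ y) x) := by
    simp_rw [hX, Finset.mul_sum, carlemanField]
    rw [← Finset.sum_sub_distrib, ← Finset.sum_add_distrib, ← Finset.sum_sub_distrib,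
      ← Finset.sum_add_distrib, ← Finset.sum_sub_distrib]
    exact Finset.sum_congr rfl fun i _ => by ring
  rw [hF, hvν, gradDot_exp_mul hψ hu, gradDot_exp_mul_self hψ hu, hS, hN,
    show v x = Real.exp (-convexWeight φ τ x / h) * u x from rfl]
  ring

/-- The normal component `ν · G` of a complex vector. -/
def normalPart (ν : RSpace n) (G : CSpace n) : ℂ := ∑ j, (ν j : ℂ) * G j

/-- The tangential part `G - (ν · G) ν` of a complex vector. -/
def tangentialPart (ν : RSpace n) (G : CSpace n) : CSpace n :=
  WithLp.toLp 2 fun j => G j - normalPart ν G * (ν j : ℂ)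

/-- The classical gradient of a complex function. -/
def gradC (W : RSpace n → ℂ) (x : RSpace n) : CSpace n :=
  WithLp.toLp 2 fun j => classicalPartial j W x

/-- The classical Laplacian of a complex function. -/
def lapC (W : RSpace n → ℂ) (x : RSpace n) : ℂ := ∑ j, classicalPartial j (classicalPartial j W) x

/-- The Cauchy–Schwarz inequality in the plane, for vectors of prescribed lengths. -/
theorem mul_add_mul_le_of_sq {a b c d A B : ℝ} (hA : 0 ≤ A) (hB : 0 ≤ B)
    (h1 : a ^ 2 + c ^ 2 = A ^ 2) (h2 : b ^ 2 + d ^ 2 = B ^ 2) : a * b + c * d ≤ A * B := by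
  refine abs_le_of_sq_le_sq' ?_ (by positivity) |>.2
  rw [mul_pow, ← h1, ← h2]
  nlinarith [sq_nonneg (a * d - b * c)]

theorem norm_sq_eq_re_im (z : ℂ) : ‖z‖ ^ 2 = z.re ^ 2 + z.im ^ 2 := by
  rw [Complex.sq_norm, Complex.normSq_apply]; ring

variable {W : RSpace n → ℂ}

theorem contDiff_re (hW : ContDiff ℝ ∞ W) : ContDiff ℝ ∞ fun x => (W x).re :=
  Complex.reCLM.contDiff.comp hW

theorem contDiff_im (hW : ContDiff ℝ ∞ W) : ContDiff ℝ ∞ fun x => (W x).im :=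
  Complex.imCLM.contDiff.comp hW

/-- The boundary flux in the Carleman identity for a complex function. -/
theorem flux_estimate_complex (hφ : ContDiff ℝ ∞ φ) (hκ : ContDiff ℝ ∞ κ) {h τ K : ℝ} (h0 : 0 < h)
    (h1 : h ≤ 1) (hK : 0 < K) {x ν : RSpace n} (hB : CoeffBound φ κ m τ K x) (hν : ‖ν‖ = 1)
    (hW : ContDiff ℝ ∞ W) {P : ℂ} {T : CSpace n} (hP : P = normalPart ν (gradC W x))
    (hT : T = tangentialPart ν (gradC W x)) :
    Real.exp (-convexWeight φ τ x / h) ^ 2 *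
        (2 * h ^ 3 * (∑ i, ν i * classicalPartial i (convexWeight φ τ) x) * ‖P‖ ^ 2 -
          (4 * K ^ 3 + 4 * K ^ 2 + 4 * K) * (h * ‖W x‖ ^ 2 + h ^ 2 * (‖W x‖ * ‖P‖) +
            h ^ 3 * ‖T‖ ^ 2 + h ^ 3 * (‖T‖ * ‖P‖))) ≤
      ∑ i, (carlemanField h (convexWeight φ τ) (fun y => h * multiplier φ κ m τ y)
          (fun y => Real.exp (-convexWeight φ τ y / h) * (W y).re) i x +
        carlemanField h (convexWeight φ τ) (fun y => h * multiplier φ κ m τ y)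
          (fun y => Real.exp (-convexWeight φ τ y / h) * (W y).im) i x) * ν i := by
  have hW1 : ContDiff ℝ 1 W := hW.of_le (by exact_mod_cast le_top)
  have hr (i : Fin n) := classicalPartial_re hW1 i x
  have hi (i : Fin n) := classicalPartial_im hW1 i x
  have hPr : P.re = ∑ i, ν i * classicalPartial i (fun y => (W y).re) x := by
    rw [hP, normalPart, Complex.re_sum]
    exact Finset.sum_congr rfl fun i _ => by rw [hr]; simp [gradC]
  have hPi : P.im = ∑ i, ν i * classicalPartial i (fun y => (W y).im) x := by
    rw [hP, normalPart, Complex.im_sum]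
    exact Finset.sum_congr rfl fun i _ => by rw [hi]; simp [gradC]
  have k1 := flux_estimate hφ hκ h0 h1 hK hB hν (contDiff_re hW) hPr rfl
  have k2 := flux_estimate hφ hκ h0 h1 hK hB hν (contDiff_im hW) hPi rfl
  set tr := √(∑ i, (classicalPartial i (fun y => (W y).re) x - P.re * ν i) ^ 2) with htr
  set ti := √(∑ i, (classicalPartial i (fun y => (W y).im) x - P.im * ν i) ^ 2) with hti
  have htr2 : tr ^ 2 = ∑ i, (classicalPartial i (fun y => (W y).re) x - P.re * ν i) ^ 2 :=
    Real.sq_sqrt (Finset.sum_nonneg fun _ _ => sq_nonneg _)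
  have hti2 : ti ^ 2 = ∑ i, (classicalPartial i (fun y => (W y).im) x - P.im * ν i) ^ 2 :=
    Real.sq_sqrt (Finset.sum_nonneg fun _ _ => sq_nonneg _)
  have hT2 : ‖T‖ ^ 2 = tr ^ 2 + ti ^ 2 := by
    rw [htr2, hti2, ← Finset.sum_add_distrib, EuclideanSpace.norm_sq_eq]
    refine Finset.sum_congr rfl fun i _ => ?_
    rw [norm_sq_eq_re_im, hT, hr, hi, tangentialPart, ← hP]
    simp [gradC]
  have hP2 := norm_sq_eq_re_im P
  have hW2 := norm_sq_eq_re_im (W x)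
  have c1 : |(W x).re| * |P.re| + |(W x).im| * |P.im| ≤ ‖W x‖ * ‖P‖ :=
    mul_add_mul_le_of_sq (norm_nonneg _) (norm_nonneg _) (by simp [hW2]) (by simp [hP2])
  have c2 : tr * |P.re| + ti * |P.im| ≤ ‖T‖ * ‖P‖ :=
    mul_add_mul_le_of_sq (norm_nonneg _) (norm_nonneg _) hT2.symm (by simp [hP2])
  simp_rw [add_mul]
  rw [Finset.sum_add_distrib]
  refine le_trans ?_ (add_le_add k1 k2)
  rw [← mul_add]
  refine mul_le_mul_of_nonneg_left ?_ (sq_nonneg _)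
  set C := 4 * K ^ 3 + 4 * K ^ 2 + 4 * K with hC
  have hC0 : 0 ≤ C := by positivity
  have d1 := mul_le_mul_of_nonneg_left c1 (show 0 ≤ C * h ^ 2 by positivity)
  have d2 := mul_le_mul_of_nonneg_left c2 (show 0 ≤ C * h ^ 3 by positivity)
  rw [hP2, hW2, hT2]
  linarith only [d1, d2]

/-- The pointwise Carleman estimate in terms of `u`. Since `e^{-ψ/h} h ∇u = h ∇v + v ∇ψ`, passing from
`v` to `u` costs the factor `2 + 2 K²`. -/
theorem IsWeightPair.pointwise_estimate_real (hd : IsWeightPair Ω φ κ m) {h ε τ K c : ℝ}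
    (h0 : 0 < h) (h1 : h ≤ 1) (hε : 0 < ε) (hτ : τ = h / ε) (hK : 0 < K) (hc : 0 ≤ c)
    (hu : ContDiff ℝ ∞ u) {x : RSpace n} (hx : x ∈ closure Ω) (hτφ : τ * φ x ≤ 1 / 2)
    (hB : CoeffBound φ κ m τ K x)
    (hε₁ : 6 * K / m ^ 2 ≤ m / ε - c / ε)
    (hε₂ : 3 * K ^ 2 + 2 * K ≤ 3 / 4 * m ^ 2 / ε - c / ε) :
    c / ε * h ^ 2 * (Real.exp (-convexWeight φ τ x / h) ^ 2 *
        (h ^ 2 * gradDot u u x + u x ^ 2)) / (2 + 2 * K ^ 2) ≤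
      (Real.exp (-convexWeight φ τ x / h) * (h ^ 2 * lap u x)) ^ 2
      - ∑ i, classicalPartial i
          (carlemanField h (convexWeight φ τ) (fun y => h * multiplier φ κ m τ y)
            (fun y => Real.exp (-convexWeight φ τ y / h) * u y) i) x := by
  have hψ := contDiff_convexWeight hd.smooth τ
  have key := hd.pointwise_estimate h0 h1 hε hτ hK (contDiff_exp_mul hψ hu h) hx hτφ hB hε₁ hε₂
  rw [conjugated_lap hψ hu h0.ne' x rfl] at key
  refine le_trans ?_ key
  rw [div_le_iff₀ (by positivity), mul_assoc (c / ε * h ^ 2)]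
  refine mul_le_mul_of_nonneg_left ?_ (by positivity)
  have hQ : gradDot (convexWeight φ τ) (convexWeight φ τ) x ≤ K ^ 2 := by
    rw [gradDot, sq]
    refine le_trans ?_ (mul_le_mul_of_nonneg_right hB.grad_weight hK.le)
    rw [Finset.sum_mul]
    refine Finset.sum_le_sum fun i hi => ?_
    rw [← abs_mul_abs_self]
    exact mul_le_mul_of_nonneg_left ((Finset.single_le_sum
      (f := fun i => |classicalPartial i (convexWeight φ τ) x|)
      (fun _ _ => abs_nonneg _) hi).trans hB.grad_weight) (abs_nonneg _)
  set E := Real.exp (-convexWeight φ τ x / h) with hE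
  set v := fun y => Real.exp (-convexWeight φ τ y / h) * u y with hv
  have hvx : v x = E * u x := rfl
  have hi : ∀ i, E ^ 2 * (h ^ 2 * (classicalPartial i u x * classicalPartial i u x)) ≤
      2 * (h ^ 2 * (classicalPartial i v x * classicalPartial i v x)) +
        2 * v x ^ 2 * (classicalPartial i (convexWeight φ τ) x *
          classicalPartial i (convexWeight φ τ) x) := by
    intro i
    have e : E * (h * classicalPartial i u x) =
        h * classicalPartial i v x + v x * classicalPartial i (convexWeight φ τ) x := by
      rw [hvx, hv, pd_exp_mul hψ hu, ← hE]; field_simp; ring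
    have : E ^ 2 * (h ^ 2 * (classicalPartial i u x * classicalPartial i u x)) =
        (E * (h * classicalPartial i u x)) ^ 2 := by ring
    rw [this, e]
    nlinarith [sq_nonneg (h * classicalPartial i v x -
      v x * classicalPartial i (convexWeight φ τ) x)]
  have hs := Finset.sum_le_sum fun i (_ : i ∈ Finset.univ) => hi i
  rw [Finset.sum_add_distrib, ← Finset.mul_sum, ← Finset.mul_sum, ← Finset.mul_sum,
    ← Finset.mul_sum, ← Finset.mul_sum, ← gradDot, ← gradDot, ← gradDot] at hs
  have h2 : v x ^ 2 * gradDot (convexWeight φ τ) (convexWeight φ τ) x ≤ v x ^ 2 * K ^ 2 := by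
    gcongr
  have h3 : 0 ≤ K ^ 2 * (h ^ 2 * gradDot v v x) :=
    mul_nonneg (sq_nonneg _) (mul_nonneg (sq_nonneg _) (gradDot_self_nonneg _ _))
  have h4 : E ^ 2 * u x ^ 2 = v x ^ 2 := by rw [hvx]; ring
  nlinarith only [hs, h2, h3, h4, sq_nonneg (v x)]

/-- The pointwise Carleman estimate for complex functions: the weight is real, so the estimates for
the real and the imaginary part add up. -/
theorem IsWeightPair.pointwise_estimate_complex (hd : IsWeightPair Ω φ κ m) {h ε τ K c : ℝ}
    (h0 : 0 < h) (h1 : h ≤ 1) (hε : 0 < ε) (hτ : τ = h / ε) (hK : 0 < K) (hc : 0 ≤ c)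
    (hW : ContDiff ℝ ∞ W) {x : RSpace n} (hx : x ∈ closure Ω) (hτφ : τ * φ x ≤ 1 / 2)
    (hB : CoeffBound φ κ m τ K x)
    (hε₁ : 6 * K / m ^ 2 ≤ m / ε - c / ε)
    (hε₂ : 3 * K ^ 2 + 2 * K ≤ 3 / 4 * m ^ 2 / ε - c / ε) :
    c / ε * h ^ 2 * (Real.exp (-convexWeight φ τ x / h) ^ 2 *
        (h ^ 2 * ‖gradC W x‖ ^ 2 + ‖W x‖ ^ 2)) / (2 + 2 * K ^ 2) ≤
      h ^ 4 * (Real.exp (-convexWeight φ τ x / h) ^ 2 * ‖lapC W x‖ ^ 2)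
      - ∑ i, classicalPartial i (fun y =>
          carlemanField h (convexWeight φ τ) (fun y => h * multiplier φ κ m τ y)
            (fun y => Real.exp (-convexWeight φ τ y / h) * (W y).re) i y +
          carlemanField h (convexWeight φ τ) (fun y => h * multiplier φ κ m τ y)
            (fun y => Real.exp (-convexWeight φ τ y / h) * (W y).im) i y) x := by
  have hψ := contDiff_convexWeight hd.smooth τ
  have hG := contDiff_multiplier hd.smooth hd.smooth_curvature m τ
  have hre := contDiff_re hW
  have him := contDiff_im hW
  have hW1 : ContDiff ℝ 1 W := hW.of_le (by exact_mod_cast le_top)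
  have hWj (j : Fin n) : ContDiff ℝ 1 (classicalPartial j W) :=
    (contDiff_classicalPartial hW j).of_le (by exact_mod_cast le_top)
  have k1 := hd.pointwise_estimate_real h0 h1 hε hτ hK hc hre hx hτφ hB hε₁ hε₂
  have k2 := hd.pointwise_estimate_real h0 h1 hε hτ hK hc him hx hτφ hB hε₁ hε₂
  have e1 : ‖gradC W x‖ ^ 2 = gradDot (fun y => (W y).re) (fun y => (W y).re) x +
      gradDot (fun y => (W y).im) (fun y => (W y).im) x := by
    rw [EuclideanSpace.norm_sq_eq, gradDot, gradDot, ← Finset.sum_add_distrib]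
    refine Finset.sum_congr rfl fun i _ => ?_
    rw [norm_sq_eq_re_im, classicalPartial_re hW1, classicalPartial_im hW1, gradC]
    ring
  have e2 : ‖lapC W x‖ ^ 2 = lap (fun y => (W y).re) x ^ 2 + lap (fun y => (W y).im) x ^ 2 := by
    rw [norm_sq_eq_re_im, lapC, Complex.re_sum, Complex.im_sum, lap, lap]
    congr 2
    · refine Finset.sum_congr rfl fun i _ => ?_
      rw [show classicalPartial i (fun y => (W y).re) = fun y => (classicalPartial i W y).re from
        funext fun y => classicalPartial_re hW1 i y, classicalPartial_re (hWj i)]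
    · refine Finset.sum_congr rfl fun i _ => ?_
      rw [show classicalPartial i (fun y => (W y).im) = fun y => (classicalPartial i W y).im from
        funext fun y => classicalPartial_im hW1 i y, classicalPartial_im (hWj i)]
  rw [Finset.sum_congr rfl fun i _ => pd_add (contDiff_carlemanField (h := h) hψ (contDiff_const.mul hG)
    (contDiff_exp_mul hψ hre h) i) (contDiff_carlemanField (h := h) hψ (contDiff_const.mul hG)
    (contDiff_exp_mul hψ him h) i) i x]
  rw [Finset.sum_add_distrib, e1, e2, norm_sq_eq_re_im (W x)]
  have := add_le_add k1 k2
  refine le_trans (le_of_eq ?_) (this.trans_eq ?_) <;> ring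

end Smooth

/-! ### The integrated estimate for smooth functions -/

section SmoothIntegrated

variable {n : ℕ} {Ω : Set (RSpace n)} {φ κ : RSpace n → ℝ} {m : ℝ} {W : RSpace n → ℂ}

theorem continuous_gradC (hW : ContDiff ℝ ∞ W) : Continuous (gradC W) :=
  (PiLp.continuous_toLp 2 _).comp
    (continuous_pi fun j => (contDiff_classicalPartial hW j).continuous)

theorem continuous_lapC (hW : ContDiff ℝ ∞ W) : Continuous (lapC W) :=
  continuous_finsetSum _ fun j _ =>
    (contDiff_classicalPartial (contDiff_classicalPartial hW j) j).continuous

theorem continuous_normalPart : Continuous fun p : RSpace n × CSpace n => normalPart p.1 p.2 := by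
  unfold normalPart
  fun_prop

theorem continuous_tangentialPart :
    Continuous fun p : RSpace n × CSpace n => tangentialPart p.1 p.2 := by
  have := continuous_normalPart (n := n)
  unfold tangentialPart
  refine (PiLp.continuous_toLp 2 _).comp (continuous_pi fun j => ?_)
  fun_prop

theorem ContinuousOn.normalPart {s : Set (RSpace n)} {N : RSpace n → RSpace n}
    {G : RSpace n → CSpace n} (hN : ContinuousOn N s) (hG : ContinuousOn G s) :
    ContinuousOn (fun x => normalPart (N x) (G x)) s :=
  continuous_normalPart.comp_continuousOn (f := fun x => (N x, G x)) (hN.prodMk hG)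

theorem ContinuousOn.tangentialPart {s : Set (RSpace n)} {N : RSpace n → RSpace n}
    {G : RSpace n → CSpace n} (hN : ContinuousOn N s) (hG : ContinuousOn G s) :
    ContinuousOn (fun x => tangentialPart (N x) (G x)) s :=
  continuous_tangentialPart.comp_continuousOn (f := fun x => (N x, G x)) (hN.prodMk hG)

/-- The divergence theorem for a smooth vector field. -/
theorem setIntegral_div_eq (hΩ : IsOpen Ω) (hbd : Bornology.IsBounded Ω) (hb : HasC2Boundary Ω)
    {X : Fin n → RSpace n → ℝ} (hX : ∀ i, ContDiff ℝ ∞ (X i)) :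
    ∫ y in Ω, ∑ i, classicalPartial i (X i) y =
      ∫ y, ∑ i, X i y * outerNormal Ω y i ∂surfaceMeasure Ω := by
  have hN := continuousOn_outerNormal hΩ hb
  rw [integral_finsetSum _ fun i _ => integrableOn_of_continuousOn hΩ hbd
      (contDiff_classicalPartial (hX i) i).continuous.continuousOn,
    integral_finsetSum _ fun i _ => integrable_surfaceMeasure hΩ hbd hb ?_]
  · refine Finset.sum_congr rfl fun i _ => ?_
    have := setIntegral_fderiv_eq hΩ hbd hb ((hX i).of_le (by exact_mod_cast le_top) :
      ContDiff ℝ 1 (X i)) (EuclideanSpace.single i 1)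
    simp only [EuclideanSpace.inner_single_right] at this
    simpa [classicalPartial] using this
  · have := (hX i).continuous
    have h2 : ContinuousOn (fun y => outerNormal Ω y i) (frontier Ω) := by fun_prop
    exact this.continuousOn.mul h2

/-- The Carleman estimate with boundary terms, for smooth functions and the convexified weight. -/
theorem IsWeightPair.carleman_smooth (hΩ : IsOpen Ω) (hbd : Bornology.IsBounded Ω)
    (hb : HasC2Boundary Ω) (hd : IsWeightPair Ω φ κ m) {h ε τ K c : ℝ}
    (h0 : 0 < h) (h1 : h ≤ 1) (hε : 0 < ε) (hτ : τ = h / ε) (hK : 0 < K) (hc : 0 ≤ c)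
    (hτφ : ∀ x ∈ closure Ω, τ * φ x ≤ 1 / 2)
    (hB : ∀ x ∈ closure Ω, CoeffBound φ κ m τ K x)
    (hε₁ : 6 * K / m ^ 2 ≤ m / ε - c / ε)
    (hε₂ : 3 * K ^ 2 + 2 * K ≤ 3 / 4 * m ^ 2 / ε - c / ε)
    (hW : ContDiff ℝ ∞ W) {w b : RSpace n → ℝ}
    (hw : w = fun x => Real.exp (-convexWeight φ τ x / h) ^ 2)
    (hbν : b = fun x => ∑ i, outerNormal Ω x i * classicalPartial i (convexWeight φ τ) x)
    {P : RSpace n → ℂ} {T : RSpace n → CSpace n}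
    (hP : P = fun x => normalPart (outerNormal Ω x) (gradC W x))
    (hT : T = fun x => tangentialPart (outerNormal Ω x) (gradC W x)) :
    c / ε * h ^ 2 / (2 + 2 * K ^ 2) *
        (h ^ 2 * (∫ x in Ω, w x * ‖gradC W x‖ ^ 2) + ∫ x in Ω, w x * ‖W x‖ ^ 2) +
        2 * h ^ 3 * (∫ x, w x * b x * ‖P x‖ ^ 2 ∂surfaceMeasure Ω) ≤
      h ^ 4 * (∫ x in Ω, w x * ‖lapC W x‖ ^ 2) + (4 * K ^ 3 + 4 * K ^ 2 + 4 * K) *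
        (h * (∫ x, w x * ‖W x‖ ^ 2 ∂surfaceMeasure Ω) +
          h ^ 2 * (∫ x, w x * (‖W x‖ * ‖P x‖) ∂surfaceMeasure Ω) +
          h ^ 3 * (∫ x, w x * ‖T x‖ ^ 2 ∂surfaceMeasure Ω) +
          h ^ 3 * (∫ x, w x * (‖T x‖ * ‖P x‖) ∂surfaceMeasure Ω)) := by
  have hψ := contDiff_convexWeight hd.smooth τ
  have hG := contDiff_multiplier hd.smooth hd.smooth_curvature m τ
  have hGh : ContDiff ℝ ∞ fun y => h * multiplier φ κ m τ y := contDiff_const.mul hG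
  have hN := continuousOn_outerNormal hΩ hb
  have hwc : Continuous w := by
    have := hψ.continuous
    rw [hw]; fun_prop
  have hbc : ContinuousOn b (frontier Ω) := by
    rw [hbν]
    refine continuousOn_finsetSum _ fun i _ => ?_
    have h2 : ContinuousOn (fun y => outerNormal Ω y i) (frontier Ω) := by fun_prop
    exact h2.mul (contDiff_classicalPartial hψ i).continuous.continuousOn
  have hgc := continuous_gradC hW
  have hlc := continuous_lapC hW
  have hWc := hW.continuous
  have hPc : ContinuousOn P (frontier Ω) := by
    rw [hP]
    exact ContinuousOn.normalPart hN hgc.continuousOn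
  have hTc : ContinuousOn T (frontier Ω) := by
    rw [hT]
    exact ContinuousOn.tangentialPart hN hgc.continuousOn
  obtain ⟨X, hXdef⟩ : ∃ X : Fin n → RSpace n → ℝ, X = fun i y =>
    carlemanField h (convexWeight φ τ) (fun y => h * multiplier φ κ m τ y)
      (fun y => Real.exp (-convexWeight φ τ y / h) * (W y).re) i y +
    carlemanField h (convexWeight φ τ) (fun y => h * multiplier φ κ m τ y)
      (fun y => Real.exp (-convexWeight φ τ y / h) * (W y).im) i y := ⟨_, rfl⟩
  have hX : ∀ i, ContDiff ℝ ∞ (X i) := fun i => by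
    have h1 := contDiff_carlemanField (h := h) hψ hGh (contDiff_exp_mul hψ (contDiff_re hW) h) i
    have h2 := contDiff_carlemanField (h := h) hψ hGh (contDiff_exp_mul hψ (contDiff_im hW) h) i
    rw [hXdef]
    exact ContDiff.add h1 h2
  have iV : ∀ {f : RSpace n → ℝ}, Continuous f → IntegrableOn f Ω := fun hf =>
    integrableOn_of_continuousOn hΩ hbd hf.continuousOn
  have iS : ∀ {f : RSpace n → ℝ}, ContinuousOn f (frontier Ω) → Integrable f (surfaceMeasure Ω) :=
    fun hf => integrable_surfaceMeasure hΩ hbd hb hf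
  have i1 : IntegrableOn (fun x => w x * ‖gradC W x‖ ^ 2) Ω := iV (by fun_prop)
  have i2 : IntegrableOn (fun x => w x * ‖W x‖ ^ 2) Ω := iV (by fun_prop)
  have i3 : IntegrableOn (fun x => w x * ‖lapC W x‖ ^ 2) Ω := iV (by fun_prop)
  have hdiv : Continuous fun x => ∑ i, classicalPartial i (X i) x :=
    continuous_finsetSum _ fun i _ => (contDiff_classicalPartial (hX i) i).continuous
  have i4 : IntegrableOn (fun x => ∑ i, classicalPartial i (X i) x) Ω := iV hdiv
  have hwc' : ContinuousOn w (frontier Ω) := hwc.continuousOn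
  have hWc' : ContinuousOn W (frontier Ω) := hWc.continuousOn
  have s0 : Integrable (fun x => w x * b x * ‖P x‖ ^ 2) (surfaceMeasure Ω) := iS (by fun_prop)
  have s1 : Integrable (fun x => w x * ‖W x‖ ^ 2) (surfaceMeasure Ω) := iS (by fun_prop)
  have s2 : Integrable (fun x => w x * (‖W x‖ * ‖P x‖)) (surfaceMeasure Ω) := iS (by fun_prop)
  have s3 : Integrable (fun x => w x * ‖T x‖ ^ 2) (surfaceMeasure Ω) := iS (by fun_prop)
  have s4 : Integrable (fun x => w x * (‖T x‖ * ‖P x‖)) (surfaceMeasure Ω) := iS (by fun_prop)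
  have s5 : Integrable (fun x => ∑ i, X i x * outerNormal Ω x i) (surfaceMeasure Ω) :=
    iS (continuousOn_finsetSum _ fun i _ => by
      have h2 : ContinuousOn (fun y => outerNormal Ω y i) (frontier Ω) := by fun_prop
      exact (hX i).continuous.continuousOn.mul h2)
  have vol := setIntegral_mono_on (s := Ω)
    (f := fun x => c / ε * h ^ 2 / (2 + 2 * K ^ 2) *
      (h ^ 2 * (w x * ‖gradC W x‖ ^ 2) + w x * ‖W x‖ ^ 2))
    (g := fun x => h ^ 4 * (w x * ‖lapC W x‖ ^ 2) - ∑ i, classicalPartial i (X i) x)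
    (iV (by fun_prop)) (iV (by fun_prop)) hΩ.measurableSet
    (fun x hx => by
      have := hd.pointwise_estimate_complex h0 h1 hε hτ hK hc hW (subset_closure hx)
        (hτφ x (subset_closure hx)) (hB x (subset_closure hx)) hε₁ hε₂
      simp only [hw, hXdef]
      refine le_trans (le_of_eq ?_) this
      ring)
  rw [integral_const_mul, integral_add (i1.const_mul _) i2, integral_const_mul,
    integral_sub (i3.const_mul _) i4, integral_const_mul, setIntegral_div_eq hΩ hbd hb hX] at vol
  have bd := integral_mono_ae (μ := surfaceMeasure Ω)
    (f := fun x => 2 * h ^ 3 * (w x * b x * ‖P x‖ ^ 2) - (4 * K ^ 3 + 4 * K ^ 2 + 4 * K) *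
      (h * (w x * ‖W x‖ ^ 2) + h ^ 2 * (w x * (‖W x‖ * ‖P x‖)) + h ^ 3 * (w x * ‖T x‖ ^ 2) +
        h ^ 3 * (w x * (‖T x‖ * ‖P x‖))))
    (g := fun x => ∑ i, X i x * outerNormal Ω x i)
    (iS (by fun_prop)) s5 (by
      filter_upwards [ae_surfaceMeasure_mem_frontier (Ω := Ω)] with x hx
      have := flux_estimate_complex (W := W) hd.smooth hd.smooth_curvature h0 h1 hK
        (hB x (frontier_subset_closure hx)) (norm_outerNormal hΩ hb hx) hW rfl rfl
      simp only [hw, hbν, hP, hT, hXdef]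
      refine le_trans (le_of_eq ?_) this
      ring)
  rw [integral_sub (s0.const_mul _) (iS (by fun_prop)), integral_const_mul, integral_const_mul,
    integral_add (iS (by fun_prop)) (s4.const_mul _),
    integral_add (iS (by fun_prop)) (s3.const_mul _),
    integral_add (s1.const_mul _) (s2.const_mul _), integral_const_mul, integral_const_mul,
    integral_const_mul, integral_const_mul] at bd
  linarith only [vol, bd]

end SmoothIntegrated

/-! ### Passing to the limit in quadratic integrals -/

section L2

variable {α : Type*} [MeasurableSpace α] {μ : Measure α} {E E' : Type*} [NormedAddCommGroup E]
  [NormedAddCommGroup E'] {F : ℕ → α → E} {f : α → E} {G : ℕ → α → E'} {g : α → E'}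

/-- `F k → f` in `L²(μ)`. -/
structure TendstoL2 (μ : Measure α) (F : ℕ → α → E) (f : α → E) : Prop where
  memLp : ∀ k, MemLp (F k) 2 μ
  memLp_lim : MemLp f 2 μ
  tendsto : Tendsto (fun k => eLpNorm (fun x => F k x - f x) 2 μ) atTop (𝓝 0)

/-- `L²` convergence is preserved by a family of Lipschitz maps fixing the origin. -/
theorem TendstoL2.comp (h : TendstoL2 μ F f) {Φ : α → E → E'} {C : ℝ}
    (hm : ∀ k : α → E, AEStronglyMeasurable k μ → AEStronglyMeasurable (fun x => Φ x (k x)) μ)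
    (hl : ∀ᵐ x ∂μ, ∀ a b, ‖Φ x a - Φ x b‖ ≤ C * ‖a - b‖) (h0 : ∀ᵐ x ∂μ, Φ x 0 = 0) :
    TendstoL2 μ (fun k x => Φ x (F k x)) fun x => Φ x (f x) := by
  have hmem : ∀ k : α → E, MemLp k 2 μ → MemLp (fun x => Φ x (k x)) 2 μ := fun k hk => by
    refine MemLp.of_le_mul (c := C) hk (hm k hk.1) ?_
    filter_upwards [hl, h0] with x hx hx0
    simpa [hx0] using hx (k x) 0
  refine ⟨fun k => hmem _ (h.memLp k), hmem _ h.memLp_lim, ?_⟩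
  have hlim : Tendsto (fun k => ENNReal.ofReal C * eLpNorm (fun x => F k x - f x) 2 μ) atTop
      (𝓝 0) := by
    simpa using ENNReal.Tendsto.const_mul h.tendsto (Or.inr ENNReal.ofReal_ne_top)
  refine tendsto_of_tendsto_of_tendsto_of_le_of_le tendsto_const_nhds hlim (fun _ => zero_le) ?_
  intro k
  refine eLpNorm_le_mul_eLpNorm_of_ae_le_mul ?_ 2
  filter_upwards [hl] with x hx using hx _ _

theorem TendstoL2.norm (h : TendstoL2 μ F f) :
    TendstoL2 μ (fun k x => ‖F k x‖) fun x => ‖f x‖ :=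
  h.comp (Φ := fun _ a => ‖a‖) (C := 1) (fun _ hk => hk.norm)
    (ae_of_all _ fun _ a b => by
      rw [one_mul, Real.norm_eq_abs]; exact abs_norm_sub_norm_le a b)
    (ae_of_all _ fun _ => norm_zero)

theorem TendstoL2.sum {ι : Type*} [Fintype ι] {F : ι → ℕ → α → E} {f : ι → α → E}
    (h : ∀ i, TendstoL2 μ (F i) (f i)) :
    TendstoL2 μ (fun k x => ∑ i, F i k x) fun x => ∑ i, f i x := by
  have hm (k : ℕ) : MemLp (fun x => ∑ i, F i k x) 2 μ :=
    memLp_finsetSum (f := fun i x => F i k x) _ fun i _ => (h i).memLp k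
  have hf : MemLp (fun x => ∑ i, f i x) 2 μ :=
    memLp_finsetSum (f := fun i x => f i x) _ fun i _ => (h i).memLp_lim
  refine ⟨hm, hf, ?_⟩
  have hlim : Tendsto (fun k => ∑ i, eLpNorm (fun x => F i k x - f i x) 2 μ) atTop (𝓝 0) := by
    simpa using tendsto_finsetSum Finset.univ fun i _ => (h i).tendsto
  refine tendsto_of_tendsto_of_tendsto_of_le_of_le tendsto_const_nhds hlim (fun _ => zero_le) ?_
  intro k
  have hd : (fun x => ∑ i, F i k x - ∑ i, f i x) = ∑ i, fun x => F i k x - f i x := by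
    funext x
    rw [Finset.sum_apply, Finset.sum_sub_distrib]
  simp only [hd]
  exact eLpNorm_sum_le (μ := μ) (p := 2) (s := Finset.univ) (f := fun i x => F i k x - f i x)
    (fun i _ => ((h i).memLp k).1.sub (h i).memLp_lim.1) (by norm_num)

theorem tendsto_integral_mul_of_tendstoL2 {F G : ℕ → α → ℝ} {f g : α → ℝ} (hF : TendstoL2 μ F f)
    (hG : TendstoL2 μ G g) : Tendsto (fun k => ∫ x, F k x * G k x ∂μ) atTop
      (𝓝 (∫ x, f x * g x ∂μ)) := by
  have key : ∀ {p q : α → ℝ} (hp : MemLp p 2 μ) (hq : MemLp q 2 μ),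
      inner ℝ (hq.toLp q) (hp.toLp p) = ∫ x, p x * q x ∂μ := by
    intro p q hp hq
    rw [L2.inner_def]
    refine integral_congr_ae ?_
    filter_upwards [hp.coeFn_toLp, hq.coeFn_toLp] with x h1 h2
    rw [h1, h2]; simp
  have t1 : Tendsto (fun k => (hF.memLp k).toLp (F k)) atTop (𝓝 (hF.memLp_lim.toLp f)) :=
    (Lp.tendsto_Lp_iff_tendsto_eLpNorm'' F hF.memLp f hF.memLp_lim).2 hF.tendsto
  have t2 : Tendsto (fun k => (hG.memLp k).toLp (G k)) atTop (𝓝 (hG.memLp_lim.toLp g)) :=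
    (Lp.tendsto_Lp_iff_tendsto_eLpNorm'' G hG.memLp g hG.memLp_lim).2 hG.tendsto
  have := t2.inner (𝕜 := ℝ) t1
  simpa only [key] using this

/-- Integrals of products of `L²`-convergent sequences against a bounded weight converge. -/
theorem tendsto_integral_weight {a : α → ℝ} {K : ℝ} (ha : AEStronglyMeasurable a μ)
    (hK : ∀ᵐ x ∂μ, |a x| ≤ K) (hF : TendstoL2 μ F f) (hG : TendstoL2 μ G g) :
    Tendsto (fun k => ∫ x, a x * (‖F k x‖ * ‖G k x‖) ∂μ) atTop
      (𝓝 (∫ x, a x * (‖f x‖ * ‖g x‖) ∂μ)) := by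
  have h1 := hF.norm.comp (Φ := fun x t => a x * t) (C := K) (fun k hk => ha.mul hk)
    (by filter_upwards [hK] with x hx s t
        rw [← mul_sub, norm_mul]
        exact mul_le_mul_of_nonneg_right hx (norm_nonneg _))
    (ae_of_all _ fun x => mul_zero _)
  simpa only [mul_assoc] using tendsto_integral_mul_of_tendstoL2 h1 hG.norm

theorem tendsto_integral_weight_sq {a : α → ℝ} {K : ℝ} (ha : AEStronglyMeasurable a μ)
    (hK : ∀ᵐ x ∂μ, |a x| ≤ K) (hF : TendstoL2 μ F f) :
    Tendsto (fun k => ∫ x, a x * ‖F k x‖ ^ 2 ∂μ) atTop (𝓝 (∫ x, a x * ‖f x‖ ^ 2 ∂μ)) := by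
  simpa only [sq] using tendsto_integral_weight ha hK hF hF

end L2

section Limit

variable {n : ℕ} {Ω : Set (RSpace n)} {φ κ : RSpace n → ℝ} {m : ℝ} {u : RSpace n → ℂ}

theorem tendstoL2_toLp {α : Type*} [MeasurableSpace α] {μ : Measure α} {F : Fin n → ℕ → α → ℂ}
    {f : Fin n → α → ℂ} (h : ∀ j, TendstoL2 μ (F j) (f j)) :
    TendstoL2 μ (fun k x => (WithLp.toLp 2 fun j => F j k x : CSpace n))
      fun x => WithLp.toLp 2 fun j => f j x := by
  have hc (j : Fin n) : Isometry fun a : ℂ => (EuclideanSpace.single j a : CSpace n) :=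
    Isometry.of_dist_eq fun a b =>
      PiLp.dist_single_same 2 (fun _ : Fin n => ℂ) j a b
  have h1 (j : Fin n) : TendstoL2 μ (fun k x => (EuclideanSpace.single j (F j k x) : CSpace n))
      fun x => EuclideanSpace.single j (f j x) := by
    refine (h j).comp (Φ := fun _ a => (EuclideanSpace.single j a : CSpace n)) (C := 1) ?_ ?_ ?_
    · intro k hk
      exact (hc j).continuous.comp_aestronglyMeasurable hk
    · refine ae_of_all _ fun _ a b => ?_
      rw [one_mul, ← dist_eq_norm, (hc j).dist_eq, dist_eq_norm]
    · exact ae_of_all _ fun _ => by simp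
  have h2 := TendstoL2.sum h1
  have e : ∀ c : Fin n → ℂ, ∑ j, (EuclideanSpace.single j (c j) : CSpace n) = WithLp.toLp 2 c := by
    intro c
    ext i
    simp [Finset.sum_apply, Pi.single_apply]
  simpa only [e] using h2

theorem normalPart_sub (ν : RSpace n) (a b : CSpace n) :
    normalPart ν a - normalPart ν b = normalPart ν (a - b) := by
  simp_rw [normalPart, ← Finset.sum_sub_distrib, ← mul_sub]
  rfl

/-- Pythagoras' theorem for the tangential and the normal part of a complex vector. -/
theorem norm_sq_tangentialPart {ν : RSpace n} (hν : ‖ν‖ = 1) (a : CSpace n) :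
    ‖tangentialPart ν a‖ ^ 2 = ‖a‖ ^ 2 - ‖normalPart ν a‖ ^ 2 := by
  have hr := sum_sq_sub_normal hν fun i => (a i).re
  have hi := sum_sq_sub_normal hν fun i => (a i).im
  have e1 : (normalPart ν a).re = ∑ i, ν i * (a i).re := by
    rw [normalPart, Complex.re_sum]
    exact Finset.sum_congr rfl fun i _ => by simp
  have e2 : (normalPart ν a).im = ∑ i, ν i * (a i).im := by
    rw [normalPart, Complex.im_sum]
    exact Finset.sum_congr rfl fun i _ => by simp
  rw [← e1] at hr
  rw [← e2] at hi
  rw [EuclideanSpace.norm_sq_eq, EuclideanSpace.norm_sq_eq, norm_sq_eq_re_im (normalPart ν a)]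
  have e3 : ∀ i, ‖tangentialPart ν a i‖ ^ 2 = ((a i).re - (normalPart ν a).re * ν i) ^ 2 +
      ((a i).im - (normalPart ν a).im * ν i) ^ 2 := fun i => by
    rw [norm_sq_eq_re_im, tangentialPart]; simp
  have e4 : ∀ i, ‖a i‖ ^ 2 = (a i).re * (a i).re + (a i).im * (a i).im := fun i => by
    rw [norm_sq_eq_re_im]; ring
  simp_rw [e3, e4, Finset.sum_add_distrib]
  rw [hr, hi]; ring

theorem norm_normalPart_le {ν : RSpace n} (hν : ‖ν‖ = 1) (a : CSpace n) :
    ‖normalPart ν a‖ ≤ ‖a‖ := by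
  have := norm_sq_tangentialPart hν a
  refine le_of_sq_le_sq ?_ (norm_nonneg _)
  nlinarith [sq_nonneg ‖tangentialPart ν a‖]

theorem norm_tangentialPart_le {ν : RSpace n} (hν : ‖ν‖ = 1) (a : CSpace n) :
    ‖tangentialPart ν a‖ ≤ ‖a‖ := by
  have := norm_sq_tangentialPart hν a
  refine le_of_sq_le_sq ?_ (norm_nonneg _)
  nlinarith [sq_nonneg ‖normalPart ν a‖]

theorem tangentialPart_sub (ν : RSpace n) (a b : CSpace n) :
    tangentialPart ν a - tangentialPart ν b = tangentialPart ν (a - b) := by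
  ext i
  simp only [tangentialPart, ← normalPart_sub, PiLp.sub_apply]
  ring

theorem TendstoL2.normalPart (hΩ : IsOpen Ω) (hb : HasC2Boundary Ω)
    {F : ℕ → RSpace n → CSpace n} {f : RSpace n → CSpace n}
    (h : TendstoL2 (surfaceMeasure Ω) F f) : TendstoL2 (surfaceMeasure Ω)
      (fun k x => normalPart (outerNormal Ω x) (F k x))
      fun x => normalPart (outerNormal Ω x) (f x) := by
  have hN : AEStronglyMeasurable (outerNormal Ω) (surfaceMeasure Ω) :=
    aestronglyMeasurable_surfaceMeasure (continuousOn_outerNormal hΩ hb)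
  refine h.comp (Φ := fun x a => Carleman.normalPart (outerNormal Ω x) a) (C := 1)
    (fun k hk => by
      exact continuous_normalPart.comp_aestronglyMeasurable (f := fun x => (outerNormal Ω x, k x))
        (hN.prodMk hk)) ?_ ?_
  · filter_upwards [ae_surfaceMeasure_mem_frontier (Ω := Ω)] with x hx a b
    rw [one_mul, normalPart_sub]
    exact norm_normalPart_le (norm_outerNormal hΩ hb hx) _
  · exact ae_of_all _ fun x => by simp [Carleman.normalPart]

theorem TendstoL2.tangentialPart (hΩ : IsOpen Ω) (hb : HasC2Boundary Ω)
    {F : ℕ → RSpace n → CSpace n} {f : RSpace n → CSpace n}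
    (h : TendstoL2 (surfaceMeasure Ω) F f) : TendstoL2 (surfaceMeasure Ω)
      (fun k x => tangentialPart (outerNormal Ω x) (F k x))
      fun x => tangentialPart (outerNormal Ω x) (f x) := by
  have hN : AEStronglyMeasurable (outerNormal Ω) (surfaceMeasure Ω) :=
    aestronglyMeasurable_surfaceMeasure (continuousOn_outerNormal hΩ hb)
  refine h.comp (Φ := fun x a => Carleman.tangentialPart (outerNormal Ω x) a) (C := 1)
    (fun k hk => by
      exact continuous_tangentialPart.comp_aestronglyMeasurable (f := fun x => (outerNormal Ω x, k x))
        (hN.prodMk hk)) ?_ ?_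
  · filter_upwards [ae_surfaceMeasure_mem_frontier (Ω := Ω)] with x hx a b
    rw [one_mul, tangentialPart_sub]
    exact norm_tangentialPart_le (norm_outerNormal hΩ hb hx) _
  · refine ae_of_all _ fun x => ?_
    ext i
    simp [Carleman.tangentialPart, Carleman.normalPart]

variable {W : ℕ → RSpace n → ℂ}

theorem IsH2Approx.tendstoL2 (hΩ : IsOpen Ω) (hbd : Bornology.IsBounded Ω)
    (hW : IsH2Approx Ω u W) : TendstoL2 (volume.restrict Ω) W u :=
  ⟨fun k => memLp_restrict_of_continuousOn hΩ hbd (hW.contDiff k).continuous.continuousOn 2,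
    hW.memLp, hW.tendsto⟩

theorem IsH2Approx.tendstoL2_grad (hΩ : IsOpen Ω) (hbd : Bornology.IsBounded Ω)
    (hW : IsH2Approx Ω u W) :
    TendstoL2 (volume.restrict Ω) (fun k => gradC (W k)) (weakGrad Ω u) :=
  tendstoL2_toLp (F := fun j k x => classicalPartial j (W k) x) (f := fun j => weakPartial Ω j u)
    fun j => ⟨fun k => memLp_restrict_of_continuousOn hΩ hbd
      (contDiff_classicalPartial (hW.contDiff k) j).continuous.continuousOn 2,
      hW.memLp_partial j, hW.tendsto_partial j⟩

theorem IsH2Approx.tendstoL2_lap (hΩ : IsOpen Ω) (hbd : Bornology.IsBounded Ω)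
    (hW : IsH2Approx Ω u W) :
    TendstoL2 (volume.restrict Ω) (fun k => lapC (W k)) (weakLaplacian Ω u) :=
  TendstoL2.sum (F := fun j k x => classicalPartial j (classicalPartial j (W k)) x)
    (f := fun j => weakPartial Ω j (weakPartial Ω j u))
    fun j => ⟨fun k => memLp_restrict_of_continuousOn hΩ hbd (contDiff_classicalPartial
      (contDiff_classicalPartial (hW.contDiff k) j) j).continuous.continuousOn 2,
      hW.memLp_partial₂ j j, hW.tendsto_partial₂ j j⟩

theorem IsH2Approx.tendstoL2_trace (hΩ : IsOpen Ω) (hbd : Bornology.IsBounded Ω)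
    (hb : HasC2Boundary Ω) (hW : IsH2Approx Ω u W) :
    TendstoL2 (surfaceMeasure Ω) W (trace Ω u) :=
  ⟨fun k => memLp_surfaceMeasure hΩ hbd hb (hW.contDiff k).continuous.continuousOn 2,
    hW.memLp_trace, hW.tendsto_trace⟩

theorem IsH2Approx.tendstoL2_traceGrad (hΩ : IsOpen Ω) (hbd : Bornology.IsBounded Ω)
    (hb : HasC2Boundary Ω) (hW : IsH2Approx Ω u W) :
    TendstoL2 (surfaceMeasure Ω) (fun k => gradC (W k)) (traceGrad Ω u) :=
  tendstoL2_toLp (F := fun j k x => classicalPartial j (W k) x)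
    (f := fun j => trace Ω (weakPartial Ω j u))
    fun j => ⟨fun k => memLp_surfaceMeasure hΩ hbd hb
      (contDiff_classicalPartial (hW.contDiff k) j).continuous.continuousOn 2,
      hW.memLp_trace_partial j, hW.tendsto_trace_partial j⟩

theorem IsH2Approx.tendstoL2_normalDeriv (hΩ : IsOpen Ω) (hbd : Bornology.IsBounded Ω)
    (hb : HasC2Boundary Ω) (hW : IsH2Approx Ω u W) :
    TendstoL2 (surfaceMeasure Ω) (fun k x => normalPart (outerNormal Ω x) (gradC (W k) x))
      (normalDeriv Ω u) :=
  (hW.tendstoL2_traceGrad hΩ hbd hb).normalPart hΩ hb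

theorem IsH2Approx.tendstoL2_tangentialGrad (hΩ : IsOpen Ω) (hbd : Bornology.IsBounded Ω)
    (hb : HasC2Boundary Ω) (hW : IsH2Approx Ω u W) :
    TendstoL2 (surfaceMeasure Ω) (fun k x => tangentialPart (outerNormal Ω x) (gradC (W k) x))
      (tangentialGrad Ω u) :=
  (hW.tendstoL2_traceGrad hΩ hbd hb).tangentialPart hΩ hb

/-- The Carleman estimate with boundary terms for the Laplacian and the convexified weight. -/
theorem IsWeightPair.carleman_H2 (hΩ : IsOpen Ω) (hbd : Bornology.IsBounded Ω)
    (hb : HasC2Boundary Ω) (hd : IsWeightPair Ω φ κ m) {h ε τ K c : ℝ}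
    (h0 : 0 < h) (h1 : h ≤ 1) (hε : 0 < ε) (hτ : τ = h / ε) (hK : 0 < K) (hc : 0 ≤ c)
    (hτφ : ∀ x ∈ closure Ω, τ * φ x ≤ 1 / 2)
    (hB : ∀ x ∈ closure Ω, CoeffBound φ κ m τ K x)
    (hε₁ : 6 * K / m ^ 2 ≤ m / ε - c / ε)
    (hε₂ : 3 * K ^ 2 + 2 * K ≤ 3 / 4 * m ^ 2 / ε - c / ε)
    (hu : IsH2Approx Ω u W) {w b : RSpace n → ℝ}
    (hw : w = fun x => Real.exp (-convexWeight φ τ x / h) ^ 2)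
    (hbν : b = fun x => ∑ i, outerNormal Ω x i * classicalPartial i (convexWeight φ τ) x) :
    c / ε * h ^ 2 / (2 + 2 * K ^ 2) *
        (h ^ 2 * (∫ x in Ω, w x * ‖weakGrad Ω u x‖ ^ 2) + ∫ x in Ω, w x * ‖u x‖ ^ 2) +
        2 * h ^ 3 * (∫ x, w x * b x * ‖normalDeriv Ω u x‖ ^ 2 ∂surfaceMeasure Ω) ≤
      h ^ 4 * (∫ x in Ω, w x * ‖weakLaplacian Ω u x‖ ^ 2) + (4 * K ^ 3 + 4 * K ^ 2 + 4 * K) *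
        (h * (∫ x, w x * ‖trace Ω u x‖ ^ 2 ∂surfaceMeasure Ω) +
          h ^ 2 * (∫ x, w x * (‖trace Ω u x‖ * ‖normalDeriv Ω u x‖) ∂surfaceMeasure Ω) +
          h ^ 3 * (∫ x, w x * ‖tangentialGrad Ω u x‖ ^ 2 ∂surfaceMeasure Ω) +
          h ^ 3 * (∫ x, w x * (‖tangentialGrad Ω u x‖ * ‖normalDeriv Ω u x‖)
            ∂surfaceMeasure Ω)) := by
  have hψ := contDiff_convexWeight hd.smooth τ
  have hN := continuousOn_outerNormal hΩ hb
  have hwc : Continuous w := by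
    have := hψ.continuous
    rw [hw]; fun_prop
  have hbc : ContinuousOn b (frontier Ω) := by
    rw [hbν]
    refine continuousOn_finsetSum _ fun i _ => ?_
    have h2 : ContinuousOn (fun y => outerNormal Ω y i) (frontier Ω) := by fun_prop
    exact h2.mul (contDiff_classicalPartial hψ i).continuous.continuousOn
  obtain ⟨D₁, hD₁⟩ := hbd.isCompact_closure.exists_bound_of_continuousOn
    (f := w) hwc.continuousOn
  have hwb : ContinuousOn (fun x => w x * b x) (frontier Ω) := hwc.continuousOn.mul hbc
  obtain ⟨D₂, hD₂⟩ := (isCompact_frontier_of_isBounded hbd).exists_bound_of_continuousOn hwb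
  have wV : AEStronglyMeasurable w (volume.restrict Ω) := hwc.aestronglyMeasurable
  have wVb : ∀ᵐ x ∂volume.restrict Ω, |w x| ≤ D₁ := by
    filter_upwards [ae_restrict_mem hΩ.measurableSet] with x hx using hD₁ x (subset_closure hx)
  have wS : AEStronglyMeasurable w (surfaceMeasure Ω) := hwc.aestronglyMeasurable
  have wSb : ∀ᵐ x ∂surfaceMeasure Ω, |w x| ≤ D₁ := by
    filter_upwards [ae_surfaceMeasure_mem_frontier (Ω := Ω)] with x hx using
      hD₁ x (frontier_subset_closure hx)
  have bS : AEStronglyMeasurable (fun x => w x * b x) (surfaceMeasure Ω) :=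
    aestronglyMeasurable_surfaceMeasure hwb
  have bSb : ∀ᵐ x ∂surfaceMeasure Ω, |w x * b x| ≤ D₂ := by
    filter_upwards [ae_surfaceMeasure_mem_frontier (Ω := Ω)] with x hx using hD₂ x hx
  have v1 := tendsto_integral_weight_sq wV wVb (hu.tendstoL2_grad hΩ hbd)
  have v2 := tendsto_integral_weight_sq wV wVb (hu.tendstoL2 hΩ hbd)
  have v3 := tendsto_integral_weight_sq wV wVb (hu.tendstoL2_lap hΩ hbd)
  have tP := hu.tendstoL2_normalDeriv hΩ hbd hb
  have tT := hu.tendstoL2_tangentialGrad hΩ hbd hb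
  have tu := hu.tendstoL2_trace hΩ hbd hb
  have b0 := tendsto_integral_weight_sq bS bSb tP
  have b1 := tendsto_integral_weight_sq wS wSb tu
  have b2 := tendsto_integral_weight wS wSb tu tP
  have b3 := tendsto_integral_weight_sq wS wSb tT
  have b4 := tendsto_integral_weight wS wSb tT tP
  refine le_of_tendsto_of_tendsto' ((((v1.const_mul _).add v2).const_mul _).add (b0.const_mul _))
    ((v3.const_mul _).add (((((b1.const_mul _).add (b2.const_mul _)).add (b3.const_mul _)).add
      (b4.const_mul _)).const_mul _)) fun k => ?_
  exact hd.carleman_smooth hΩ hbd hb h0 h1 hε hτ hK hc hτφ hB hε₁ hε₂ (hu.contDiff k) hw hbν rfl rfl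

end Limit

/-! ### Absorbing the lower order terms -/

section Absorb

variable {n : ℕ} {Ω : Set (RSpace n)} {φ κ : RSpace n → ℝ} {m : ℝ} {u : RSpace n → ℂ}

theorem integrable_weight_mul {α : Type*} [MeasurableSpace α] {μ : Measure α} {E E' : Type*}
    [NormedAddCommGroup E] [NormedAddCommGroup E'] {f : α → E} {g : α → E'} {a : α → ℝ} {K : ℝ}
    (ha : AEStronglyMeasurable a μ) (hK : ∀ᵐ x ∂μ, |a x| ≤ K) (hf : MemLp f 2 μ)
    (hg : MemLp g 2 μ) : Integrable (fun x => a x * (‖f x‖ * ‖g x‖)) μ :=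
  (memLp_one_iff_integrable.1 (hg.norm.mul (r := 1) hf.norm)).bdd_mul ha hK

theorem integrable_weight_sq {α : Type*} [MeasurableSpace α] {μ : Measure α} {E : Type*}
    [NormedAddCommGroup E] {f : α → E} {a : α → ℝ} {K : ℝ}
    (ha : AEStronglyMeasurable a μ) (hK : ∀ᵐ x ∂μ, |a x| ≤ K) (hf : MemLp f 2 μ) :
    Integrable (fun x => a x * ‖f x‖ ^ 2) μ := by
  simpa only [sq] using integrable_weight_mul ha hK hf hf

theorem ae_norm_le_of_eLpNorm_top_le {α : Type*} [MeasurableSpace α] {μ : Measure α} {E : Type*}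
    [NormedAddCommGroup E] {f : α → E} {M : ℝ} (hM : 0 ≤ M)
    (h : eLpNorm f ∞ μ ≤ ENNReal.ofReal M) : ∀ᵐ x ∂μ, ‖f x‖ ≤ M := by
  rw [eLpNorm_exponent_top] at h
  filter_upwards [ae_le_eLpNormEssSup (f := f) (μ := μ)] with x hx
  have := hx.trans h
  rwa [← ofReal_norm, ENNReal.ofReal_le_ofReal_iff hM] at this

/-- The first and zeroth order terms of the operator are of lower order in `h`. -/
theorem norm_lap_le_schrodingerOp {h M : ℝ} (h0 : 0 < h) {A : RSpace n → CSpace n}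
    {V : RSpace n → ℂ} {x : RSpace n} (hA : ‖A x‖ ≤ M) (hV : ‖V x‖ ≤ M / h) :
    h ^ 4 * ‖weakLaplacian Ω u x‖ ^ 2 ≤ 3 * ‖schrodingerOp Ω h A V u x‖ ^ 2 +
      3 * M ^ 2 * h ^ 2 * (h ^ 2 * ‖weakGrad Ω u x‖ ^ 2 + ‖u x‖ ^ 2) ∧
    ‖schrodingerOp Ω h A V u x‖ ≤ h ^ 2 * ‖weakLaplacian Ω u x‖ + h ^ 2 * M * ‖weakGrad Ω u x‖ +
      h * M * ‖u x‖ := by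
  have hM : 0 ≤ M := (norm_nonneg _).trans hA
  set a := ∑ j, ((h : ℂ) * A x j) * ((h : ℂ) * weakGrad Ω u x j) with ha
  set b := (h : ℂ) ^ 2 * V x * u x with hb
  have ea : ‖a‖ ≤ h ^ 2 * M * ‖weakGrad Ω u x‖ := by
    have e : a = (h : ℂ) ^ 2 * ∑ j, A x j * weakGrad Ω u x j := by
      rw [ha, Finset.mul_sum]
      exact Finset.sum_congr rfl fun j _ => by ring
    have hh : ‖(h : ℂ) ^ 2‖ = h ^ 2 := by
      rw [norm_pow, Complex.norm_real, Real.norm_of_nonneg h0.le]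
    rw [e, norm_mul, hh, mul_assoc]
    refine mul_le_mul_of_nonneg_left ?_ (sq_nonneg _)
    refine (norm_sum_le _ _).trans ?_
    simp_rw [norm_mul]
    refine (Real.sum_mul_le_sqrt_mul_sqrt _ _ _).trans ?_
    rw [← EuclideanSpace.norm_eq, ← EuclideanSpace.norm_eq]
    exact mul_le_mul_of_nonneg_right hA (norm_nonneg _)
  have eb : ‖b‖ ≤ h * M * ‖u x‖ := by
    rw [hb, norm_mul, norm_mul, norm_pow, Complex.norm_real, Real.norm_of_nonneg h0.le]
    refine mul_le_mul_of_nonneg_right ?_ (norm_nonneg _)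
    calc h ^ 2 * ‖V x‖ ≤ h ^ 2 * (M / h) := by gcongr
      _ = h * M := by field_simp
  have hop : schrodingerOp Ω h A V u x = -(h : ℂ) ^ 2 * weakLaplacian Ω u x + a + b := rfl
  have hl : ‖-(h : ℂ) ^ 2 * weakLaplacian Ω u x‖ = h ^ 2 * ‖weakLaplacian Ω u x‖ := by
    rw [norm_mul, norm_neg, norm_pow, Complex.norm_real, Real.norm_of_nonneg h0.le]
  constructor
  · have h3 : h ^ 2 * ‖weakLaplacian Ω u x‖ ≤ ‖schrodingerOp Ω h A V u x‖ +
        h ^ 2 * M * ‖weakGrad Ω u x‖ + h * M * ‖u x‖ := by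
      rw [← hl, show -(h : ℂ) ^ 2 * weakLaplacian Ω u x =
        schrodingerOp Ω h A V u x - a - b by rw [hop]; ring]
      refine (norm_sub_le _ _).trans (add_le_add ((norm_sub_le _ _).trans ?_) eb)
      gcongr
    have h4 : 0 ≤ h ^ 2 * ‖weakLaplacian Ω u x‖ := by positivity
    generalize ‖schrodingerOp Ω h A V u x‖ = o at *
    generalize ‖weakGrad Ω u x‖ = g at *
    generalize ‖u x‖ = v at *
    generalize ‖weakLaplacian Ω u x‖ = l at *
    have h5 : (h ^ 2 * l) ^ 2 ≤ (o + h ^ 2 * M * g + h * M * v) ^ 2 := by gcongr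
    have h6 : (o + h ^ 2 * M * g + h * M * v) ^ 2 ≤
        3 * o ^ 2 + 3 * (h ^ 2 * M * g) ^ 2 + 3 * (h * M * v) ^ 2 := by
      nlinarith only [sq_nonneg (o - h ^ 2 * M * g), sq_nonneg (o - h * M * v),
        sq_nonneg (h ^ 2 * M * g - h * M * v)]
    linarith only [h5, h6]
  · rw [hop, ← hl]
    exact (norm_add_le _ _).trans (add_le_add ((norm_add_le _ _).trans (by gcongr)) eb)

theorem memLp_schrodingerOp {h M : ℝ} (h0 : 0 < h) {A : RSpace n → CSpace n} {V : RSpace n → ℂ}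
    (hA : AEStronglyMeasurable A (volume.restrict Ω)) (hV : AEStronglyMeasurable V (volume.restrict Ω))
    (hAM : ∀ᵐ x ∂volume.restrict Ω, ‖A x‖ ≤ M) (hVM : ∀ᵐ x ∂volume.restrict Ω, ‖V x‖ ≤ M / h)
    (hu : MemLp u 2 (volume.restrict Ω)) (hg : MemLp (weakGrad Ω u) 2 (volume.restrict Ω))
    (hl : MemLp (weakLaplacian Ω u) 2 (volume.restrict Ω)) :
    MemLp (schrodingerOp Ω h A V u) 2 (volume.restrict Ω) := by
  have hj : ∀ {G : RSpace n → CSpace n}, AEStronglyMeasurable G (volume.restrict Ω) → ∀ j,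
      AEStronglyMeasurable (fun x => G x j) (volume.restrict Ω) := fun hG j =>
    (EuclideanSpace.proj (𝕜 := ℂ) j).continuous.comp_aestronglyMeasurable hG
  have hs : AEStronglyMeasurable (fun x => ∑ j, ((h : ℂ) * A x j) * ((h : ℂ) * weakGrad Ω u x j))
      (volume.restrict Ω) := by
    refine Finset.aestronglyMeasurable_fun_sum _ fun j _ => ?_
    exact ((hj hA j).const_mul _).mul ((hj hg.1 j).const_mul _)
  have hm : AEStronglyMeasurable (schrodingerOp Ω h A V u) (volume.restrict Ω) :=
    ((hl.1.const_mul _).add hs).add ((hV.const_mul _).mul hu.1)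
  refine MemLp.of_le (g := fun x => h ^ 2 * ‖weakLaplacian Ω u x‖ +
    h ^ 2 * M * ‖weakGrad Ω u x‖ + h * M * ‖u x‖)
    (((hl.norm.const_mul _).add (hg.norm.const_mul _)).add (hu.norm.const_mul _)) hm ?_
  filter_upwards [hAM, hVM] with x h1 h2
  exact (norm_lap_le_schrodingerOp h0 h1 h2).2.trans (le_abs_self _)

theorem weightNormalDeriv_eq_sum (Ω : Set (RSpace n)) (φ : RSpace n → ℝ) (x : RSpace n) :
    weightNormalDeriv Ω φ x = ∑ i, outerNormal Ω x i * classicalPartial i φ x := by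
  rw [weightNormalDeriv, inner_gradient_left, fderiv_apply_eq_sum]
  rfl

theorem continuousOn_weightNormalDeriv (hΩ : IsOpen Ω) (hb : HasC2Boundary Ω)
    (hφ : ContDiff ℝ ∞ φ) : ContinuousOn (weightNormalDeriv Ω φ) (frontier Ω) := by
  have hN := continuousOn_outerNormal hΩ hb
  rw [show weightNormalDeriv Ω φ = _ from funext (weightNormalDeriv_eq_sum Ω φ)]
  refine continuousOn_finsetSum _ fun i _ => ?_
  have h2 : ContinuousOn (fun y => outerNormal Ω y i) (frontier Ω) := by fun_prop
  exact h2.mul (contDiff_classicalPartial hφ i).continuous.continuousOn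

theorem measurableSet_boundaryPlus (hΩ : IsOpen Ω) (hb : HasC2Boundary Ω)
    (hφ : ContDiff ℝ ∞ φ) : MeasurableSet (boundaryPlus Ω φ) :=
  ((continuousOn_weightNormalDeriv hΩ hb hφ).preimage_isClosed_of_isClosed isClosed_frontier
    isClosed_Ici).measurableSet

theorem measurableSet_boundaryMinus (hΩ : IsOpen Ω) (hb : HasC2Boundary Ω)
    (hφ : ContDiff ℝ ∞ φ) : MeasurableSet (boundaryMinus Ω φ) :=
  ((continuousOn_weightNormalDeriv hΩ hb hφ).preimage_isClosed_of_isClosed isClosed_frontier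
    isClosed_Iic).measurableSet

end Absorb

/-! ### The estimate for the magnetic Schrödinger operator -/

section Final

variable {n : ℕ} {Ω : Set (RSpace n)} {φ κ : RSpace n → ℝ} {m : ℝ} {u : RSpace n → ℂ}

/-- The weight `e^{-2ψ/h}` of the convexified function `ψ = φ - (h / (2 ε)) φ²` differs from
`e^{-2φ/h}` by a factor which does not depend on `h`. -/
theorem sq_exp_convexWeight {h ε τ : ℝ} (h0 : 0 < h) (hτ : τ = h / ε) (φ : RSpace n → ℝ)
    (x : RSpace n) : Real.exp (-convexWeight φ τ x / h) ^ 2 =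
      Real.exp (-2 * φ x / h) * Real.exp (φ x ^ 2 / ε) := by
  rw [← Real.exp_nat_mul, ← Real.exp_add, convexWeight, hτ]
  congr 1
  push_cast
  field_simp
  ring

/-- The choice of the convexification parameter. -/
theorem exists_convexification_parameter {m K M : ℝ} (hm : 0 < m) (hK : 0 < K) :
    ∃ ε c : ℝ, 0 < ε ∧ 0 < c ∧ 6 * K / m ^ 2 ≤ m / ε - c / ε ∧
      3 * K ^ 2 + 2 * K ≤ 3 / 4 * m ^ 2 / ε - c / ε ∧ 3 * M ^ 2 + 1 ≤ c / ε / (2 + 2 * K ^ 2) := by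
  set c := min (m / 2) (m ^ 2 / 2) with hc
  set R := 6 * K / m ^ 2 + 2 * (3 * K ^ 2 + 2 * K) + (3 * M ^ 2 + 1) * (2 + 2 * K ^ 2) with hR
  have hc0 : 0 < c := lt_min (by positivity) (by positivity)
  have r1 : 0 < 6 * K / m ^ 2 := by positivity
  have r2 : 0 < 3 * K ^ 2 + 2 * K := by positivity
  have r3 : 0 < (3 * M ^ 2 + 1) * (2 + 2 * K ^ 2) := by positivity
  have hR0 : 0 < R := by positivity
  have hε : 0 < c / R := by positivity
  have e : c / (c / R) = R := by field_simp
  have e1 : 2 * R ≤ m / (c / R) := by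
    nth_rewrite 1 [← e]
    rw [← mul_div_assoc]
    have := min_le_left (m / 2) (m ^ 2 / 2)
    gcongr ?_ / _; rw [hc]; linarith
  have e2 : 3 / 2 * R ≤ 3 / 4 * m ^ 2 / (c / R) := by
    nth_rewrite 1 [← e]
    rw [← mul_div_assoc]
    have := min_le_right (m / 2) (m ^ 2 / 2)
    gcongr ?_ / _; rw [hc]; linarith
  refine ⟨c / R, c, hε, hc0, ?_, ?_, ?_⟩
  · rw [e]; linarith
  · rw [e]; linarith
  · rw [e, le_div_iff₀ (by positivity)]; linarith

/-- The Carleman estimate with boundary terms for the magnetic Schrödinger operator and a globally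
smooth weight. -/
theorem IsWeightPair.carleman_schrodinger (hΩ : IsOpen Ω) (hbd : Bornology.IsBounded Ω)
    (hb : HasC2Boundary Ω) (hd : IsWeightPair Ω φ κ m) (M : ℝ) :
    ∃ C : ℝ, 0 < C ∧ ∃ h₀ : ℝ, 0 < h₀ ∧ ∀ h : ℝ, 0 < h → h < h₀ →
      ∀ (A : RSpace n → CSpace n) (V : RSpace n → ℂ),
        MemLp A ∞ (volume.restrict Ω) →
        eLpNorm A ∞ (volume.restrict Ω) ≤ ENNReal.ofReal M →
        MemLp V ∞ (volume.restrict Ω) →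
        eLpNorm V ∞ (volume.restrict Ω) ≤ ENNReal.ofReal (M / h) →
      ∀ u : RSpace n → ℂ, MemH2 Ω u →
        h ^ 2 * ((∫ x in Ω, Real.exp (-2 * φ x / h) * ‖u x‖ ^ 2)
              + h ^ 2 * ∫ x in Ω, Real.exp (-2 * φ x / h) * ‖weakGrad Ω u x‖ ^ 2)
            + h ^ 3 * (∫ x in boundaryPlus Ω φ, weightNormalDeriv Ω φ x *
                Real.exp (-2 * φ x / h) * ‖normalDeriv Ω u x‖ ^ 2 ∂surfaceMeasure Ω)
          ≤ C * (h * (∫ x, Real.exp (-2 * φ x / h) * ‖trace Ω u x‖ ^ 2 ∂surfaceMeasure Ω)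
            + h ^ 2 * (∫ x, Real.exp (-2 * φ x / h) * (‖trace Ω u x‖ * ‖normalDeriv Ω u x‖)
                ∂surfaceMeasure Ω)
            + h ^ 3 * (∫ x in boundaryMinus Ω φ, (-weightNormalDeriv Ω φ x) *
                Real.exp (-2 * φ x / h) * ‖normalDeriv Ω u x‖ ^ 2 ∂surfaceMeasure Ω)
            + h ^ 3 * (∫ x, Real.exp (-2 * φ x / h) * ‖tangentialGrad Ω u x‖ ^ 2
                ∂surfaceMeasure Ω)
            + h ^ 3 * (∫ x, Real.exp (-2 * φ x / h) *
                (‖tangentialGrad Ω u x‖ * ‖normalDeriv Ω u x‖) ∂surfaceMeasure Ω)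
            + ∫ x in Ω, Real.exp (-2 * φ x / h) * ‖schrodingerOp Ω h A V u x‖ ^ 2) := by
  obtain ⟨K, hK, hcoef⟩ := hd.exists_bound hbd
  have hφ := hd.smooth
  set M' := max M 0 with hM'
  have hM'0 : 0 ≤ M' := le_max_right _ _
  obtain ⟨ε, c, hε, hc, hε₁, hε₂, hε₃⟩ :=
    exists_convexification_parameter (M := M') hd.pos hK
  set C₁ := 4 * K ^ 3 + 4 * K ^ 2 + 4 * K with hC₁
  have hC₁0 : 0 < C₁ := by positivity
  set D := Real.exp (K ^ 2 / ε) with hD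
  have hD0 : 0 < D := Real.exp_pos _
  -- The bound on `h` ensures `τ ≤ 1` and `|τ φ| ≤ 1 / 2` on the closure of `Ω`.
  refine ⟨D * (C₁ + 3), by positivity, min 1 (min ε (ε / (2 * K))), by positivity, ?_⟩
  intro h h0 hh A V hA hAM hV hVM u hu
  have h1 : h ≤ 1 := hh.le.trans (min_le_left _ _)
  have hhε : h ≤ ε := hh.le.trans ((min_le_right _ _).trans (min_le_left _ _))
  have hhK : h ≤ ε / (2 * K) := hh.le.trans ((min_le_right _ _).trans (min_le_right _ _))
  obtain ⟨τ, hτ⟩ : ∃ τ : ℝ, τ = h / ε := ⟨_, rfl⟩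
  have hτ0 : 0 ≤ τ := by rw [hτ]; positivity
  have hτ1 : τ ≤ 1 := by rw [hτ, div_le_one hε]; exact hhε
  have hτK : τ * K ≤ 1 / 2 := by
    rw [le_div_iff₀ (by positivity)] at hhK
    rw [hτ, div_mul_eq_mul_div, div_le_iff₀ hε]; linarith
  have hB : ∀ x ∈ closure Ω, CoeffBound φ κ m τ K x := hcoef τ ⟨hτ0, hτ1⟩
  have habs : ∀ x ∈ closure Ω, |τ * φ x| ≤ 1 / 2 := fun x hx => by
    rw [abs_mul, abs_of_nonneg hτ0]
    exact (mul_le_mul_of_nonneg_left (hB x hx).weight hτ0).trans hτK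
  obtain ⟨W, hW⟩ := hu.exists_isH2Approx hΩ hbd hb
  obtain ⟨w, hw⟩ : ∃ w : RSpace n → ℝ,
    w = fun x => Real.exp (-convexWeight φ τ x / h) ^ 2 := ⟨_, rfl⟩
  obtain ⟨b, hbν⟩ : ∃ b : RSpace n → ℝ, b = fun x =>
    ∑ i, outerNormal Ω x i * classicalPartial i (convexWeight φ τ) x := ⟨_, rfl⟩
  have key := hd.carleman_H2 hΩ hbd hb h0 h1 hε hτ hK hc.le
    (fun x hx => (le_abs_self _).trans (habs x hx)) hB hε₁ hε₂ hW hw hbν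
  obtain ⟨w₀, hw₀⟩ : ∃ w₀ : RSpace n → ℝ, w₀ = fun x => Real.exp (-2 * φ x / h) := ⟨_, rfl⟩
  simp only [show ∀ x, Real.exp (-2 * φ x / h) = w₀ x from fun x => by rw [hw₀]]
  have w₀pos : ∀ x, 0 < w₀ x := fun x => by rw [hw₀]; exact Real.exp_pos _
  -- The two weights differ by the factor `exp (φ² / ε)`, which does not depend on `h`.
  have hww : ∀ x, w x = w₀ x * Real.exp (φ x ^ 2 / ε) := fun x => by
    rw [hw, hw₀]; exact sq_exp_convexWeight h0 hτ φ x
  have hw1 : ∀ x, w₀ x ≤ w x := fun x => by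
    rw [hww]
    exact le_mul_of_one_le_right (w₀pos x).le (Real.one_le_exp (by positivity))
  have hw2 : ∀ x ∈ closure Ω, w x ≤ D * w₀ x := fun x hx => by
    rw [hww, mul_comm]
    refine mul_le_mul_of_nonneg_right (Real.exp_le_exp.2 ?_) (w₀pos x).le
    have := (hB x hx).weight
    rw [← sq_abs (φ x)]
    gcongr
  have hwc : Continuous w := by
    have := (contDiff_convexWeight hφ τ).continuous
    rw [hw]; fun_prop
  have hw₀c : Continuous w₀ := by
    have := hφ.continuous
    rw [hw₀]; fun_prop
  have hν := continuousOn_weightNormalDeriv hΩ hb hφ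
  have hb_eq : ∀ x, b x = (1 - τ * φ x) * weightNormalDeriv Ω φ x := fun x => by
    rw [hbν, weightNormalDeriv_eq_sum, Finset.mul_sum]
    exact Finset.sum_congr rfl fun i _ => by rw [pd_convexWeight hφ]; ring
  have memF := ae_surfaceMeasure_mem_frontier (Ω := Ω)
  have memΩ : ∀ᵐ x ∂volume.restrict Ω, x ∈ Ω := ae_restrict_mem hΩ.measurableSet
  -- Integrability of all the integrands.
  have bdV : ∀ {a : RSpace n → ℝ}, Continuous a → ∃ L, ∀ᵐ x ∂volume.restrict Ω, |a x| ≤ L :=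
    fun {a} ha => by
      obtain ⟨L, hL⟩ := hbd.isCompact_closure.exists_bound_of_continuousOn ha.continuousOn
      exact ⟨L, by filter_upwards [memΩ] with x hx using hL x (subset_closure hx)⟩
  have bdS : ∀ {a : RSpace n → ℝ}, ContinuousOn a (frontier Ω) →
      ∃ L, ∀ᵐ x ∂surfaceMeasure Ω, |a x| ≤ L := fun {a} ha => by
    obtain ⟨L, hL⟩ := (isCompact_frontier_of_isBounded hbd).exists_bound_of_continuousOn ha
    exact ⟨L, by filter_upwards [memF] with x hx using hL x hx⟩
  have iV : ∀ {E : Type} [NormedAddCommGroup E] {a : RSpace n → ℝ} {f : RSpace n → E},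
      Continuous a → MemLp f 2 (volume.restrict Ω) → IntegrableOn (fun x => a x * ‖f x‖ ^ 2) Ω :=
    fun ha hf => integrable_weight_sq ha.aestronglyMeasurable (bdV ha).choose_spec hf
  have iS : ∀ {E : Type} [NormedAddCommGroup E] {a : RSpace n → ℝ} {f : RSpace n → E},
      ContinuousOn a (frontier Ω) → MemLp f 2 (surfaceMeasure Ω) →
        Integrable (fun x => a x * ‖f x‖ ^ 2) (surfaceMeasure Ω) :=
    fun ha hf => integrable_weight_sq (aestronglyMeasurable_surfaceMeasure ha)
      (bdS ha).choose_spec hf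
  have iS' : ∀ {E E' : Type} [NormedAddCommGroup E] [NormedAddCommGroup E'] {a : RSpace n → ℝ}
      {f : RSpace n → E} {g : RSpace n → E'}, ContinuousOn a (frontier Ω) →
        MemLp f 2 (surfaceMeasure Ω) → MemLp g 2 (surfaceMeasure Ω) →
          Integrable (fun x => a x * (‖f x‖ * ‖g x‖)) (surfaceMeasure Ω) :=
    fun ha hf hg => integrable_weight_mul (aestronglyMeasurable_surfaceMeasure ha)
      (bdS ha).choose_spec hf hg
  have lu := (hW.tendstoL2 hΩ hbd).memLp_lim
  have lg := (hW.tendstoL2_grad hΩ hbd).memLp_lim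
  have ll := (hW.tendstoL2_lap hΩ hbd).memLp_lim
  have lt := (hW.tendstoL2_trace hΩ hbd hb).memLp_lim
  have lP := (hW.tendstoL2_normalDeriv hΩ hbd hb).memLp_lim
  have lT := (hW.tendstoL2_tangentialGrad hΩ hbd hb).memLp_lim
  have hAM' : ∀ᵐ x ∂volume.restrict Ω, ‖A x‖ ≤ M' :=
    ae_norm_le_of_eLpNorm_top_le hM'0 (hAM.trans (ENNReal.ofReal_le_ofReal (le_max_left _ _)))
  have hVM' : ∀ᵐ x ∂volume.restrict Ω, ‖V x‖ ≤ M' / h :=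
    ae_norm_le_of_eLpNorm_top_le (by positivity) (hVM.trans (ENNReal.ofReal_le_ofReal
      (div_le_div_of_nonneg_right (le_max_left _ _) h0.le)))
  have lO := memLp_schrodingerOp h0 hA.1 hV.1 hAM' hVM' lu lg ll
  -- The Laplacian is replaced by the full operator.
  have absorb : h ^ 4 * (∫ x in Ω, w x * ‖weakLaplacian Ω u x‖ ^ 2) ≤
      3 * (∫ x in Ω, w x * ‖schrodingerOp Ω h A V u x‖ ^ 2) + 3 * M' ^ 2 * h ^ 2 *
        (h ^ 2 * (∫ x in Ω, w x * ‖weakGrad Ω u x‖ ^ 2) + ∫ x in Ω, w x * ‖u x‖ ^ 2) := by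
    have j1 := (iV hwc lO).const_mul 3
    have j2 := (iV hwc lg).const_mul (h ^ 2)
    have j3 : Integrable (fun x => h ^ 2 * (w x * ‖weakGrad Ω u x‖ ^ 2) + w x * ‖u x‖ ^ 2)
      (volume.restrict Ω) := j2.add (iV hwc lu)
    have j4 := j3.const_mul (3 * M' ^ 2 * h ^ 2)
    have j5 : Integrable (fun x => 3 * (w x * ‖schrodingerOp Ω h A V u x‖ ^ 2) +
      3 * M' ^ 2 * h ^ 2 * (h ^ 2 * (w x * ‖weakGrad Ω u x‖ ^ 2) + w x * ‖u x‖ ^ 2))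
      (volume.restrict Ω) := j1.add j4
    have := integral_mono_ae ((iV hwc ll).const_mul (h ^ 4)) j5 (by
      filter_upwards [hAM', hVM'] with x hx1 hx2
      have h3 := (norm_lap_le_schrodingerOp (Ω := Ω) (u := u) h0 hx1 hx2).1
      have h4 := mul_le_mul_of_nonneg_left h3 ((w₀pos x).le.trans (hw1 x))
      linarith only [h4])
    rwa [integral_const_mul, integral_add j1 j4, integral_const_mul, integral_const_mul,
      integral_add j2 (iV hwc lu), integral_const_mul] at this
  -- Comparison of the weights.
  have cV : ∀ {E : Type} [NormedAddCommGroup E] {f : RSpace n → E},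
      MemLp f 2 (volume.restrict Ω) →
      ∫ x in Ω, w₀ x * ‖f x‖ ^ 2 ≤ ∫ x in Ω, w x * ‖f x‖ ^ 2 := fun {E} _ {f} hf =>
    integral_mono (iV hw₀c hf) (iV hwc hf) fun x =>
      mul_le_mul_of_nonneg_right (hw1 x) (sq_nonneg _)
  have cO : ∫ x in Ω, w x * ‖schrodingerOp Ω h A V u x‖ ^ 2 ≤
      D * ∫ x in Ω, w₀ x * ‖schrodingerOp Ω h A V u x‖ ^ 2 := by
    rw [← integral_const_mul]
    refine integral_mono_ae (iV hwc lO) ((iV hw₀c lO).const_mul D) ?_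
    filter_upwards [memΩ] with x hx
    rw [← mul_assoc]
    exact mul_le_mul_of_nonneg_right (hw2 x (subset_closure hx)) (sq_nonneg _)
  have cS : ∀ {E E' : Type} [NormedAddCommGroup E] [NormedAddCommGroup E']
      {f : RSpace n → E} {g : RSpace n → E'}, MemLp f 2 (surfaceMeasure Ω) →
      MemLp g 2 (surfaceMeasure Ω) → ∫ x, w x * (‖f x‖ * ‖g x‖) ∂surfaceMeasure Ω ≤
        D * ∫ x, w₀ x * (‖f x‖ * ‖g x‖) ∂surfaceMeasure Ω := fun {E E'} _ _ {f g} hf hg => by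
    rw [← integral_const_mul]
    refine integral_mono_ae (iS' hwc.continuousOn hf hg)
      ((iS' hw₀c.continuousOn hf hg).const_mul D) ?_
    filter_upwards [memF] with x hx
    have := mul_le_mul_of_nonneg_right (hw2 x (frontier_subset_closure hx))
      (show 0 ≤ ‖f x‖ * ‖g x‖ by positivity)
    rwa [mul_assoc D] at this
  have cS2 : ∀ {E : Type} [NormedAddCommGroup E] {f : RSpace n → E},
      MemLp f 2 (surfaceMeasure Ω) → ∫ x, w x * ‖f x‖ ^ 2 ∂surfaceMeasure Ω ≤
        D * ∫ x, w₀ x * ‖f x‖ ^ 2 ∂surfaceMeasure Ω := fun {E} _ {f} hf => by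
    simpa only [sq] using cS hf hf
  -- The boundary is split according to the sign of `∂_ν φ`.
  have hp := measurableSet_boundaryPlus hΩ hb hφ
  have hm := measurableSet_boundaryMinus hΩ hb hφ
  have iν : Integrable (fun x => weightNormalDeriv Ω φ x * w₀ x * ‖normalDeriv Ω u x‖ ^ 2)
    (surfaceMeasure Ω) := iS (hν.mul hw₀c.continuousOn) lP
  have iν' : Integrable (fun x => -weightNormalDeriv Ω φ x * w₀ x * ‖normalDeriv Ω u x‖ ^ 2)
    (surfaceMeasure Ω) := iS (hν.neg.mul hw₀c.continuousOn) lP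
  have hbc : ContinuousOn b (frontier Ω) := by
    rw [show b = _ from funext hb_eq]
    have := hφ.continuous.continuousOn (s := frontier Ω)
    fun_prop
  have split : 1 / 2 * (∫ x in boundaryPlus Ω φ, weightNormalDeriv Ω φ x * w₀ x *
        ‖normalDeriv Ω u x‖ ^ 2 ∂surfaceMeasure Ω) - 3 / 2 * D * (∫ x in boundaryMinus Ω φ,
        -weightNormalDeriv Ω φ x * w₀ x * ‖normalDeriv Ω u x‖ ^ 2 ∂surfaceMeasure Ω) ≤
      ∫ x, w x * b x * ‖normalDeriv Ω u x‖ ^ 2 ∂surfaceMeasure Ω := by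
    rw [← integral_indicator hp, ← integral_indicator hm, ← integral_const_mul,
      ← integral_const_mul, ← integral_sub ((iν.indicator hp).const_mul _)
        ((iν'.indicator hm).const_mul _)]
    refine integral_mono_ae (((iν.indicator hp).const_mul _).sub
      ((iν'.indicator hm).const_mul _)) (iS (hwc.continuousOn.mul hbc) lP) ?_
    filter_upwards [memF] with x hx
    have hxc := frontier_subset_closure hx
    have hσ := abs_le.1 (habs x hxc)
    have q : 0 ≤ ‖normalDeriv Ω u x‖ ^ 2 := sq_nonneg _
    have hw1x := hw1 x
    have hw2x := hw2 x hxc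
    have hw₀x := w₀pos x
    simp only [hb_eq]
    by_cases hs : 0 ≤ weightNormalDeriv Ω φ x
    · rw [indicator_of_mem (show x ∈ boundaryPlus Ω φ from ⟨hx, hs⟩)]
      have z : (boundaryMinus Ω φ).indicator
          (fun x => -weightNormalDeriv Ω φ x * w₀ x * ‖normalDeriv Ω u x‖ ^ 2) x = 0 := by
        by_cases hx2 : x ∈ boundaryMinus Ω φ
        · rw [indicator_of_mem hx2, show weightNormalDeriv Ω φ x = 0 from le_antisymm hx2.2 hs]
          ring
        · rw [indicator_of_notMem hx2]
      rw [z, mul_zero, sub_zero, ← mul_assoc]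
      refine mul_le_mul_of_nonneg_right ?_ q
      have a1 : w₀ x * (1 / 2) ≤ w x * (1 - τ * φ x) := by
        apply mul_le_mul hw1x (by linarith) (by norm_num) (by linarith)
      have := mul_le_mul_of_nonneg_right a1 hs
      linarith only [this]
    · push Not at hs
      rw [indicator_of_notMem (fun hx2 => absurd hx2.2 (not_le.2 hs)),
        indicator_of_mem (show x ∈ boundaryMinus Ω φ from ⟨hx, hs.le⟩), mul_zero, zero_sub,
        ← neg_mul, ← mul_assoc]
      refine mul_le_mul_of_nonneg_right ?_ q
      have a1 : w x * (1 - τ * φ x) ≤ D * w₀ x * (3 / 2) := by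
        apply mul_le_mul hw2x (by linarith) (by linarith) (by positivity)
      have := mul_le_mul_of_nonneg_right a1 (neg_nonneg.2 hs.le)
      linarith only [this]
  have Im0 : 0 ≤ ∫ x in boundaryMinus Ω φ, -weightNormalDeriv Ω φ x * w₀ x *
      ‖normalDeriv Ω u x‖ ^ 2 ∂surfaceMeasure Ω := by
    refine setIntegral_nonneg hm fun x hx => ?_
    exact mul_nonneg (mul_nonneg (neg_nonneg.2 hx.2) (w₀pos x).le) (sq_nonneg _)
  have O0 : 0 ≤ ∫ x in Ω, w₀ x * ‖schrodingerOp Ω h A V u x‖ ^ 2 :=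
    integral_nonneg fun x => mul_nonneg (w₀pos x).le (sq_nonneg _)
  have J0 : ∀ {E E' : Type} [NormedAddCommGroup E] [NormedAddCommGroup E']
      (f : RSpace n → E) (g : RSpace n → E'),
        0 ≤ ∫ x, w₀ x * (‖f x‖ * ‖g x‖) ∂surfaceMeasure Ω := fun f g =>
    integral_nonneg fun x => mul_nonneg (w₀pos x).le (by positivity)
  have J02 : ∀ {E : Type} [NormedAddCommGroup E] (f : RSpace n → E),
      0 ≤ ∫ x, w₀ x * ‖f x‖ ^ 2 ∂surfaceMeasure Ω := fun f =>
    integral_nonneg fun x => mul_nonneg (w₀pos x).le (by positivity)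
  have c1 : (∫ x in Ω, w₀ x * ‖u x‖ ^ 2) ≤ ∫ x in Ω, w x * ‖u x‖ ^ 2 := cV lu
  have c2 : (∫ x in Ω, w₀ x * ‖weakGrad Ω u x‖ ^ 2) ≤ ∫ x in Ω, w x * ‖weakGrad Ω u x‖ ^ 2 := cV lg
  have d1 : (∫ x, w x * ‖trace Ω u x‖ ^ 2 ∂surfaceMeasure Ω) ≤
      D * ∫ x, w₀ x * ‖trace Ω u x‖ ^ 2 ∂surfaceMeasure Ω := cS2 lt
  have d2 : (∫ x, w x * (‖trace Ω u x‖ * ‖normalDeriv Ω u x‖) ∂surfaceMeasure Ω) ≤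
      D * ∫ x, w₀ x * (‖trace Ω u x‖ * ‖normalDeriv Ω u x‖) ∂surfaceMeasure Ω := cS lt lP
  have d3 : (∫ x, w x * ‖tangentialGrad Ω u x‖ ^ 2 ∂surfaceMeasure Ω) ≤
      D * ∫ x, w₀ x * ‖tangentialGrad Ω u x‖ ^ 2 ∂surfaceMeasure Ω := cS2 lT
  have d4 : (∫ x, w x * (‖tangentialGrad Ω u x‖ * ‖normalDeriv Ω u x‖) ∂surfaceMeasure Ω) ≤
      D * ∫ x, w₀ x * (‖tangentialGrad Ω u x‖ * ‖normalDeriv Ω u x‖) ∂surfaceMeasure Ω := cS lT lP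
  have n1 : 0 ≤ ∫ x, w₀ x * ‖trace Ω u x‖ ^ 2 ∂surfaceMeasure Ω := J02 _
  have n2 : 0 ≤ ∫ x, w₀ x * (‖trace Ω u x‖ * ‖normalDeriv Ω u x‖) ∂surfaceMeasure Ω := J0 _ _
  have n3 : 0 ≤ ∫ x, w₀ x * ‖tangentialGrad Ω u x‖ ^ 2 ∂surfaceMeasure Ω := J02 _
  have n4 : 0 ≤ ∫ x, w₀ x * (‖tangentialGrad Ω u x‖ * ‖normalDeriv Ω u x‖) ∂surfaceMeasure Ω := J0 _ _
  have I1 : 0 ≤ ∫ x in Ω, w x * ‖weakGrad Ω u x‖ ^ 2 :=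
    integral_nonneg fun x => mul_nonneg ((w₀pos x).le.trans (hw1 x)) (sq_nonneg _)
  have I2 : 0 ≤ ∫ x in Ω, w x * ‖u x‖ ^ 2 :=
    integral_nonneg fun x => mul_nonneg ((w₀pos x).le.trans (hw1 x)) (sq_nonneg _)
  generalize (∫ x in Ω, w x * ‖weakGrad Ω u x‖ ^ 2) = i1 at *
  generalize (∫ x in Ω, w x * ‖u x‖ ^ 2) = i2 at *
  generalize (∫ x in Ω, w₀ x * ‖weakGrad Ω u x‖ ^ 2) = i1' at *
  generalize (∫ x in Ω, w₀ x * ‖u x‖ ^ 2) = i2' at *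
  generalize (∫ x in Ω, w x * ‖schrodingerOp Ω h A V u x‖ ^ 2) = o at *
  generalize (∫ x in Ω, w₀ x * ‖schrodingerOp Ω h A V u x‖ ^ 2) = o' at *
  generalize (∫ x in Ω, w x * ‖weakLaplacian Ω u x‖ ^ 2) = l at *
  generalize (∫ x, w x * b x * ‖normalDeriv Ω u x‖ ^ 2 ∂surfaceMeasure Ω) = bb at *
  generalize (∫ x in boundaryPlus Ω φ, weightNormalDeriv Ω φ x * w₀ x *
        ‖normalDeriv Ω u x‖ ^ 2 ∂surfaceMeasure Ω) = bp at *
  generalize (∫ x in boundaryMinus Ω φ, -weightNormalDeriv Ω φ x * w₀ x *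
        ‖normalDeriv Ω u x‖ ^ 2 ∂surfaceMeasure Ω) = bm at *
  generalize (∫ x, w x * ‖trace Ω u x‖ ^ 2 ∂surfaceMeasure Ω) = j1 at *
  generalize (∫ x, w₀ x * ‖trace Ω u x‖ ^ 2 ∂surfaceMeasure Ω) = j1' at *
  generalize (∫ x, w x * (‖trace Ω u x‖ * ‖normalDeriv Ω u x‖) ∂surfaceMeasure Ω) = j2 at *
  generalize (∫ x, w₀ x * (‖trace Ω u x‖ * ‖normalDeriv Ω u x‖) ∂surfaceMeasure Ω) = j2' at *
  generalize (∫ x, w x * ‖tangentialGrad Ω u x‖ ^ 2 ∂surfaceMeasure Ω) = j3 at *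
  generalize (∫ x, w₀ x * ‖tangentialGrad Ω u x‖ ^ 2 ∂surfaceMeasure Ω) = j3' at *
  generalize (∫ x, w x * (‖tangentialGrad Ω u x‖ * ‖normalDeriv Ω u x‖)
    ∂surfaceMeasure Ω) = j4 at *
  generalize (∫ x, w₀ x * (‖tangentialGrad Ω u x‖ * ‖normalDeriv Ω u x‖)
    ∂surfaceMeasure Ω) = j4' at *
  have main : (3 * M' ^ 2 + 1) * (h ^ 2 * (h ^ 2 * i1 + i2)) ≤
      c / ε * h ^ 2 / (2 + 2 * K ^ 2) * (h ^ 2 * i1 + i2) := by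
    have := mul_le_mul_of_nonneg_right hε₃ (show 0 ≤ h ^ 2 * (h ^ 2 * i1 + i2) by positivity)
    refine this.trans_eq ?_
    ring
  have f1 : h ^ 2 * (i2' + h ^ 2 * i1') ≤ h ^ 2 * (h ^ 2 * i1 + i2) := by
    have : h ^ 2 * i1' ≤ h ^ 2 * i1 := by gcongr
    exact mul_le_mul_of_nonneg_left (by linarith only [this, c1]) (sq_nonneg h)
  have f2 : C₁ * (h * j1 + h ^ 2 * j2 + h ^ 3 * j3 + h ^ 3 * j4) ≤
      C₁ * (h * (D * j1') + h ^ 2 * (D * j2') + h ^ 3 * (D * j3') + h ^ 3 * (D * j4')) := by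
    gcongr
  have f3 : 2 * h ^ 3 * (1 / 2 * bp - 3 / 2 * D * bm) ≤ 2 * h ^ 3 * bb := by gcongr
  have f4 : 0 ≤ D * C₁ * (h ^ 3 * bm) := by positivity
  have f5 : 0 ≤ D * C₁ * o' := by positivity
  have f6 : 0 ≤ 3 * D * (h * j1' + h ^ 2 * j2' + h ^ 3 * j3' + h ^ 3 * j4') := by positivity
  linarith only [key, absorb, cO, main, f1, f2, f3, f4, f5, f6]

end Final

/-! ### Limiting Carleman weights -/

section LCW

/-- A smooth function near a closed set agrees near that set with a globally smooth function. -/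
theorem exists_contDiff_eventuallyEq {E : Type*} [NormedAddCommGroup E] [NormedSpace ℝ E]
    [FiniteDimensional ℝ E] {K V : Set E} (hK : IsClosed K) (hV : IsOpen V) (hKV : K ⊆ V)
    {f : E → ℝ} (hf : ContDiffOn ℝ ∞ f V) :
    ∃ F : E → ℝ, ContDiff ℝ ∞ F ∧ ∀ x ∈ K, F =ᶠ[𝓝 x] f := by
  obtain ⟨χ, h0, h1, -⟩ := exists_contMDiffMap_zero_one_nhds_of_isClosed (n := (⊤ : ℕ∞))
    (modelWithCornersSelf ℝ E) hV.isClosed_compl hK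
    (disjoint_compl_left_iff_subset.2 hKV)
  have hχ : ContDiff ℝ ∞ χ := χ.contMDiff.contDiff
  refine ⟨fun x => χ x * f x, contDiff_iff_contDiffAt.2 fun x => ?_, fun x hx => ?_⟩
  · by_cases hx : x ∈ V
    · exact hχ.contDiffAt.mul (hf.contDiffAt (hV.mem_nhds hx))
    · have : (fun x => χ x * f x) =ᶠ[𝓝 x] fun _ => 0 := by
        filter_upwards [eventually_nhdsSet_iff_forall.1 h0 x hx] with y hy
        rw [hy, zero_mul]
      exact contDiffAt_const.congr_of_eventuallyEq this
  · filter_upwards [eventually_nhdsSet_iff_forall.1 h1 x hx] with y hy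
    rw [hy, one_mul]

/-- A symmetric bilinear form `B` with `B(ξ, ξ) + B(b, b) = 0` for all `ξ ⟂ b` of the same length
as `b` is a multiple of the inner product, up to a form which vanishes on the complement of `b`. -/
theorem bilin_eq_of_forall_orthogonal {E : Type*} [NormedAddCommGroup E] [InnerProductSpace ℝ E]
    (B : E →L[ℝ] E →L[ℝ] ℝ) (hB : ∀ x y, B x y = B y x) {b : E} (hb : b ≠ 0)
    (h : ∀ ξ, ‖ξ‖ = ‖b‖ → inner ℝ b ξ = 0 → B ξ ξ + B b b = 0) (ζ : E) :
    B ζ ζ = -(B b b / ‖b‖ ^ 2) * ‖ζ‖ ^ 2 + 2 * B b ζ * inner ℝ b ζ / ‖b‖ ^ 2 := by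
  have hβ : 0 < ‖b‖ ^ 2 := by positivity
  have perp : ∀ ξ, inner ℝ b ξ = 0 → B ξ ξ = -(B b b / ‖b‖ ^ 2) * ‖ξ‖ ^ 2 := by
    intro ξ hξ
    rcases eq_or_ne ξ 0 with rfl | h0
    · simp
    have hn : 0 < ‖ξ‖ := norm_pos_iff.2 h0
    have := h ((‖b‖ / ‖ξ‖) • ξ) (by
      rw [norm_smul, Real.norm_of_nonneg (by positivity)]; field_simp)
      (by rw [inner_smul_right, hξ, mul_zero])
    simp only [map_smul, smul_apply, smul_eq_mul] at this
    have e : B ξ ξ * (‖b‖ / ‖ξ‖) ^ 2 = -B b b := by linear_combination this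
    rw [div_pow, ← mul_div_assoc, div_eq_iff (by positivity)] at e
    field_simp
    linear_combination e
  set s := inner ℝ b ζ / ‖b‖ ^ 2 with hs
  have hsb : inner ℝ b ζ = s * ‖b‖ ^ 2 := by rw [hs]; field_simp
  have h1 := perp (ζ - s • b) (by
    rw [inner_sub_right, inner_smul_right, real_inner_self_eq_norm_sq, hsb]; ring)
  have h2 : ‖ζ - s • b‖ ^ 2 = ‖ζ‖ ^ 2 - s ^ 2 * ‖b‖ ^ 2 := by
    rw [norm_sub_sq_real, inner_smul_right, norm_smul, real_inner_comm, hsb, mul_pow,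
      Real.norm_eq_abs, sq_abs]
    ring
  rw [h2] at h1
  simp only [map_sub, map_smul, sub_apply, smul_apply, smul_eq_mul, hB ζ b] at h1
  have h3 : B b b / ‖b‖ ^ 2 * ‖b‖ ^ 2 = B b b := by field_simp
  rw [mul_div_assoc, ← hs]
  linear_combination h1 + s ^ 2 * h3

variable {n : ℕ} {Ω U : Set (RSpace n)} {φ : RSpace n → ℝ} {x ξ : RSpace n}

theorem symbol_re (φ : RSpace n → ℝ) (x ξ : RSpace n) :
    (symbol φ x ξ).re = ‖ξ‖ ^ 2 - ‖gradient φ x‖ ^ 2 := by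
  simp [symbol, -Complex.ofReal_pow]

theorem symbol_im (φ : RSpace n → ℝ) (x ξ : RSpace n) :
    (symbol φ x ξ).im = 2 * inner ℝ (gradient φ x) ξ := by
  simp [symbol, -Complex.ofReal_pow]

/-- The Poisson bracket of the real and the imaginary part of the symbol, in terms of the second
derivative of the weight. -/
theorem poissonBracket_symbol (hφ : ContDiffAt ℝ 2 φ x) :
    poissonBracket (fun y η => (symbol φ y η).re) (fun y η => (symbol φ y η).im) x ξ =
      4 * fderiv ℝ (fderiv ℝ φ) x ξ ξ +
        4 * fderiv ℝ (fderiv ℝ φ) x (gradient φ x) (gradient φ x) := by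
  have hd : HasFDerivAt (fderiv ℝ φ) (fderiv ℝ (fderiv ℝ φ) x) x :=
    ((hφ.fderiv_right (m := 1) (by norm_num)).differentiableAt (by norm_num)).hasFDerivAt
  have hg : HasFDerivAt (gradient φ) ((InnerProductSpace.toDual ℝ
      (RSpace n)).symm.toContinuousLinearEquiv.toContinuousLinearMap.comp
        (fderiv ℝ (fderiv ℝ φ) x)) x :=
    (InnerProductSpace.toDual ℝ (RSpace n)).symm.toContinuousLinearEquiv.hasFDerivAt.comp x hd
  have hg' : ∀ v w, inner ℝ ((InnerProductSpace.toDual ℝ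
      (RSpace n)).symm.toContinuousLinearEquiv.toContinuousLinearMap.comp
        (fderiv ℝ (fderiv ℝ φ) x) v) w = fderiv ℝ (fderiv ℝ φ) x v w := fun v w =>
    InnerProductSpace.toDual_symm_apply
  simp only [poissonBracket, symbol_re, symbol_im]
  have e1 : gradient (fun η : RSpace n => ‖η‖ ^ 2 - ‖gradient φ x‖ ^ 2) ξ = (2 : ℝ) • ξ := by
    refine ext_inner_right ℝ fun w => ?_
    have := (HasStrictFDerivAt.hasFDerivAt (hasStrictFDerivAt_norm_sq ξ)).sub_const
      (‖gradient φ x‖ ^ 2)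
    rw [inner_gradient_left, this.fderiv]
    simp [inner_smul_left]
  have e2 : gradient (fun η : RSpace n => 2 * inner ℝ (gradient φ x) η) ξ =
      (2 : ℝ) • gradient φ x := by
    refine ext_inner_right ℝ fun w => ?_
    have := ((innerSL ℝ (gradient φ x)).hasFDerivAt (x := ξ)).const_mul 2
    rw [inner_gradient_left, show (fun η => 2 * inner ℝ (gradient φ x) η) =
      fun η => 2 * innerSL ℝ (gradient φ x) η from rfl, this.fderiv]
    simp [inner_smul_left]
  have e3 : ∀ w, inner ℝ (gradient (fun y => 2 * inner ℝ (gradient φ y) ξ) x) w =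
      2 * fderiv ℝ (fderiv ℝ φ) x w ξ := fun w => by
    have := (hg.inner ℝ (hasFDerivAt_const ξ x)).const_mul 2
    rw [inner_gradient_left, this.fderiv]
    simp only [smul_apply, smul_eq_mul, ContinuousLinearMap.comp_apply, fderivInnerCLM_apply,
      ContinuousLinearMap.prod_apply, zero_apply, inner_zero_right, zero_add]
    rw [← hg' w ξ]
    rfl
  have e4 : ∀ w, inner ℝ (gradient (fun y => ‖ξ‖ ^ 2 - ‖gradient φ y‖ ^ 2) x) w =
      -(2 * fderiv ℝ (fderiv ℝ φ) x w (gradient φ x)) := fun w => by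
    have := (hg.norm_sq).const_sub (‖ξ‖ ^ 2)
    rw [inner_gradient_left, this.fderiv]
    have h2 := hg' w (gradient φ x)
    rw [real_inner_comm] at h2
    rw [← h2]
    simp
  rw [e1, e2, real_inner_comm, e3, e4]
  simp only [map_smul, smul_apply, smul_eq_mul]
  ring

/-- At a point of the domain, a limiting Carleman weight satisfies an identity for its second
derivative. -/
theorem IsLimitingCarlemanWeight.hessian_identity (hφ : IsLimitingCarlemanWeight U φ)
    (hU : IsOpen U) (hx : x ∈ U) (ζ : RSpace n) :
    fderiv ℝ (fderiv ℝ φ) x ζ ζ =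
      -(fderiv ℝ (fderiv ℝ φ) x (gradient φ x) (gradient φ x) / ‖gradient φ x‖ ^ 2) * ‖ζ‖ ^ 2 +
        2 * fderiv ℝ (fderiv ℝ φ) x (gradient φ x) ζ * inner ℝ (gradient φ x) ζ /
          ‖gradient φ x‖ ^ 2 := by
  have h2 : ContDiffAt ℝ 2 φ x :=
    (hφ.1.contDiffAt (hU.mem_nhds hx)).of_le (WithTop.coe_le_coe.2 (le_top : (2 : ℕ∞) ≤ ⊤))
  refine bilin_eq_of_forall_orthogonal (fderiv ℝ (fderiv ℝ φ) x)
    (h2.isSymmSndFDerivAt (by simp)) (hφ.2.1 x hx) (fun ξ h1 h3 => ?_) ζ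
  have hs : symbol φ x ξ = 0 := by
    refine Complex.ext ?_ ?_
    · rw [symbol_re, h1, sub_self]; rfl
    · rw [symbol_im, h3, mul_zero]; rfl
  have := hφ.2.2 x hx ξ hs
  rw [poissonBracket_symbol h2] at this
  linarith

theorem gradient_apply (f : RSpace n → ℝ) (x : RSpace n) (i : Fin n) :
    gradient f x i = classicalPartial i f x := by
  have := inner_gradient_left f x (EuclideanSpace.single i (1 : ℝ))
  rwa [EuclideanSpace.inner_single_right, one_mul] at this

theorem gradDot_eq_inner (f g : RSpace n → ℝ) (x : RSpace n) :
    gradDot f g x = inner ℝ (gradient f x) (gradient g x) := by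
  rw [inner_gradient_left, fderiv_apply_eq_sum, gradDot]
  exact Finset.sum_congr rfl fun i _ => by rw [gradient_apply, smul_eq_mul, mul_comm]

/-- The Hessian form in coordinates agrees with the second Fréchet derivative. -/
theorem hessForm_eq (hφ : ContDiff ℝ ∞ φ) (v k : RSpace n → ℝ) (x : RSpace n) :
    hessForm φ v k x = fderiv ℝ (fderiv ℝ φ) x (gradient v x) (gradient k x) := by
  have hd : DifferentiableAt ℝ (fderiv ℝ φ) x :=
    (hφ.fderiv_right (m := ∞) (by norm_num)).differentiable (by simp) x
  have h : ∀ a b : Fin n, classicalPartial a (classicalPartial b φ) x =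
      classicalPartial a (fderiv ℝ φ) x (EuclideanSpace.single b 1) := by
    intro a b
    have := hd.hasFDerivAt.clm_apply (hasFDerivAt_const (EuclideanSpace.single b (1 : ℝ)) x)
    rw [classicalPartial, show fderiv ℝ (classicalPartial b φ) x = _ from this.fderiv]
    simp [classicalPartial]
  have e : gradient k x = ∑ j, classicalPartial j k x • EuclideanSpace.single j (1 : ℝ) := by
    conv_lhs => rw [← (EuclideanSpace.basisFun (Fin n) ℝ).sum_repr (gradient k x)]
    exact Finset.sum_congr rfl fun j _ => by simp [gradient_apply]
  rw [fderiv_apply_eq_sum, _root_.sum_apply, hessForm]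
  refine Finset.sum_congr rfl fun i _ => ?_
  rw [e, map_sum]
  refine Finset.sum_congr rfl fun j _ => ?_
  rw [h, gradient_apply, map_smul, smul_apply, smul_eq_mul, smul_eq_mul]
  ring

/-- A limiting Carleman weight near the closure of a bounded set agrees there with a globally
smooth one. -/
theorem IsLimitingCarlemanWeight.exists_isWeightPair (hφ : IsLimitingCarlemanWeight U φ)
    (hU : IsOpen U) (hbd : Bornology.IsBounded Ω) (hΩU : closure Ω ⊆ U) :
    ∃ (φ₁ κ : RSpace n → ℝ) (m : ℝ), IsWeightPair Ω φ₁ κ m ∧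
      ∀ x ∈ closure Ω, φ₁ =ᶠ[𝓝 x] φ := by
  obtain ⟨φ₁, hφ₁, heq⟩ := exists_contDiff_eventuallyEq isClosed_closure hU hΩU hφ.1
  have hβ := contDiff_gradDot hφ₁ hφ₁
  have grad : ∀ x ∈ closure Ω, gradient φ₁ x = gradient φ x := fun x hx => (heq x hx).gradient_eq
  have hess : ∀ x ∈ closure Ω, fderiv ℝ (fderiv ℝ φ₁) x = fderiv ℝ (fderiv ℝ φ) x :=
    fun x hx => (heq x hx).fderiv.fderiv_eq
  have pos : ∀ x ∈ closure Ω, 0 < gradDot φ₁ φ₁ x := fun x hx => by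
    rw [gradDot_eq_inner, grad x hx, real_inner_self_eq_norm_sq]
    have := norm_pos_iff.2 (hφ.2.1 x (hΩU hx))
    positivity
  obtain ⟨m, hm, hmle⟩ := hbd.isCompact_closure.exists_forall_le' hβ.continuous.continuousOn pos
  obtain ⟨κ, hκ, hκeq⟩ := exists_contDiff_eventuallyEq (K := closure Ω)
    (V := {x | gradDot φ₁ φ₁ x ≠ 0}) (f := fun x => hessForm φ₁ φ₁ φ₁ x / gradDot φ₁ φ₁ x)
    isClosed_closure (isOpen_ne_fun hβ.continuous continuous_const) (fun x hx => (pos x hx).ne')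
    ((contDiff_hessForm hφ₁ hφ₁ hφ₁).contDiffOn.div hβ.contDiffOn fun x hx => hx)
  have hκx : ∀ x ∈ closure Ω, κ x = hessForm φ₁ φ₁ φ₁ x / gradDot φ₁ φ₁ x := fun x hx =>
    (hκeq x hx).eq_of_nhds
  refine ⟨φ₁, κ, m, ⟨hφ₁, hκ, hm, hmle, fun x hx => ?_, fun x hx v => ?_⟩, heq⟩
  · rw [hκx x hx, div_mul_cancel₀ _ (pos x hx).ne']
  · have := hφ.hessian_identity hU (hΩU hx) (gradient v x)
    rw [← grad x hx, ← hess x hx, ← hessForm_eq hφ₁, ← hessForm_eq hφ₁, ← hessForm_eq hφ₁,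
      ← gradDot_eq_inner, ← real_inner_self_eq_norm_sq, ← real_inner_self_eq_norm_sq,
      ← gradDot_eq_inner, ← gradDot_eq_inner, ← hκx x hx] at this
    exact this

end LCW

end Carleman

end

theorem proposition3p2 (n : ℕ) (hn : 3 ≤ n)
    (Ω Ω' : Set (EuclideanSpace ℝ (Fin n)))
    (hΩ_open : IsOpen Ω) (hΩ_bdd : Bornology.IsBounded Ω) (hΩ_C2 : Carleman.HasC2Boundary Ω)
    (hΩ'_open : IsOpen Ω') (hΩΩ' : closure Ω ⊆ Ω')
    (φ : EuclideanSpace ℝ (Fin n) → ℝ) (hφ : Carleman.IsLimitingCarlemanWeight Ω' φ)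
    (M : ℝ) :
    ∃ C : ℝ, 0 < C ∧ ∃ h₀ : ℝ, 0 < h₀ ∧ ∀ h : ℝ, 0 < h → h < h₀ →
      ∀ (A : EuclideanSpace ℝ (Fin n) → EuclideanSpace ℂ (Fin n))
        (V : EuclideanSpace ℝ (Fin n) → ℂ),
        MemLp A ∞ (volume.restrict Ω) →
        eLpNorm A ∞ (volume.restrict Ω) ≤ ENNReal.ofReal M →
        MemLp V ∞ (volume.restrict Ω) →
        eLpNorm V ∞ (volume.restrict Ω) ≤ ENNReal.ofReal (M / h) →
      ∀ u : EuclideanSpace ℝ (Fin n) → ℂ, Carleman.MemH2 Ω u →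
        h ^ 2 * ((∫ x in Ω, ‖Real.exp (-φ x / h) • u x‖ ^ 2)
              + ∫ x in Ω, ‖Real.exp (-φ x / h) • (h • Carleman.weakGrad Ω u x)‖ ^ 2)
            + h ^ 3 * (∫ x in Carleman.boundaryPlus Ω φ,
                Carleman.weightNormalDeriv Ω φ x * Real.exp (-2 * φ x / h)
                  * ‖Carleman.normalDeriv Ω u x‖ ^ 2 ∂(Carleman.surfaceMeasure Ω))
          ≤ C * h * (∫ x, ‖Real.exp (-φ x / h) • Carleman.trace Ω u x‖ ^ 2
                ∂(Carleman.surfaceMeasure Ω))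
            + C * h ^ 2 * (∫ x, Real.exp (-2 * φ x / h)
                * ‖Carleman.normalDeriv Ω u x‖ * ‖Carleman.trace Ω u x‖
                ∂(Carleman.surfaceMeasure Ω))
            + C * h ^ 3 * (∫ x in Carleman.boundaryMinus Ω φ,
                (-Carleman.weightNormalDeriv Ω φ x) * Real.exp (-2 * φ x / h)
                  * ‖Carleman.normalDeriv Ω u x‖ ^ 2 ∂(Carleman.surfaceMeasure Ω))
            + C * h ^ 3 * (∫ x, ‖Real.exp (-φ x / h) • Carleman.tangentialGrad Ω u x‖ ^ 2
                ∂(Carleman.surfaceMeasure Ω))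
            + C * h ^ 3 * (∫ x, Real.exp (-2 * φ x / h)
                * ‖Carleman.tangentialGrad Ω u x‖ * ‖Carleman.normalDeriv Ω u x‖
                ∂(Carleman.surfaceMeasure Ω))
            + C * (∫ x in Ω, ‖Real.exp (-φ x / h) • Carleman.schrodingerOp Ω h A V u x‖ ^ 2) := by
  -- The estimate is applied to a global extension `φ₁` of the germ of `φ` at the closure of `Ω`; the
  -- rest of the argument matches the integrals.
  obtain ⟨φ₁, κ, m, hd, heq⟩ := hφ.exists_isWeightPair hΩ'_open hΩ_bdd hΩΩ'
  obtain ⟨C, hC, h₀, hh₀, key⟩ := hd.carleman_schrodinger hΩ_open hΩ_bdd hΩ_C2 M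
  refine ⟨C, hC, h₀, hh₀, fun h h0 hh A V hA hAM hV hVM u hu => ?_⟩
  have est := key h h0 hh A V hA hAM hV hVM u hu
  have hval : ∀ x ∈ closure Ω, φ₁ x = φ x := fun x hx => (heq x hx).eq_of_nhds
  have hnor : ∀ x ∈ frontier Ω, Carleman.weightNormalDeriv Ω φ₁ x =
      Carleman.weightNormalDeriv Ω φ x := fun x hx => by
    rw [Carleman.weightNormalDeriv, (heq x (frontier_subset_closure hx)).gradient_eq]
    rfl
  have hplus : Carleman.boundaryPlus Ω φ₁ = Carleman.boundaryPlus Ω φ :=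
    Set.ext fun x => and_congr_right fun hx => by rw [hnor x hx]
  have hminus : Carleman.boundaryMinus Ω φ₁ = Carleman.boundaryMinus Ω φ :=
    Set.ext fun x => and_congr_right fun hx => by rw [hnor x hx]
  have hmp := Carleman.measurableSet_boundaryPlus hΩ_open hΩ_C2 hd.smooth
  have hmm := Carleman.measurableSet_boundaryMinus hΩ_open hΩ_C2 hd.smooth
  rw [hplus] at hmp est
  rw [hminus] at hmm est
  have hexp : ∀ {E : Type} [NormedAddCommGroup E] [NormedSpace ℝ E] (x) (z : E),
      ‖Real.exp (-φ x / h) • z‖ ^ 2 = Real.exp (-2 * φ x / h) * ‖z‖ ^ 2 := fun x z => by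
    rw [norm_smul, mul_pow, Real.norm_of_nonneg (Real.exp_pos _).le, ← Real.exp_nat_mul]
    congr 2
    push_cast
    ring
  have vol : ∀ {E : Type} [NormedAddCommGroup E] [NormedSpace ℝ E]
      (f : EuclideanSpace ℝ (Fin n) → E), ∫ x in Ω, ‖Real.exp (-φ x / h) • f x‖ ^ 2 =
        ∫ x in Ω, Real.exp (-2 * φ₁ x / h) * ‖f x‖ ^ 2 := fun f =>
    setIntegral_congr_fun hΩ_open.measurableSet fun x hx => by
      simp only [hexp, hval x (subset_closure hx)]
  have bdy : ∀ {E : Type} [NormedAddCommGroup E] [NormedSpace ℝ E]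
      (f : EuclideanSpace ℝ (Fin n) → E),
      ∫ x, ‖Real.exp (-φ x / h) • f x‖ ^ 2 ∂Carleman.surfaceMeasure Ω =
        ∫ x, Real.exp (-2 * φ₁ x / h) * ‖f x‖ ^ 2 ∂Carleman.surfaceMeasure Ω := fun f =>
    integral_congr_ae (by
      filter_upwards [Carleman.ae_surfaceMeasure_mem_frontier (Ω := Ω)] with x hx
      rw [hexp, hval x (frontier_subset_closure hx)])
  have bdy' : ∀ {E E' : Type} [NormedAddCommGroup E] [NormedAddCommGroup E']
      (f : EuclideanSpace ℝ (Fin n) → E) (g : EuclideanSpace ℝ (Fin n) → E'),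
      ∫ x, Real.exp (-2 * φ x / h) * ‖f x‖ * ‖g x‖ ∂Carleman.surfaceMeasure Ω =
        ∫ x, Real.exp (-2 * φ₁ x / h) * (‖f x‖ * ‖g x‖) ∂Carleman.surfaceMeasure Ω := fun f g =>
    integral_congr_ae (by
      filter_upwards [Carleman.ae_surfaceMeasure_mem_frontier (Ω := Ω)] with x hx
      rw [hval x (frontier_subset_closure hx), mul_assoc])
  have hgrad : ∫ x in Ω, ‖Real.exp (-φ x / h) • (h • Carleman.weakGrad Ω u x)‖ ^ 2 =
      h ^ 2 * ∫ x in Ω, Real.exp (-2 * φ₁ x / h) * ‖Carleman.weakGrad Ω u x‖ ^ 2 := by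
    rw [vol fun x => h • Carleman.weakGrad Ω u x, ← integral_const_mul]
    refine integral_congr_ae (Eventually.of_forall fun x => ?_)
    simp only [norm_smul, Real.norm_of_nonneg h0.le]
    ring
  have hP : ∫ x in Carleman.boundaryPlus Ω φ, Carleman.weightNormalDeriv Ω φ x *
        Real.exp (-2 * φ x / h) * ‖Carleman.normalDeriv Ω u x‖ ^ 2 ∂Carleman.surfaceMeasure Ω =
      ∫ x in Carleman.boundaryPlus Ω φ, Carleman.weightNormalDeriv Ω φ₁ x *
        Real.exp (-2 * φ₁ x / h) * ‖Carleman.normalDeriv Ω u x‖ ^ 2 ∂Carleman.surfaceMeasure Ω :=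
    setIntegral_congr_fun hmp fun x hx => by
      simp only [hnor x hx.1, hval x (frontier_subset_closure hx.1)]
  have hM : ∫ x in Carleman.boundaryMinus Ω φ, (-Carleman.weightNormalDeriv Ω φ x) *
        Real.exp (-2 * φ x / h) * ‖Carleman.normalDeriv Ω u x‖ ^ 2 ∂Carleman.surfaceMeasure Ω =
      ∫ x in Carleman.boundaryMinus Ω φ, (-Carleman.weightNormalDeriv Ω φ₁ x) *
        Real.exp (-2 * φ₁ x / h) * ‖Carleman.normalDeriv Ω u x‖ ^ 2 ∂Carleman.surfaceMeasure Ω :=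
    setIntegral_congr_fun hmm fun x hx => by
      simp only [hnor x hx.1, hval x (frontier_subset_closure hx.1)]
  have sw : ∫ x, Real.exp (-2 * φ₁ x / h) * (‖Carleman.normalDeriv Ω u x‖ *
        ‖Carleman.trace Ω u x‖) ∂Carleman.surfaceMeasure Ω =
      ∫ x, Real.exp (-2 * φ₁ x / h) * (‖Carleman.trace Ω u x‖ *
        ‖Carleman.normalDeriv Ω u x‖) ∂Carleman.surfaceMeasure Ω := by
    simp only [mul_comm ‖Carleman.normalDeriv Ω u _‖]
  rw [vol u, hgrad, hP, bdy (Carleman.trace Ω u), bdy', sw, hM, bdy (Carleman.tangentialGrad Ω u),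
    bdy', vol (Carleman.schrodingerOp Ω h A V u)]
  refine est.trans_eq ?_
  ring
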